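/- Let $Y=(0,1]^3$. Let $D$ be a nonempty open set with $\overline D\subset(0,1)^3$ whose boundary is of class $C^{1,\gamma}$ for some $\gamma>0$ (so $D$ is a finite union of separated inclusions). Put $H=Y\setminus D$, and assume that the host phase $\mathbb{R}^3\setminus\bigcup_{n\in\mathbb{Z}^3}(\overline D+n)$ is simply connected (in particular connected). All fields are $\mathbb{Z}^3$-periodic and $\mathbb{C}^3$-valued. Write $(\mathbf u,\mathbf v)=\int_Y\mathbf u\cdot\overline{\mathbf v}\,dx$ and $\langle\mathbf u,\mathbf v\rangle=\int_Y\nabla\times\mathbf u\cdot\overline{\nabla\times\mathbf v}\,dx$. Let - $F(Y)$ be the space of periodic $\mathbf u\in H^1_{loc}(\mathbb{R}^3,\mathbb{C}^3)$ with $\nabla\cdot\mathbf u=0$, and $\nabla\times\mathbf u=0$ in $H$; - $W_2^0=\{\mathbf u\in F(Y):\int_Y\mathbf u\,dx=0\}$; - $\chi_0^{div}=\{\mathbf u\in F(Y):\oint\mathbf u=0\}$, where the $i$-th component of the geometric average $\oint\mathbf u\in\mathbb{C}^3$ is the line integral of $\mathbf u$ along any curve in the host phase that joins a point $x$ to $x+\mathbf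 e^i$. Let $(-\Delta_0)^{-1}\mathbf f(x)=\sum_{k\in\mathbb{Z}^3\setminus\{0\}}|2\pi k|^{-2}\,\hat{\mathbf f}(k)\,e^{2\pi i k\cdot x}$ with $\hat{\mathbf f}(k)=\int_Y\mathbf f(y)e^{-2\pi i k\cdot y}\,dy$. Let $P_2^0$ be the projection onto $W_2^0$ that is orthogonal with respect to $\langle\cdot,\cdot\rangle$: $P_2^0\mathbf w\in W_2^0$ and $\langle P_2^0\mathbf w,\mathbf v\rangle=\langle\mathbf w,\mathbf v\rangle$ for all $\mathbf v\in W_2^0$. Let $A^0(0)=P_2^0(-\Delta_0)^{-1}$; it is a well-defined bounded operator on the space $L^2_\#(0,Y,\mathbb{C}^3)$ of periodic square-integrable fields. The auxiliary problem asks for $\beta>0$ and $0\ne\mathbf u\in\chi_0^{div}$ with $(\mathbf u,\mathbf v)=\beta\langle\mathbf u,\mathbf v\rangle$ for all $\mathbf v\in\chi_0^{div}$. There is a sequence of eigenpairs $(\mathbf u_n,\beta_n)_{n\ge1}$ of it such that the $\mathbf u_n$ are orthonormal in $L^2(Y,\mathbb{C}^3)$ and have a linear span that is dense in $\chi_0^{div}$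 in the $W^{1,2}$-norm. For any such sequence, let $$\boldsymbol\mu(\nu)=I_{3\times3}+\nu\sum_{n=1}^\infty\frac{\int_Y\mathbf u_n\,dx\otimes\int_Y\overline{\mathbf u_n}\,dx}{\beta_n^{-1}-\nu},\qquad \nu\in\mathbb{C},$$ be the effective magnetic permeability tensor. Its poles are the numbers $\beta_n^{-1}$ with $\int_Y\mathbf u_n\,dx\neq0$; terms with $\int_Y\mathbf u_n\,dx=0$ are zero. **Theorem.** $$\sigma(A^0(0))=\{0\}\cup\{\beta'\}\cup\{\tilde\beta\}.$$ Here $\{\beta'\}$ is the set of those eigenvalues $\beta$ of the auxiliary problem that have an eigenfunction with mean zero over $Y$. The set $\{\tilde\beta\}$ consists of the reciprocals $\nu^{-1}$ of the roots $\nu\in\mathbb{C}$ of $\boldsymbol\mu$. If $\nu$ is not a pole of $\boldsymbol\mu$, then $\nu$ is a root if and only if $\det\boldsymbol\mu(\nu)=0$. A pole $\nu$ counts as a root if and only if there are vectors $\mathbf c(z)\in\mathbb{C}^3$, with a limit $\mathbf c_0\neq0$ as $z\to\nu$, $z\ne\nu$, such that $\boldsymbol\mu(z)\mathbf c(z)\to0$.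 -/

import Mathlib

open MeasureTheory Filter Topology
open scoped NNReal ContDiff

noncomputable section

namespace PhotonicCrystal

/-! ### Periodic fields on the unit cell -/

/-- Physical space. -/
abbrev E3 : Type := EuclideanSpace ℝ (Fin 3)

/-- Values of the vector fields. -/
abbrev C3 : Type := EuclideanSpace ℂ (Fin 3)

/-- The `i`-th unit vector of physical space. -/
def e (i : Fin 3) : E3 := EuclideanSpace.single i 1

/-- The translate of `x` by the lattice vector `n`. -/
def shift (x : E3) (n : Fin 3 → ℤ) : E3 := WithLp.toLp 2 (fun i => x i + (n i : ℝ))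

/-- The unit cell `Y = (0,1]^3`. -/
def cell : Set E3 := {x | ∀ i, 0 < x i ∧ x i ≤ 1}

/-- Lebesgue measure on the unit cell. -/
def cellMeasure : Measure E3 := volume.restrict cell

/-- The Hilbert space of periodic square integrable vector fields: a field is identified
with its restriction to the cell. -/
abbrev L2V : Type := Lp C3 2 cellMeasure

/-- The point of the cell that is congruent to `x` modulo the lattice. -/
def wrap (x : E3) : E3 := WithLp.toLp 2 (fun i => x i - (⌈x i⌉ : ℝ) + 1)

/-- The periodic extension of a field to the whole space. -/
def periodicExt (u : L2V) : E3 → C3 := fun x => u (wrap x)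

/-- The `L²` inner product of the paper: linear in the first and conjugate linear in the
second argument. -/
def l2Form (u v : L2V) : ℂ :=
  ∫ x, ∑ i, u x i * starRingEnd ℂ (v x i) ∂cellMeasure

/-- The mean `∫_Y u dx` of a field (the cell has volume one). -/
def mean (u : L2V) : C3 := ∫ x, u x ∂cellMeasure

/-! ### Periodic Sobolev fields -/

/-- A field together with three candidate partial derivatives `(u, (∂₁u, ∂₂u, ∂₃u))`. The
topology induced on `W12` below is the one of the `W^{1,2}` norm. -/
abbrev Jet : Type := L2V × (Fin 3 → L2V)

/-- Smooth periodic scalar test functions. -/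
def IsTestFunction (φ : E3 → ℂ) : Prop :=
  ContDiff ℝ ∞ φ ∧ ∀ x n, φ (shift x n) = φ x

/-- Periodic fields whose periodic extension belongs to `H¹_loc`: the pairs `(u, ∇u)` where
`∇u` is the weak gradient of the periodic field `u`. -/
def W12 : Set Jet :=
  {p | ∀ φ : E3 → ℂ, IsTestFunction φ → ∀ i j : Fin 3,
    ∫ x, p.1 x i * fderiv ℝ φ x (e j) ∂cellMeasure
      = - ∫ x, p.2 j x i * φ x ∂cellMeasure}

/-- The curl, computed from the weak gradient. -/
def curl (p : Jet) (x : E3) : C3 :=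
  !₂[p.2 1 x 2 - p.2 2 x 1, p.2 2 x 0 - p.2 0 x 2, p.2 0 x 1 - p.2 1 x 0]

/-- The divergence, computed from the weak gradient. -/
def divergence (p : Jet) (x : E3) : ℂ := ∑ j, p.2 j x j

/-- The form `⟨u, v⟩ = ∫_Y curl u · conj (curl v) dx`. -/
def curlForm (p q : Jet) : ℂ :=
  ∫ x, ∑ i, curl p x i * starRingEnd ℂ (curl q x i) ∂cellMeasure

/-- Divergence free periodic `H¹` fields of mean zero. -/
def J : Set Jet :=
  {p | p ∈ W12 ∧ (∀ᵐ x ∂cellMeasure, divergence p x = 0) ∧ mean p.1 = 0}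

/-- Fields of `J` that are curl free in the host `H = Y \ D`. -/
def W2 (D : Set E3) : Set Jet :=
  {p | p ∈ J ∧ ∀ᵐ x ∂cellMeasure, x ∉ D → curl p x = 0}

/-! ### The geometry -/

/-- The boundary of `D` is of class `C^{1,γ}`: near each of its points `D` is the set where
a `C^{1,γ}` function with nonvanishing gradient is negative. -/
def HasC1HolderBoundary (γ : ℝ≥0) (D : Set E3) : Prop :=
  ∀ x ∈ frontier D, ∃ (U : Set E3) (ρ : E3 → ℝ), IsOpen U ∧ x ∈ U ∧
    ContDiffOn ℝ 1 ρ U ∧ (∃ K : ℝ≥0, HolderOnWith K γ (fderiv ℝ ρ) U) ∧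
    fderiv ℝ ρ x ≠ 0 ∧ D ∩ U = {y ∈ U | ρ y < 0}

/-- The host phase in the whole space: the complement of all lattice translates of the
closure of `D`. -/
def host (D : Set E3) : Set E3 := {x | ∀ n : Fin 3 → ℤ, shift x n ∉ closure D}

/-- The admissible inclusions: `D` is a nonempty open set, compactly contained in the open
cell, with `C^{1,γ}` boundary (such a set has finitely many components and their closures
are pairwise disjoint), and the surrounding host phase is simply connected, in particular
connected. -/
structure IsInclusion (γ : ℝ≥0) (D : Set E3) : Prop where
  isOpen : IsOpen D
  nonempty : D.Nonempty
  closure_subset : closure D ⊆ {x | ∀ i, 0 < x i ∧ x i < 1}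
  boundary : HasC1HolderBoundary γ D
  host_simplyConnected : IsSimplyConnected (host D)

/-! ### The operator `A⁰(0) = P₂⁰ (-Δ₀)⁻¹` -/

/-- The function `x ↦ exp (2πi k·x)`. -/
def character (k : Fin 3 → ℤ) (x : E3) : ℂ :=
  Complex.exp (2 * Real.pi * Complex.I * ((∑ i, (k i : ℝ) * x i : ℝ) : ℂ))

lemma norm_character (k : Fin 3 → ℤ) (x : E3) : ‖character k x‖ = 1 := by
  unfold character
  rw [show (2 * Real.pi * Complex.I * ((∑ i, (k i : ℝ) * x i : ℝ) : ℂ))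
    = ((2 * Real.pi * ∑ i, (k i : ℝ) * x i : ℝ) : ℂ) * Complex.I by push_cast; ring]
  exact Complex.norm_exp_ofReal_mul_I _

lemma continuous_character (k : Fin 3 → ℤ) : Continuous (character k) := by
  unfold character
  fun_prop

instance : IsFiniteMeasure cellMeasure := by
  refine ⟨?_⟩
  have hb : Bornology.IsBounded cell := by
    refine (Metric.isBounded_closedBall (x := (0 : E3)) (r := √3)).subset ?_
    intro x hx
    rw [mem_closedBall_zero_iff, EuclideanSpace.norm_eq]
    refine Real.sqrt_le_sqrt ?_
    have h : ∀ i, ‖x i‖ ^ 2 ≤ 1 := fun i => by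
      have := hx i
      rw [Real.norm_eq_abs, sq_abs]
      nlinarith
    calc ∑ i, ‖x i‖ ^ 2 ≤ ∑ _i : Fin 3, (1 : ℝ) := Finset.sum_le_sum fun i _ => h i
      _ = 3 := by simp
  rw [cellMeasure, Measure.restrict_apply_univ]
  exact hb.measure_lt_top

lemma memLp_wave (k : Fin 3 → ℤ) (a : C3) :
    MemLp (fun x => character k x • a) 2 cellMeasure := by
  refine MemLp.of_bound
    ((continuous_character k).smul continuous_const).aestronglyMeasurable ‖a‖ ?_
  refine Eventually.of_forall fun x => ?_
  rw [norm_smul, norm_character, one_mul]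

/-- The plane wave `x ↦ exp (2πi k·x) a`. -/
def wave (k : Fin 3 → ℤ) (a : C3) : L2V := (memLp_wave k a).toLp _

/-- The operator `f ↦ -∫_Y G⁰(·,y) f(y) dy` with the periodic Green's function
`G⁰(x,y) = - ∑_{k ≠ 0} exp (2πi k·(x-y)) / |2πk|²`; that is, the series
`∑_{k ≠ 0} |2πk|⁻² (∫_Y f(y) exp (-2πi k·y) dy) exp (2πi k·x)`. -/
def invLaplacian (f : L2V) : L2V :=
  ∑' k : {k : Fin 3 → ℤ // k ≠ 0},
    wave k.1 ((((2 * Real.pi) ^ 2 * ∑ i, (k.1 i : ℝ) ^ 2)⁻¹ : ℝ) •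
      ∫ y, starRingEnd ℂ (character k.1 y) • f y ∂cellMeasure)

/-- `p` is the projection of `w` to `W2 D`, orthogonal with respect to the curl form. -/
def IsProjW2 (D : Set E3) (w p : Jet) : Prop :=
  p ∈ W2 D ∧ ∀ v ∈ W2 D, curlForm p v = curlForm w v

/-- The bounded operator `A` on `L2V` is the limit operator `A⁰(0) = P₂⁰ (-Δ₀)⁻¹`. -/
def IsLimitOperator (D : Set E3) (A : L2V →L[ℂ] L2V) : Prop :=
  ∀ f : L2V, ∃ w ∈ W12, w.1 = invLaplacian f ∧ ∃ p : Jet, IsProjW2 D w p ∧ A f = p.1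

/-! ### The auxiliary eigenvalue problem -/

/-- Divergence free periodic `H¹` fields that are curl free in the host `H = Y \ D`. -/
def F (D : Set E3) : Set Jet :=
  {p | p ∈ W12 ∧ (∀ᵐ x ∂cellMeasure, divergence p x = 0) ∧
    ∀ᵐ x ∂cellMeasure, x ∉ D → curl p x = 0}

/-- The line integral of the periodic field `u` along the curve `Γ t`, `0 ≤ t ≤ 1`. -/
def lineIntegral (u : L2V) (Γ : ℝ → E3) : ℂ :=
  ∫ t in (0 : ℝ)..1, ∑ j, periodicExt u (Γ t) j * ((deriv Γ t j : ℝ) : ℂ)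

/-- The geometric average of `u` is `c`: the line integral of `u` along any `C¹` curve in
the host that joins a point `x` to the opposite point `x + eᵢ` is `cᵢ`. Since `u` is only
determined almost everywhere, the integral is taken along almost every translate of the
curve; where `u` is continuous (a field of `F D` is harmonic, hence smooth, in the host)
this is the same as the integral along every curve. -/
def HasGeometricAverage (D : Set E3) (u : L2V) (c : C3) : Prop :=
  ∀ (i : Fin 3) (Γ : ℝ → E3), ContDiff ℝ 1 Γ → Γ 1 = Γ 0 + e i →
    ∀ᵐ y : E3, (∀ t ∈ Set.Icc (0 : ℝ) 1, Γ t + y ∈ host D) →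
      lineIntegral u (fun t => Γ t + y) = c i

/-- The fields of `F D` with vanishing geometric average. -/
def chi0 (D : Set E3) : Set Jet := {p | p ∈ F D ∧ HasGeometricAverage D p.1 0}

/-- `(u, β)` is an eigenpair of the auxiliary problem: `β > 0`, `0 ≠ u ∈ chi0 D` and
`(u, v) = β ⟨u, v⟩` for all `v ∈ chi0 D`. -/
def IsEigenpair (D : Set E3) (u : Jet) (β : ℝ) : Prop :=
  0 < β ∧ u ∈ chi0 D ∧ u.1 ≠ 0 ∧ ∀ v ∈ chi0 D, l2Form u.1 v.1 = β * curlForm u v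

/-- A sequence of eigenpairs of the auxiliary problem whose eigenfunctions are orthonormal
in `L²` and span a dense subspace of `chi0 D` for the `W^{1,2}` norm. -/
structure EigenSystem (D : Set E3) where
  u : ℕ → Jet
  β : ℕ → ℝ
  eigenpair : ∀ n, IsEigenpair D (u n) (β n)
  orthonormal : Orthonormal ℂ (fun n => (u n).1)
  dense : chi0 D ⊆ closure (Submodule.span ℂ (Set.range u) : Set Jet)

/-- The numbers `β'`: eigenvalues of the auxiliary problem that have an eigenfunction of
mean zero. -/
def meanZeroEigenvalues (D : Set E3) : Set ℝ :=
  {β | ∃ u : Jet, IsEigenpair D u β ∧ mean u.1 = 0}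

/-! ### The effective magnetic permeability -/

/-- The effective magnetic permeability tensor
`I + ν ∑ₙ (∫ uₙ ⊗ ∫ conj uₙ) / (βₙ⁻¹ - ν)`. It is meaningful when `ν` is not a pole; then
all terms with `βₙ⁻¹ = ν` have numerator zero. -/
def permeability {D : Set E3} (S : EigenSystem D) (ν : ℂ) : Matrix (Fin 3) (Fin 3) ℂ :=
  fun i j => (if i = j then 1 else 0) +
    ν * ∑' n, (mean (S.u n).1 i * starRingEnd ℂ (mean (S.u n).1 j)) /
      (((S.β n)⁻¹ : ℝ) - ν)

/-- `ν` is a pole of the permeability tensor: some term with nonzero numerator has a zero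
denominator. -/
def IsPole {D : Set E3} (S : EigenSystem D) (ν : ℂ) : Prop :=
  ∃ n, (((S.β n)⁻¹ : ℝ) : ℂ) = ν ∧ mean (S.u n).1 ≠ 0

/-- `ν` is a root of the permeability tensor. Away from the poles this means
`det μ(ν) = 0`. A pole `ν` counts as a root if the tensor also has a null vector there, as
a limit: there are vectors `c(z)` with a limit `c₀ ≠ 0` as `z → ν`, `z ≠ ν`, and
`μ(z) c(z) → 0`. -/
def IsRoot {D : Set E3} (S : EigenSystem D) (ν : ℂ) : Prop :=
  (¬ IsPole S ν ∧ (permeability S ν).det = 0) ∨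
  (IsPole S ν ∧ ∃ (c : ℂ → Fin 3 → ℂ) (c₀ : Fin 3 → ℂ), c₀ ≠ 0 ∧
    Tendsto c (𝓝[≠] ν) (𝓝 c₀) ∧
    Tendsto (fun z => (permeability S z).mulVec (c z)) (𝓝[≠] ν) (𝓝 0))

end PhotonicCrystal

end

open MeasureTheory Filter Topology
open scoped NNReal ContDiff

noncomputable section

namespace PhotonicCrystal

/-! ### Rank three perturbations of compact self-adjoint operators -/

open Module.End

section Abstract

variable {R : Type*} [NormedAddCommGroup R] [InnerProductSpace ℂ R] [CompleteSpace R]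

local notation "⟪" x ", " y "⟫" => inner ℂ x y

/-! Everything is expressed through curls. Let R be `curlSpace D`, the closed space of divergence
free, mean zero L² fields vanishing off D, and let B be the Biot–Savart operator restricted to R. It
inverts the curl, identifies R with `W2 D`, and turns the curl form into the L² inner product of R.
The curl of (-Δ₀)⁻¹f is the Biot–Savart field of f (`curlL_of_invLaplacian`), and Biot–Savart is
symmetric, so the limit operator is BB* (`isLimitOperator_iff`, `limitOperator_apply`). It is
compact and kills constants; hence 0 lies in the spectrum, and the rest consists of the nonzero
eigenvalues of B*B on R.

The field of `chi0 D` with curl w is Bw - Gw, where Gw ∈ ℂ³ is the geometric average of Bw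
(`mem_chi0_iff`). Since Bw has mean zero, the L² form on `chi0 D` pulls back to K = B*B + G*G
(`inner_field`). So the auxiliary problem reads Kw = βw, the mean of its eigenfunction is -Gw, and
B*B = K - G*G is a perturbation of rank at most three (`auxOperator_sub`).

In an eigenbasis of K the tensor becomes μ(1/z) = I - G(K - z)⁻¹G* (`tensor_mulVec`). A solution of
(K - z)w = G*Gw either has Gw = 0, which is a mean zero eigenfunction, or gives the null vector Gw
of μ(1/z). At a pole the vector Gw needs a first order correction in z
(`tensorRoot_of_eigenvector`). Conversely, if a is not an eigenvalue of K₀ = K - G*G, then c = (I +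
G(K₀ - z)⁻¹G*)μ(1/z)c with a factor bounded near a, so μc → 0 forces c → 0
(`eigenvector_of_tensorRoot`).

It remains to extend the geometric average to a bounded map on L² (`exists_geometricAverage`). The
fields are only defined almost everywhere, so they are mollified; away from the inclusions the
mollified field is a closed one-form, and homotopy invariance applies in the simply connected host.
All radii depend on the curves only, not on the field or the kernel. Eigensystems exist because R is
infinite dimensional (`not_finiteDimensional_curlSpace`). -/

/-- The tensor `I + ν ∑ₙ (mₙ ⊗ conj mₙ) / (βₙ⁻¹ - ν)`. -/
def tensor (m : ℕ → C3) (β : ℕ → ℝ) (ν : ℂ) : Matrix (Fin 3) (Fin 3) ℂ :=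
  fun i j => (if i = j then 1 else 0) +
    ν * ∑' n, (m n i * starRingEnd ℂ (m n j)) / (((β n)⁻¹ : ℝ) - ν)

/-- The poles of `tensor m β`. -/
def TensorPole (m : ℕ → C3) (β : ℕ → ℝ) (ν : ℂ) : Prop :=
  ∃ n, (((β n)⁻¹ : ℝ) : ℂ) = ν ∧ m n ≠ 0

/-- The roots of `tensor m β`. -/
def TensorRoot (m : ℕ → C3) (β : ℕ → ℝ) (ν : ℂ) : Prop :=
  (¬ TensorPole m β ν ∧ (tensor m β ν).det = 0) ∨
  (TensorPole m β ν ∧ ∃ (c : ℂ → Fin 3 → ℂ) (c₀ : Fin 3 → ℂ), c₀ ≠ 0 ∧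
    Tendsto c (𝓝[≠] ν) (𝓝 c₀) ∧
    Tendsto (fun z => (tensor m β z).mulVec (c z)) (𝓝[≠] ν) (𝓝 0))

-- Symmetry makes the eigenvalue real, so no conjugate appears on `a`; for `n = 0` there is nothing
-- to prove, although `a` may then be any complex number.
omit [CompleteSpace R] in
lemma inner_eigenspace_left {K : R →L[ℂ] R} (hs : (K : R →ₗ[ℂ] R).IsSymmetric) {a : ℂ} {n : R}
    (hn : K n = a • n) (x : R) : ⟪n, K x⟫ = a * ⟪n, x⟫ := by
  by_cases h0 : n = 0
  · simp [h0]
  have hev : HasEigenvalue (K : R →ₗ[ℂ] R) a :=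
    hasEigenvalue_of_hasEigenvector (x := n) ⟨by simpa [mem_eigenspace_iff] using hn, h0⟩
  have h1 : starRingEnd ℂ a = a := hs.conj_eigenvalue_eq_self hev
  have h2 : ⟪K n, x⟫ = ⟪n, K x⟫ := hs n x
  rw [← h2, hn, inner_smul_left, h1]

/-- Near `a ≠ 0` the resolvent of a compact self-adjoint operator is continuous on the
orthogonal complement of the eigenspace of `a`. -/
lemma exists_reduced_resolvent {K : R →L[ℂ] R} (hK : IsCompactOperator K)
    (hs : (K : R →ₗ[ℂ] R).IsSymmetric) {a : ℂ} (ha : a ≠ 0) :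
    ∃ S : ℂ → R →L[ℂ] R, ContinuousAt S a ∧
      ∀ᶠ z in 𝓝 a, ∀ y : R, (∀ n, K n = a • n → ⟪n, y⟫ = 0) →
        K (S z y) - z • S z y = y := by
  set N := eigenspace (K : R →ₗ[ℂ] R) a with hN
  have hNm : ∀ n, n ∈ N ↔ K n = a • n := fun n => by simp [hN]
  have : FiniteDimensional ℂ N := ContinuousLinearMap.finite_dimensional_eigenspace hK a ha
  set P : R →L[ℂ] R := N.starProjection with hP
  have hPN : ∀ x, P x ∈ N := fun x => Submodule.starProjection_apply_mem N x
  have hPi : ∀ n ∈ N, ∀ x, ⟪n, P x⟫ = ⟪n, x⟫ := fun n hn x => by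
    rw [hP, ← Submodule.inner_starProjection_left_eq_right,
      Submodule.starProjection_eq_self_iff.mpr hn]
  have hPc : IsCompactOperator P := by
    have : ProperSpace N := FiniteDimensional.proper ℂ N
    have h : IsCompactOperator (N.orthogonalProjectionOnto) :=
      isCompactOperator_of_locallyCompactSpace_dom _
    exact h.clm_comp N.subtypeL
  -- Adding the projection to the eigenspace moves the eigenvalue `a` to `a + 1` and leaves `K`
  -- unchanged on the complement. So `a` becomes a regular point of a compact operator.
  set T : R →L[ℂ] R := K + P with hT
  have hTc : IsCompactOperator T := hK.add hPc
  have hres : a ∈ resolventSet ℂ T := by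
    refine (hTc.hasEigenvalue_or_mem_resolventSet ha).resolve_left fun h => ?_
    obtain ⟨x, hx, hx0⟩ := h.exists_hasEigenvector
    have hx : K x + P x = a • x := by simpa [mem_eigenspace_iff, hT] using hx
    have h1 : ⟪P x, P x⟫ = 0 := by
      have := congrArg (fun y => ⟪P x, y⟫) hx
      simp only [inner_add_right, inner_smul_right] at this
      rw [inner_eigenspace_left hs ((hNm _).1 (hPN x))] at this
      simpa using this
    have h2 : P x = 0 := inner_self_eq_zero.1 h1
    have h3 : x ∈ N := (hNm x).2 (by simpa [h2] using hx)
    exact hx0 ((Submodule.starProjection_eq_self_iff.mpr h3).symm.trans h2)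
  refine ⟨fun z => -resolvent T z, ?_, ?_⟩
  · exact (spectrum.hasDerivAt_resolvent_const_left hres).continuousAt.neg
  have e1 : ∀ᶠ z in 𝓝 a, z ∈ resolventSet ℂ T :=
    (spectrum.isOpen_resolventSet T).mem_nhds hres
  have e2 : ∀ᶠ z in 𝓝 a, a + 1 - z ≠ 0 := by
    have : ContinuousAt (fun z => a + 1 - z) a := by fun_prop
    exact this.eventually_ne (by simp)
  filter_upwards [e1, e2] with z hz1 hz2 y hy
  set x := (-resolvent T z) y with hx
  have hxy : K x + P x - z • x = y := by
    have h := congrArg (fun A : R →L[ℂ] R => A y)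
      (Ring.mul_inverse_cancel _ (spectrum.mem_resolventSet_iff.1 hz1))
    have hx' : Ring.inverse (algebraMap ℂ (R →L[ℂ] R) z - T) y = -x := by
      simp [hx, resolvent]
    rw [mul_apply_eq_comp, hx'] at h
    simp [hT, Algebra.algebraMap_eq_smul_one] at h
    rw [← h]; abel
  -- Pairing with `P x` gives `(a + 1 - z) ‖P x‖² = 0`, because `y` is orthogonal to the eigenspace.
  have hPx : P x = 0 := by
    have h1 := congrArg (fun y => ⟪P x, y⟫) hxy
    simp only [inner_add_right, inner_sub_right, inner_smul_right] at h1
    rw [hy _ ((hNm _).1 (hPN x)), inner_eigenspace_left hs ((hNm _).1 (hPN x)),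
      ← hPi _ (hPN x)] at h1
    have h2 : (a + 1 - z) * ⟪P x, P x⟫ = 0 := by linear_combination h1
    exact inner_self_eq_zero.1 ((mul_eq_zero.1 h2).resolve_left hz2)
  simpa [hPx] using hxy

variable {K : R →L[ℂ] R} {G : R →L[ℂ] C3} {ψ : HilbertBasis ℕ ℂ R} {β : ℕ → ℝ} {m : ℕ → C3}

lemma coord_apply (G : R →L[ℂ] C3) (w : R) (i : Fin 3) :
    G w i = ⟪G.adjoint (EuclideanSpace.single i 1), w⟫ := by
  rw [ContinuousLinearMap.adjoint_inner_left, EuclideanSpace.inner_single_left]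
  simp

/-- The tensor expressed by the resolvent of `K`, entrywise. -/
lemma tensor_apply (hs : (K : R →ₗ[ℂ] R).IsSymmetric) (hβ : ∀ n, β n ≠ 0)
    (hψ : ∀ n, K (ψ n) = (β n : ℂ) • ψ n)
    (hm : ∀ n i j, m n i * starRingEnd ℂ (m n j) =
      ((β n : ℂ))⁻¹ * (G (ψ n) i * starRingEnd ℂ (G (ψ n) j)))
    {z : ℂ} (hz : z ≠ 0) {w : Fin 3 → R}
    (hw : ∀ j, K (w j) - z • w j = G.adjoint (EuclideanSpace.single j 1)) (i j : Fin 3) :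
    tensor m β z⁻¹ i j = (if i = j then 1 else 0) - G (w j) i := by
  have h1 := ψ.hasSum_inner_mul_inner (G.adjoint (EuclideanSpace.single i 1)) (w j)
  rw [← coord_apply] at h1
  -- Pairing the resolvent equation with `ψ n`.
  have hc : ∀ n j, ((β n : ℂ) - z) * ⟪ψ n, w j⟫ = starRingEnd ℂ (G (ψ n) j) := by
    intro n j
    have h := congrArg (fun y => ⟪ψ n, y⟫) (hw j)
    simp only [inner_sub_right, inner_smul_right] at h
    rw [inner_eigenspace_left hs (hψ n)] at h
    rw [coord_apply, inner_conj_symm, ← h]; ring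
  have h2 : ∀ n, z⁻¹ * ((m n i * starRingEnd ℂ (m n j)) / (((β n)⁻¹ : ℝ) - z⁻¹)) =
      -(⟪G.adjoint (EuclideanSpace.single i 1), ψ n⟫ * ⟪ψ n, w j⟫) := by
    intro n
    rw [← coord_apply, hm, ← hc n j]
    have hb : (β n : ℂ) ≠ 0 := by exact_mod_cast hβ n
    -- Solvability at `z = β n` forces `G (ψ n) = 0`, so the term whose denominator vanishes is zero
    -- on both sides.
    by_cases hbz : (β n : ℂ) = z
    · have h0 : starRingEnd ℂ (G (ψ n) i) = 0 := by rw [← hc n i, hbz]; simp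
      have h0 : G (ψ n) i = 0 := by simpa using h0
      simp [h0]
    · have hbz' : (β n : ℂ) - z ≠ 0 := sub_ne_zero.2 hbz
      have h3 : (((β n)⁻¹ : ℝ) : ℂ) - z⁻¹ = -((β n : ℂ) - z) / (β n * z) := by
        push_cast; field_simp; ring
      rw [h3]
      field_simp
  rw [tensor, ← tsum_mul_left, tsum_congr h2, tsum_neg, h1.tsum_eq, ← sub_eq_add_neg]

/-- The tensor expressed by the resolvent of `K`. -/
lemma tensor_mulVec (hs : (K : R →ₗ[ℂ] R).IsSymmetric) (hβ : ∀ n, β n ≠ 0)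
    (hψ : ∀ n, K (ψ n) = (β n : ℂ) • ψ n)
    (hm : ∀ n i j, m n i * starRingEnd ℂ (m n j) =
      ((β n : ℂ))⁻¹ * (G (ψ n) i * starRingEnd ℂ (G (ψ n) j)))
    {z : ℂ} (hz : z ≠ 0) {w : Fin 3 → R}
    (hw : ∀ j, K (w j) - z • w j = G.adjoint (EuclideanSpace.single j 1))
    (c : C3) {x : R} (hx : K x - z • x = G.adjoint c) :
    (tensor m β z⁻¹).mulVec (WithLp.ofLp c) = WithLp.ofLp (c - G x) := by
  have hcsum : c = ∑ j, c j • EuclideanSpace.single j (1 : ℂ) := by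
    ext i; simp [Finset.sum_apply, Pi.single_apply]
  -- `K - z` need not be injective. Two solutions differ by a `d` in its kernel, and `G d = 0`
  -- because the vectors `G* eⱼ` lie in the range of `K - z`.
  set d := x - ∑ j, c j • w j with hd
  have hker : K d = z • d := by
    rw [← sub_eq_zero]
    have : K (∑ j, c j • w j) - z • (∑ j, c j • w j) = G.adjoint c := by
      conv_rhs => rw [hcsum]
      simp only [map_sum, map_smul, ← hw, Finset.smul_sum, smul_sub, Finset.sum_sub_distrib]
      congr 1
      exact Finset.sum_congr rfl fun j _ => smul_comm _ _ _
    rw [hd, map_sub, smul_sub, ← sub_eq_zero.2 (hx.trans this.symm)]; abel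
  have hGd : G d = 0 := by
    ext i
    rw [coord_apply, ← hw, ← inner_conj_symm, inner_sub_right, inner_eigenspace_left hs hker,
      inner_smul_right]
    simp
  have hGx : G x = ∑ j, c j • G (w j) := by
    rw [hd, map_sub, sub_eq_zero] at hGd
    simp [hGd]
  ext i
  simp only [Matrix.mulVec, dotProduct, tensor_apply hs hβ hψ hm hz hw, hGx]
  simp only [sub_mul, Finset.sum_sub_distrib]
  simp [mul_comm]

/-- Away from the poles the right hand sides `G* c` are orthogonal to the eigenspace. -/
lemma inner_adjoint_eq_zero_of_not_pole (hs : (K : R →ₗ[ℂ] R).IsSymmetric) (hβ : ∀ n, β n ≠ 0)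
    (hψ : ∀ n, K (ψ n) = (β n : ℂ) • ψ n)
    (hm : ∀ n i j, m n i * starRingEnd ℂ (m n j) =
      ((β n : ℂ))⁻¹ * (G (ψ n) i * starRingEnd ℂ (G (ψ n) j)))
    {a : ℂ} (hp : ¬ TensorPole m β a⁻¹) {n : R} (hn : K n = a • n) (c : C3) :
    ⟪n, G.adjoint c⟫ = 0 := by
  have hGψ : ∀ k, (β k : ℂ) = a → G (ψ k) = 0 := by
    intro k hk
    have hmk : m k = 0 := by
      by_contra h
      exact hp ⟨k, by rw [← hk]; push_cast; rfl, h⟩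
    ext i
    have h := hm k i i
    rw [hmk] at h
    have hb : (β k : ℂ) ≠ 0 := by exact_mod_cast hβ k
    simpa [hb] using h
  rw [ContinuousLinearMap.adjoint_inner_right]
  suffices G n = 0 by simp [this]
  ext i
  have h1 := ψ.hasSum_inner_mul_inner (G.adjoint (EuclideanSpace.single i 1)) n
  rw [← coord_apply] at h1
  -- In the expansion of `G n` every term vanishes: either `β k = a` and `G (ψ k) = 0`, or `ψ k` is
  -- orthogonal to `n`.
  refine (h1.congr_fun fun k => ?_ : HasSum (fun _ : ℕ => (0 : ℂ)) _).unique hasSum_zero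
  symm
  by_cases hk : (β k : ℂ) = a
  · rw [← coord_apply, hGψ k hk]; simp
  · have h2 := inner_eigenspace_left hs (hψ k) n
    rw [hn, inner_smul_right] at h2
    have h3 : ((β k : ℂ) - a) * ⟪ψ k, n⟫ = 0 := by linear_combination -h2
    rw [(mul_eq_zero.1 h3).resolve_left (sub_ne_zero.2 hk), mul_zero]

/-- Punctured neighbourhoods of `a ≠ 0` contain no eigenvalue of `K`. -/
lemma eventually_solvable (hK : IsCompactOperator K)
    (hs : (K : R →ₗ[ℂ] R).IsSymmetric) {a : ℂ} (ha : a ≠ 0) :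
    ∀ᶠ z in 𝓝[≠] a, ∀ y : R, ∃ w, K w - z • w = y := by
  obtain ⟨S, -, hS⟩ := exists_reduced_resolvent hK hs ha
  set N := eigenspace (K : R →ₗ[ℂ] R) a with hN
  have hNm : ∀ n, n ∈ N ↔ K n = a • n := fun n => by simp [hN]
  have : FiniteDimensional ℂ N := ContinuousLinearMap.finite_dimensional_eigenspace hK a ha
  filter_upwards [hS.filter_mono nhdsWithin_le_nhds, self_mem_nhdsWithin] with z hz hza y
  have hza : a - z ≠ 0 := sub_ne_zero.2 (Ne.symm hza)
  have h1 := hz (y - N.starProjection y) fun n hn => by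
    exact Submodule.sub_starProjection_mem_orthogonal (K := N) y n ((hNm n).2 hn)
  -- On the eigenspace `K - z` is multiplication by `a - z`; on its complement the reduced resolvent
  -- inverts it.
  refine ⟨(a - z)⁻¹ • N.starProjection y + S z (y - N.starProjection y), ?_⟩
  rw [map_add, map_smul, (hNm _).1 (Submodule.starProjection_apply_mem N y), smul_add,
    show ∀ p q r s : R, p + q - (r + s) = (p - r) + (q - s) from fun _ _ _ _ => by abel, h1,
    smul_comm z, ← smul_sub, ← sub_smul, smul_smul, inv_mul_cancel₀ hza]
  simp

/-- For an operator `X` of finite rank, `X X*` has the same range as `X`. -/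
lemma exists_self_adjoint_apply (X : R →L[ℂ] C3) (x : R) : ∃ d, X (X.adjoint d) = X x := by
  set V := LinearMap.range ((X ∘L X.adjoint : C3 →L[ℂ] C3) : C3 →ₗ[ℂ] C3) with hV
  suffices X x ∈ V by
    obtain ⟨d, hd⟩ := this
    exact ⟨d, hd⟩
  -- A vector `y` orthogonal to the range of `X X*` satisfies `‖X* y‖² = 0`, hence is orthogonal to
  -- the range of `X`.
  rw [← Submodule.orthogonal_orthogonal V]
  intro y hy
  have h1 : ⟪X (X.adjoint y), y⟫ = 0 := hy _ ⟨y, rfl⟩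
  rw [← ContinuousLinearMap.adjoint_inner_right] at h1
  rw [← ContinuousLinearMap.adjoint_inner_left, inner_self_eq_zero.1 h1, inner_zero_left]

lemma tendsto_inv_punctured {a : ℂ} (ha : a ≠ 0) :
    Tendsto (fun z : ℂ => z⁻¹) (𝓝[≠] a) (𝓝[≠] a⁻¹) :=
  tendsto_nhdsWithin_iff.2 ⟨(tendsto_inv₀ ha).mono_left nhdsWithin_le_nhds,
    eventually_nhdsWithin_of_forall fun _ hz => fun h => hz (inv_injective h)⟩

/-- An eigenvector of the perturbed operator with `G w ≠ 0` gives a root of the tensor. -/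
lemma tensorRoot_of_eigenvector (hK : IsCompactOperator K)
    (hs : (K : R →ₗ[ℂ] R).IsSymmetric) (hβ : ∀ n, β n ≠ 0)
    (hψ : ∀ n, K (ψ n) = (β n : ℂ) • ψ n)
    (hm : ∀ n i j, m n i * starRingEnd ℂ (m n j) =
      ((β n : ℂ))⁻¹ * (G (ψ n) i * starRingEnd ℂ (G (ψ n) j)))
    {a : ℂ} (ha : a ≠ 0) {w : R} (hw : K w - G.adjoint (G w) = a • w) (hGw : G w ≠ 0) :
    TensorRoot m β a⁻¹ := by
  obtain ⟨S, hSc, hS⟩ := exists_reduced_resolvent hK hs ha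
  have hw' : K w - a • w = G.adjoint (G w) := by rw [← hw]; abel
  by_cases hp : TensorPole m β a⁻¹
  · refine Or.inr ⟨hp, ?_⟩
    set N := eigenspace (K : R →ₗ[ℂ] R) a with hN
    have hNm : ∀ n, n ∈ N ↔ K n = a • n := fun n => by simp [hN]
    have : FiniteDimensional ℂ N := ContinuousLinearMap.finite_dimensional_eigenspace hK a ha
    set P : R →L[ℂ] R := N.starProjection with hP
    obtain ⟨d, hd⟩ := exists_self_adjoint_apply (G ∘L P) (-w)
    set p := P (G.adjoint d) with hp'
    have hGp : G p = - G (P w) := by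
      have hPP : P (P (G.adjoint d)) = P (G.adjoint d) :=
        Submodule.starProjection_eq_self_iff.mpr (Submodule.starProjection_apply_mem N _)
      have hPa : P.adjoint = P := (isSelfAdjoint_starProjection N).adjoint_eq
      rw [ContinuousLinearMap.adjoint_comp, hPa] at hd
      simpa [hPP] using hd
    set q := (G.adjoint d - p) + (w - P w) with hq
    have hqN : ∀ n, K n = a • n → ⟪n, q⟫ = 0 := fun n hn => by
      rw [hq, inner_add_right,
        Submodule.sub_starProjection_mem_orthogonal (K := N) w n ((hNm n).2 hn),
        Submodule.sub_starProjection_mem_orthogonal (K := N) (G.adjoint d) n ((hNm n).2 hn),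
        add_zero]
    have hinv := tendsto_inv_punctured (inv_ne_zero ha)
    rw [inv_inv] at hinv
    have hinv' : Tendsto (fun z : ℂ => z⁻¹) (𝓝[≠] a⁻¹) (𝓝 a) :=
      hinv.mono_right nhdsWithin_le_nhds
    -- The variable of the tensor is the reciprocal of the spectral parameter, so `z⁻¹ - a` is the
    -- small quantity here.
    refine ⟨fun z => WithLp.ofLp (G w + (z⁻¹ - a) • d), WithLp.ofLp (G w), ?_, ?_, ?_⟩
    · exact fun h => hGw (by ext i; exact congrFun h i)
    · refine ((PiLp.continuous_ofLp 2 _).tendsto (G w)).comp ?_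
      simpa using tendsto_const_nhds.add ((hinv'.sub_const a).smul_const d)
    · have hev : ∀ᶠ z in 𝓝[≠] a⁻¹,
          (tensor m β z).mulVec (WithLp.ofLp (G w + (z⁻¹ - a) • d)) =
            WithLp.ofLp ((z⁻¹ - a) • (d - G (S z⁻¹ q))) := by
        have e1 := hinv'.eventually hS
        have e2 := hinv.eventually (eventually_solvable hK hs ha)
        have e3 : ∀ᶠ z in 𝓝[≠] a⁻¹, z⁻¹ ≠ 0 := hinv'.eventually_ne ha
        filter_upwards [e1, e2, e3] with z h1 h2 h3
        choose W hW using fun j => h2 (G.adjoint (EuclideanSpace.single j 1))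
        have h4 := h1 q hqN
        have h5 := tensor_mulVec hs hβ hψ hm h3 hW (G w + (z⁻¹ - a) • d)
          -- The three terms solve for the unperturbed part, the component in the eigenspace and the
          -- component `q` orthogonal to it.
          (x := w + (-(p + P w) + (z⁻¹ - a) • S z⁻¹ q)) ?_
        · rw [inv_inv] at h5
          rw [h5]
          congr 1
          simp only [map_add, map_neg, map_smul, hGp, smul_sub]
          generalize G (S z⁻¹ q) = y
          abel
        · have hKp : K p = a • p := (hNm _).1 (Submodule.starProjection_apply_mem N _)
          have hKw : K (P w) = a • P w := (hNm _).1 (Submodule.starProjection_apply_mem N _)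
          have hKw' : K w = G.adjoint (G w) + a • w := by rw [← hw']; abel
          have hKS := sub_eq_iff_eq_add.1 h4
          have hq' : G.adjoint d = q + p - (w - P w) := by rw [hq]; abel
          simp only [map_add, map_neg, map_smul, hKp, hKw, hKw', hKS, hq']
          module
      refine Tendsto.congr' (EventuallyEq.symm hev) ?_
      have h6 : Tendsto (fun z : ℂ => (z⁻¹ - a) • (d - G (S z⁻¹ q))) (𝓝[≠] a⁻¹) (𝓝 0) := by
        have h7 : Tendsto (fun z : ℂ => S z⁻¹) (𝓝[≠] a⁻¹) (𝓝 (S a)) := hSc.tendsto.comp hinv'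
        have h8 : Tendsto (fun z : ℂ => d - G (S z⁻¹ q)) (𝓝[≠] a⁻¹) (𝓝 (d - G (S a q))) :=
          tendsto_const_nhds.sub ((G.continuous.tendsto _).comp ((ContinuousLinearMap.apply ℂ R q).continuous.tendsto _ |>.comp h7))
        simpa using (hinv'.sub_const a).smul h8
      exact ((PiLp.continuous_ofLp 2 _).tendsto (0 : C3)).comp h6
  · refine Or.inl ⟨hp, ?_⟩
    have hW : ∀ j, K (S a (G.adjoint (EuclideanSpace.single j 1))) -
        a • S a (G.adjoint (EuclideanSpace.single j 1)) =
          G.adjoint (EuclideanSpace.single j 1) := fun j =>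
      hS.self_of_nhds _ fun n hn => inner_adjoint_eq_zero_of_not_pole hs hβ hψ hm hp hn _
    have h1 := tensor_mulVec hs hβ hψ hm ha hW (G w) hw'
    rw [← Matrix.exists_mulVec_eq_zero_iff]
    exact ⟨WithLp.ofLp (G w), fun h => hGw (by ext i; exact congrFun h i), by simpa using h1⟩

/-- A root of the tensor gives an eigenvector of the perturbed operator. -/
lemma eigenvector_of_tensorRoot (hK : IsCompactOperator K)
    (hs : (K : R →ₗ[ℂ] R).IsSymmetric) (hβ : ∀ n, β n ≠ 0)
    (hψ : ∀ n, K (ψ n) = (β n : ℂ) • ψ n)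
    (hm : ∀ n i j, m n i * starRingEnd ℂ (m n j) =
      ((β n : ℂ))⁻¹ * (G (ψ n) i * starRingEnd ℂ (G (ψ n) j)))
    {a : ℂ} (ha : a ≠ 0) (hr : TensorRoot m β a⁻¹) :
    ∃ w ≠ 0, K w - G.adjoint (G w) = a • w := by
  rcases hr with ⟨hp, hdet⟩ | ⟨-, c, c₀, hc₀, hc, hμ⟩
  · obtain ⟨S, -, hS⟩ := exists_reduced_resolvent hK hs ha
    have hW : ∀ y : C3, K (S a (G.adjoint y)) - a • S a (G.adjoint y) = G.adjoint y := fun j =>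
      hS.self_of_nhds _ fun n hn => inner_adjoint_eq_zero_of_not_pole hs hβ hψ hm hp hn _
    obtain ⟨v, hv0, hv⟩ := Matrix.exists_mulVec_eq_zero_iff.2 hdet
    have h1 := tensor_mulVec hs hβ hψ hm ha (fun j => hW _) (WithLp.toLp 2 v) (hW _)
    rw [WithLp.ofLp_toLp, hv] at h1
    have h2 : G (S a (G.adjoint (WithLp.toLp 2 v))) = WithLp.toLp 2 v := by
      ext i
      have := congrFun h1 i
      simp only [Pi.zero_apply, PiLp.sub_apply] at this
      exact (sub_eq_zero.1 this.symm).symm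
    refine ⟨S a (G.adjoint (WithLp.toLp 2 v)), fun h => ?_, ?_⟩
    · rw [h, map_zero] at h2
      exact hv0 (by ext i; simpa using (congrArg (fun y : C3 => y i) h2).symm)
    · rw [h2, sub_eq_iff_eq_add', ← sub_eq_iff_eq_add, hW]
  · set K₀ : R →L[ℂ] R := K - G.adjoint ∘L G with hK₀
    have hK₀c : IsCompactOperator K₀ := by
      have : IsCompactOperator G := isCompactOperator_of_locallyCompactSpace_dom G
      exact hK.sub (this.clm_comp G.adjoint)
    by_contra hno
    push Not at hno
    have hres : a ∈ resolventSet ℂ K₀ := by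
      refine (hK₀c.hasEigenvalue_or_mem_resolventSet ha).resolve_left fun h => ?_
      obtain ⟨x, hx, hx0⟩ := h.exists_hasEigenvector
      exact hno x hx0 (by simpa [hK₀] using hx)
    have hinv := tendsto_inv_punctured (inv_ne_zero ha)
    rw [inv_inv] at hinv
    have hinv' : Tendsto (fun z : ℂ => z⁻¹) (𝓝[≠] a⁻¹) (𝓝 a) :=
      hinv.mono_right nhdsWithin_le_nhds
    have hres' : Tendsto (fun z : ℂ => resolvent K₀ z⁻¹) (𝓝[≠] a⁻¹) (𝓝 (resolvent K₀ a)) :=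
      (spectrum.hasDerivAt_resolvent_const_left hres).continuousAt.tendsto.comp hinv'
    have hμ' : Tendsto (fun z => WithLp.toLp 2 ((tensor m β z).mulVec (c z))) (𝓝[≠] a⁻¹)
        (𝓝 (0 : C3)) := ((PiLp.continuous_toLp 2 _).tendsto 0).comp hμ
    have hc' : Tendsto (fun z => WithLp.toLp 2 (c z)) (𝓝[≠] a⁻¹)
        (𝓝 (WithLp.toLp 2 c₀ : C3)) := ((PiLp.continuous_toLp 2 _).tendsto c₀).comp hc
    -- Woodbury's identity: `μ c = c - G x` and `(z⁻¹ - K₀) x = -G* (c - G x)`. Thus `c` is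
    -- recovered from `μ c` through the resolvent of `K₀`, which stays continuous at `a`.
    have hev : ∀ᶠ z in 𝓝[≠] a⁻¹, WithLp.toLp 2 (c z) =
        WithLp.toLp 2 ((tensor m β z).mulVec (c z)) -
          G (resolvent K₀ z⁻¹ (G.adjoint (WithLp.toLp 2 ((tensor m β z).mulVec (c z))))) := by
      have e1 : ∀ᶠ z : ℂ in 𝓝[≠] a⁻¹, z⁻¹ ∈ resolventSet ℂ K₀ :=
        hinv'.eventually ((spectrum.isOpen_resolventSet K₀).mem_nhds hres)
      have e2 := hinv.eventually (eventually_solvable hK hs ha)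
      have e3 : ∀ᶠ z in 𝓝[≠] a⁻¹, z⁻¹ ≠ 0 := hinv'.eventually_ne ha
      filter_upwards [e1, e2, e3] with z h1 h2 h3
      choose W hW using h2
      have h5 := tensor_mulVec hs hβ hψ hm h3 (fun j => hW _) (WithLp.toLp 2 (c z)) (hW _)
      rw [inv_inv, WithLp.ofLp_toLp] at h5
      set x := W (G.adjoint (WithLp.toLp 2 (c z))) with hx
      have hxe := hW (G.adjoint (WithLp.toLp 2 (c z)))
      rw [← hx] at hxe
      have h6 : (algebraMap ℂ (R →L[ℂ] R) z⁻¹ - K₀) x =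
          - G.adjoint (WithLp.toLp 2 (c z) - G x) := by
        rw [map_sub, ← hxe]
        simp only [Algebra.algebraMap_eq_smul_one, hK₀, sub_apply,
          smul_apply, one_apply_eq_self,
          ContinuousLinearMap.comp_apply]
        abel
      have h7 : resolvent K₀ z⁻¹ ((algebraMap ℂ (R →L[ℂ] R) z⁻¹ - K₀) x) = x :=
        congrArg (fun A : R →L[ℂ] R => A x)
          (Ring.inverse_mul_cancel _ (spectrum.mem_resolventSet_iff.1 h1))
      rw [h6] at h7
      rw [h5, WithLp.toLp_ofLp]
      rw [map_neg] at h7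
      rw [neg_eq_iff_eq_neg.1 h7, map_neg]
      simp
    have hlim : Tendsto (fun z => WithLp.toLp 2 ((tensor m β z).mulVec (c z)) -
          G (resolvent K₀ z⁻¹ (G.adjoint (WithLp.toLp 2 ((tensor m β z).mulVec (c z))))))
        (𝓝[≠] a⁻¹) (𝓝 (0 : C3)) := by
      have h8 := (G.continuous.tendsto _).comp
        ((isBoundedBilinearMap_apply (𝕜 := ℂ) (E := R) (F := R)).continuous.tendsto (_, _) |>.comp
          (hres'.prodMk_nhds ((G.adjoint.continuous.tendsto _).comp hμ')))
      simpa using hμ'.sub h8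
    have h9 := tendsto_nhds_unique hc' (Tendsto.congr' (EventuallyEq.symm hev) hlim)
    exact hc₀ (by ext i; simpa using congrArg (fun y : C3 => y i) h9)

/-- The nonzero eigenvalues of the rank three perturbation `K - G* G`. -/
theorem eigenvalue_perturbation_iff (hK : IsCompactOperator K)
    (hs : (K : R →ₗ[ℂ] R).IsSymmetric) (hpos : ∀ x ≠ 0, 0 < (⟪x, K x⟫).re)
    (hβ : ∀ n, β n ≠ 0) (hψ : ∀ n, K (ψ n) = (β n : ℂ) • ψ n)
    (hm : ∀ n i j, m n i * starRingEnd ℂ (m n j) =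
      ((β n : ℂ))⁻¹ * (G (ψ n) i * starRingEnd ℂ (G (ψ n) j)))
    {a : ℂ} (ha : a ≠ 0) :
    (∃ w ≠ 0, K w - G.adjoint (G w) = a • w) ↔
      (∃ b : ℝ, 0 < b ∧ a = b ∧ ∃ w ≠ 0, K w = (b : ℂ) • w ∧ G w = 0) ∨
      ∃ ν, TensorRoot m β ν ∧ a = ν⁻¹ := by
  constructor
  · rintro ⟨w, hw0, hw⟩
    by_cases hGw : G w = 0
    · left
      have hKw : K w = a • w := by simpa [hGw] using hw
      have hev : HasEigenvalue (K : R →ₗ[ℂ] R) a :=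
        hasEigenvalue_of_hasEigenvector (x := w) ⟨by simpa [mem_eigenspace_iff] using hKw, hw0⟩
      -- Symmetry makes the eigenvalue real, and positivity of the form then gives its sign.
      have h1 : (a.re : ℂ) = a := Complex.conj_eq_iff_re.1 (hs.conj_eigenvalue_eq_self hev)
      have h2 := hpos w hw0
      rw [hKw, ← h1, inner_smul_right, inner_self_eq_norm_sq_to_K, Complex.re_ofReal_mul] at h2
      refine ⟨a.re, ?_, h1.symm, w, hw0, by rw [h1, hKw], hGw⟩
      refine pos_of_mul_pos_left h2 ?_
      have : ((‖w‖ : ℂ) ^ 2).re = ‖w‖ ^ 2 := by norm_cast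
      exact this ▸ by positivity
    · exact Or.inr ⟨a⁻¹, tensorRoot_of_eigenvector hK hs hβ hψ hm ha hw hGw, (inv_inv a).symm⟩
  · rintro (⟨b, -, rfl, w, hw0, hw, hGw⟩ | ⟨ν, hν, rfl⟩)
    · exact ⟨w, hw0, by simp [hGw, hw]⟩
    · exact eigenvector_of_tensorRoot hK hs hβ hψ hm ha (by rwa [inv_inv])

/-! ### Eigenbases of positive compact operators -/

omit [CompleteSpace R] in
-- The images of orthonormal eigenvectors with eigenvalues at least `ε` are at mutual distance at
-- least `ε`, so infinitely many of them would contradict compactness.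
lemma finite_large_eigenvalues {ι : Type*} {v : ι → R} (hv : Orthonormal ℂ v)
    (hK : IsCompactOperator K) {b : ι → ℝ} (hb : ∀ i, K (v i) = (b i : ℂ) • v i)
    {ε : ℝ} (hε : 0 < ε) : {i | ε ≤ b i}.Finite := by
  by_contra hinf
  set f := Set.Infinite.natEmbedding _ hinf
  obtain ⟨C, hC, hKC⟩ := hK.image_closedBall_subset_compact (𝕜₁ := ℂ) (f := (K : R →ₗ[ℂ] R)) 1
  obtain ⟨y, -, φ, hφ, hy⟩ := hC.tendsto_subseq (x := fun n => K (v (f n))) fun n =>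
    hKC ⟨v (f n), by simp [hv.1], rfl⟩
  obtain ⟨N, hN⟩ := Metric.cauchySeq_iff'.1 hy.cauchySeq ε hε
  have h1 := hN (N + 1) (Nat.le_succ N)
  simp only [Function.comp_apply, dist_eq_norm] at h1
  have hne : (f (φ (N + 1)) : ι) ≠ f (φ N) := fun h =>
    absurd (hφ.injective (f.injective (Subtype.ext h))) (Nat.succ_ne_self N)
  have h2 : ⟪v (f (φ (N + 1))), K (v (f (φ (N + 1)))) - K (v (f (φ N)))⟫ =
      b (f (φ (N + 1))) := by
    rw [hb, hb, inner_sub_right, inner_smul_right, inner_smul_right, hv.2 hne,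
      inner_self_eq_norm_sq_to_K, hv.1]
    simp
  have h3 := norm_inner_le_norm (𝕜 := ℂ) (v (f (φ (N + 1))))
    (K (v (f (φ (N + 1)))) - K (v (f (φ N))))
  rw [h2, hv.1, one_mul, Complex.norm_real, Real.norm_eq_abs] at h3
  have h4 : ε ≤ b (f (φ (N + 1))) := (f (φ (N + 1))).2
  linarith [le_abs_self (b (f (φ (N + 1))))]

/-- A positive compact operator on an infinite dimensional Hilbert space has an orthonormal
basis of eigenvectors. -/
theorem exists_eigenbasis (hK : IsCompactOperator K)
    (hs : (K : R →ₗ[ℂ] R).IsSymmetric) (hpos : ∀ x ≠ 0, 0 < (⟪x, K x⟫).re)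
    (hinf : ¬ FiniteDimensional ℂ R) :
    ∃ (ψ : HilbertBasis ℕ ℂ R) (β : ℕ → ℝ), (∀ n, 0 < β n) ∧
      ∀ n, K (ψ n) = (β n : ℂ) • ψ n := by
  have hcl : ∀ a : ℂ, IsClosed (eigenspace (K : R →ₗ[ℂ] R) a : Set R) := fun a => by
    have : (eigenspace (K : R →ₗ[ℂ] R) a : Set R) = {x | K x = a • x} := by
      ext x; simp
    rw [this]
    exact isClosed_eq K.continuous (continuous_const_smul a)
  have hcomp : ∀ a : ℂ, CompleteSpace (eigenspace (K : R →ₗ[ℂ] R) a) := fun a =>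
    (hcl a).completeSpace_coe
  -- The basis is the union of Hilbert bases of all eigenspaces; it is indexed by ℕ once the union
  -- is known to be infinite and countable.
  choose w b hb using fun a : ℂ => exists_hilbertBasis ℂ (eigenspace (K : R →ₗ[ℂ] R) a)
  set v : (Σ a, w a) → R := fun p => (b p.1 p.2 : eigenspace (K : R →ₗ[ℂ] R) p.1) with hv
  have hvo : Orthonormal ℂ v :=
    hs.orthogonalFamily_eigenspaces.orthonormal_sigma_orthonormal fun a => (b a).orthonormal
  have hKv : ∀ p, K (v p) = p.1 • v p := fun p =>
    mem_eigenspace_iff.1 (b p.1 p.2).2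
  have hv0 : ∀ p, v p ≠ 0 := hvo.ne_zero
  have hreal : ∀ p : Σ a, w a, (p.1.re : ℂ) = p.1 := fun p =>
    Complex.conj_eq_iff_re.1 (hs.conj_eigenvalue_eq_self
      (hasEigenvalue_of_hasEigenvector (x := v p) ⟨by simpa using hKv p, hv0 p⟩))
  have hKv' : ∀ p : Σ a, w a, K (v p) = (p.1.re : ℂ) • v p := fun p => by rw [hreal, hKv]
  have hppos : ∀ p : Σ a, w a, 0 < p.1.re := fun p => by
    have := hpos _ (hv0 p)
    rw [hKv', inner_smul_right, inner_self_eq_norm_sq_to_K, hvo.1] at this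
    simpa using this
  have hperp : (Submodule.span ℂ (Set.range v))ᗮ = ⊥ := by
    rw [eq_bot_iff, ← ContinuousLinearMap.orthogonalComplement_iSup_eigenspaces_eq_bot hK hs]
    intro x hx
    rw [Submodule.mem_orthogonal] at hx
    rw [← Submodule.iInf_orthogonal, Submodule.mem_iInf]
    intro a
    set E := eigenspace (K : R →ₗ[ℂ] R) a
    have hp : E.orthogonalProjectionOnto x = 0 := by
      rw [← (b a).repr.map_eq_zero_iff]
      ext i
      rw [(b a).repr_apply_apply, Submodule.inner_orthogonalProjectionOnto_eq_of_mem_left]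
      exact hx _ (Submodule.subset_span ⟨⟨a, i⟩, rfl⟩)
    rwa [Submodule.orthogonalProjectionOnto_eq_zero_iff] at hp
  have hι : Infinite (Σ a, w a) := by
    by_contra h
    rw [not_infinite_iff_finite] at h
    have hfd : FiniteDimensional ℂ (Submodule.span ℂ (Set.range v)) :=
      FiniteDimensional.span_of_finite ℂ (Set.finite_range v)
    rw [Submodule.orthogonal_eq_bot_iff] at hperp
    rw [hperp] at hfd
    exact hinf (Module.Finite.equiv (Submodule.topEquiv : (⊤ : Submodule ℂ R) ≃ₗ[ℂ] R))
  have hcount : Countable (Σ a, w a) := by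
    -- All eigenvalues are positive, so the index set is the union over `n` of the finite sets with
    -- eigenvalue at least `1 / (n + 1)`.
    have h1 : (Set.univ : Set (Σ a, w a)) = ⋃ n : ℕ, {p | 1 / ((n : ℝ) + 1) ≤ p.1.re} := by
      symm
      rw [Set.eq_univ_iff_forall]
      intro p
      obtain ⟨n, hn⟩ := exists_nat_one_div_lt (hppos p)
      exact Set.mem_iUnion.2 ⟨n, hn.le⟩
    rw [← Set.countable_univ_iff, h1]
    exact Set.countable_iUnion fun n =>
      (finite_large_eigenvalues hvo hK hKv' (by positivity)).countable
  obtain ⟨e⟩ := nonempty_equiv_of_countable (α := ℕ) (β := Σ a, w a)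
  have hr : Set.range (v ∘ e) = Set.range v := e.surjective.range_comp v
  refine ⟨HilbertBasis.mkOfOrthogonalEqBot (hvo.comp e e.injective) (by rw [hr, hperp]),
    fun n => (e n).1.re, fun n => hppos _, fun n => ?_⟩
  rw [HilbertBasis.coe_mkOfOrthogonalEqBot]
  exact hKv' _

end Abstract

/-! ### Fourier series of periodic fields -/

attribute [local instance] instMeasureSpaceUnitAddCircle

/-- The projection of space to the torus. -/
def toTorus (x : E3) : UnitAddTorus (Fin 3) := fun i => (x i : UnitAddCircle)

/-- The representative in the cell of a point of the torus. -/
def fromTorus (t : UnitAddTorus (Fin 3)) : E3 :=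
  WithLp.toLp 2 fun i => (AddCircle.equivIoc 1 0 (t i)).1

lemma measurableSet_cell : MeasurableSet cell := by
  have : cell = ⋂ i, {x : E3 | 0 < x i ∧ x i ≤ 1} := by ext x; simp [cell]
  rw [this]
  exact MeasurableSet.iInter fun i =>
    (measurableSet_lt (g := fun x : E3 => x i) measurable_const (by fun_prop)).inter
      (measurableSet_le (f := fun x : E3 => x i) (by fun_prop) measurable_const)

lemma measurable_toTorus : Measurable toTorus :=
  measurable_pi_lambda _ fun i => AddCircle.measurable_mk'.comp (by fun_prop)

lemma measurable_fromTorus : Measurable fromTorus := by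
  refine (WithLp.measurable_toLp 2 _).comp (measurable_pi_lambda _ fun i => ?_)
  exact measurable_subtype_coe.comp
    ((AddCircle.measurableEquivIoc 1 0).measurable.comp (measurable_pi_apply i))

lemma fromTorus_toTorus {x : E3} (hx : x ∈ cell) : fromTorus (toTorus x) = x := by
  ext i
  simp only [fromTorus, toTorus]
  exact AddCircle.equivIoc_coe_of_mem ⟨(hx i).1, by simpa using (hx i).2⟩

/-- Transports orthogonality and completeness of the characters from the torus to the cell. -/
lemma measurePreserving_toTorus : MeasurePreserving toTorus cellMeasure volume := by
  refine ⟨measurable_toTorus, ?_⟩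
  ext s hs
  rw [Measure.map_apply measurable_toTorus hs, ← lintegral_indicator_one hs,
    UnitAddTorus.lintegral_preimage _ (fun _ => 0)]
  have h := (PiLp.volume_preserving_toLp (Fin 3))
  have hc : MeasurableSet {x : Fin 3 → ℝ | ∀ i, x i ∈ Set.Ioc (0 : ℝ) (0 + 1)} :=
    MeasurableSet.univ_pi' fun i => measurableSet_Ioc
  have h2 : ∀ x : Fin 3 → ℝ, s.indicator (1 : UnitAddTorus (Fin 3) → ENNReal)
      (fun i => (x i : UnitAddCircle)) =
      ((toTorus ∘ WithLp.toLp 2) ⁻¹' s).indicator 1 x := fun x => rfl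
  simp_rw [h2]
  rw [lintegral_indicator_one ((measurable_toTorus.comp (WithLp.measurable_toLp 2 _)) hs),
    Measure.restrict_apply ((measurable_toTorus.comp (WithLp.measurable_toLp 2 _)) hs),
    cellMeasure, Measure.restrict_apply (measurable_toTorus hs),
    ← h.measure_preimage ((measurable_toTorus hs).inter measurableSet_cell).nullMeasurableSet]
  congr 1
  ext x
  simp [cell]

instance : IsProbabilityMeasure cellMeasure :=
  by
  have : IsProbabilityMeasure (volume : Measure UnitAddCircle) :=
    inferInstanceAs (IsProbabilityMeasure AddCircle.haarAddCircle)
  refine ⟨?_⟩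
  have h := measurePreserving_toTorus.measure_preimage (s := Set.univ) .univ
  rw [Set.preimage_univ] at h
  rw [h, measure_univ]

lemma mFourier_toTorus (k : Fin 3 → ℤ) (x : E3) :
    UnitAddTorus.mFourier k (toTorus x) = character k x := by
  simp only [UnitAddTorus.mFourier, toTorus, ContinuousMap.coe_mk, fourier_coe_apply, character]
  rw [← Complex.exp_sum]
  congr 1
  push_cast
  rw [Finset.mul_sum]
  refine Finset.sum_congr rfl fun i _ => ?_
  ring

lemma conj_character (k : Fin 3 → ℤ) (x : E3) :
    starRingEnd ℂ (character k x) = character (-k) x := by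
  rw [← mFourier_toTorus, ← mFourier_toTorus, UnitAddTorus.mFourier_neg]

lemma character_mul (k l : Fin 3 → ℤ) (x : E3) :
    character k x * character l x = character (k + l) x := by
  simp_rw [← mFourier_toTorus, UnitAddTorus.mFourier_add]

lemma integral_character (k : Fin 3 → ℤ) :
    ∫ x, character k x ∂cellMeasure = if k = 0 then 1 else 0 := by
  simp_rw [← mFourier_toTorus]
  rw [← integral_map (f := fun t => UnitAddTorus.mFourier k t) measurable_toTorus.aemeasurable
    (ContinuousMap.continuous _).aestronglyMeasurable, measurePreserving_toTorus.map_eq]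
  have h := orthonormal_iff_ite.1 (UnitAddTorus.orthonormal_mFourier (d := Fin 3)) 0 k
  simp only [ContinuousMap.inner_toLp, UnitAddTorus.mFourier_zero] at h
  simpa [eq_comm] using h

/-- The Fourier coefficient of a field. -/
def coeff (k : Fin 3 → ℤ) (f : L2V) : C3 :=
  ∫ y, starRingEnd ℂ (character k y) • f y ∂cellMeasure

lemma integrable_L2V (f : L2V) : Integrable f cellMeasure :=
  (Lp.memLp f).integrable (by norm_num)

lemma integrable_character_smul {F : Type*} [NormedAddCommGroup F] [NormedSpace ℂ F]
    (k : Fin 3 → ℤ) {f : E3 → F} (hf : Integrable f cellMeasure) :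
    Integrable (fun y => starRingEnd ℂ (character k y) • f y) cellMeasure := by
  refine hf.bdd_smul 1 (Complex.continuous_conj.comp
    (continuous_character k)).aestronglyMeasurable ?_
  exact Eventually.of_forall fun x => by simp [norm_character]

lemma wave_coe (k : Fin 3 → ℤ) (a : C3) :
    wave k a =ᵐ[cellMeasure] fun x => character k x • a := (memLp_wave k a).coeFn_toLp

/-- Synthesis and analysis are adjoint to each other; this identifies `coeff k` with the bounded
operator `coeffL k`. -/
lemma inner_wave_left (k : Fin 3 → ℤ) (a : C3) (f : L2V) :
    inner ℂ (wave k a) f = inner ℂ a (coeff k f) := by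
  rw [L2.inner_def, coeff, ← integral_inner (integrable_character_smul k (integrable_L2V f))]
  refine integral_congr_ae ?_
  filter_upwards [wave_coe k a] with x hx
  rw [hx, inner_smul_left, inner_smul_right]

lemma coeff_wave (k l : Fin 3 → ℤ) (a : C3) :
    coeff k (wave l a) = if l = k then a else 0 := by
  have h : coeff k (wave l a) = ∫ x, character (l - k) x • a ∂cellMeasure := by
    refine integral_congr_ae ?_
    filter_upwards [wave_coe l a] with x hx
    rw [hx, conj_character, smul_smul, character_mul, neg_add_eq_sub]
  rw [h, integral_smul_const, integral_character]
  simp [sub_eq_zero]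

/-- The plane waves with wave vector `k`. -/
def waveL (k : Fin 3 → ℤ) : C3 →ₗᵢ[ℂ] L2V where
  toFun := wave k
  map_add' a b := by
    unfold wave
    rw [← MemLp.toLp_add]
    exact MemLp.toLp_congr _ _ (Eventually.of_forall fun x => smul_add _ _ _)
  map_smul' c a := by
    unfold wave
    rw [RingHom.id_apply, ← MemLp.toLp_const_smul]
    exact MemLp.toLp_congr _ _ (Eventually.of_forall fun x => smul_comm _ _ _)
  norm_map' a := by
    have h := inner_wave_left k a (wave k a)
    rw [coeff_wave, if_pos rfl, inner_self_eq_norm_sq_to_K, inner_self_eq_norm_sq_to_K] at h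
    have h' : ‖wave k a‖ ^ 2 = ‖a‖ ^ 2 := by exact_mod_cast h
    exact (sq_eq_sq₀ (norm_nonneg _) (norm_nonneg _)).1 h'

@[simp] lemma waveL_apply (k : Fin 3 → ℤ) (a : C3) : waveL k a = wave k a := rfl

/-- The Fourier coefficient as a continuous linear map. -/
def coeffL (k : Fin 3 → ℤ) : L2V →L[ℂ] C3 := (waveL k).toContinuousLinearMap.adjoint

lemma coeffL_apply (k : Fin 3 → ℤ) (f : L2V) : coeffL k f = coeff k f := by
  refine ext_inner_left ℂ fun a => ?_
  rw [coeffL, ContinuousLinearMap.adjoint_inner_right]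
  exact inner_wave_left k a f

lemma coeff_apply (k : Fin 3 → ℤ) (f : L2V) (i : Fin 3) :
    coeff k f i = ∫ y, starRingEnd ℂ (character k y) * f y i ∂cellMeasure := by
  have h := (EuclideanSpace.proj (𝕜 := ℂ) i).integral_comp_comm
    (integrable_character_smul k (integrable_L2V f))
  simpa [coeff] using h.symm

/-- Each component, moved to the torus through the representative in the cell, has zero coordinates
in the Fourier basis of `L²` of the torus. -/
lemma eq_zero_of_coeff_eq_zero {f : L2V} (hf : ∀ k, coeff k f = 0) : f = 0 := by
  have hi : ∀ i, ∀ᵐ x ∂cellMeasure, f x i = 0 := by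
    intro i
    set h : UnitAddTorus (Fin 3) → ℂ := fun t => f (fromTorus t) i with hh
    have hfm : StronglyMeasurable fun x => f x i :=
      (EuclideanSpace.proj (𝕜 := ℂ) i).continuous.comp_stronglyMeasurable (Lp.stronglyMeasurable f)
    have hm : StronglyMeasurable h := hfm.comp_measurable measurable_fromTorus
    have hcomp : ∀ᵐ x ∂cellMeasure, h (toTorus x) = f x i := by
      filter_upwards [ae_restrict_mem measurableSet_cell] with x hx
      rw [hh]; simp only; rw [fromTorus_toTorus hx]
    have hL : MemLp h 2 volume := by
      rw [← measurePreserving_toTorus.map_eq,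
        memLp_map_measure_iff (by rw [measurePreserving_toTorus.map_eq]; exact hm.aestronglyMeasurable)
          measurable_toTorus.aemeasurable]
      refine MemLp.ae_eq (EventuallyEq.symm hcomp) ?_
      exact (EuclideanSpace.proj (𝕜 := ℂ) i).comp_memLp' (Lp.memLp f)
    have h0 : hL.toLp h = 0 := by
      apply UnitAddTorus.mFourierBasis.repr.injective
      rw [map_zero]
      ext k
      rw [UnitAddTorus.mFourierBasis_repr]
      have h1 := congrArg (fun v : C3 => v i) (hf k)
      simp only [coeff_apply] at h1
      have h2 : UnitAddTorus.mFourierCoeff (hL.toLp h) k =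
          ∫ t, UnitAddTorus.mFourier (-k) t * h t := by
        refine integral_congr_ae ?_
        filter_upwards [hL.coeFn_toLp] with t ht
        rw [ht, smul_eq_mul]
      rw [h2, ← measurePreserving_toTorus.map_eq, integral_map measurable_toTorus.aemeasurable]
      · simp only [lp.coeFn_zero, Pi.zero_apply]
        refine Eq.trans (integral_congr_ae ?_) h1
        filter_upwards [hcomp] with x hx
        rw [hx, mFourier_toTorus, conj_character]
      · exact ((ContinuousMap.continuous _).stronglyMeasurable.mul hm).aestronglyMeasurable
    have h3 : h =ᵐ[volume] 0 := (hL.coeFn_toLp.symm.trans (by rw [h0])).trans (Lp.coeFn_zero _ _ _)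
    have h4 := measurePreserving_toTorus.quasiMeasurePreserving.ae h3
    filter_upwards [h4, hcomp] with x hx hx'
    rw [← hx', hx]; rfl
  rw [Lp.eq_zero_iff_ae_eq_zero]
  filter_upwards [ae_all_iff.2 hi] with x hx
  ext i
  exact hx i

/-- The source of Parseval's identity, of the Fourier expansion and of the Riesz–Fischer theorem for
vector fields. -/
lemma isHilbertSum_waveL : IsHilbertSum ℂ (fun _ : Fin 3 → ℤ => C3) waveL := by
  refine IsHilbertSum.mk (fun k l hkl a b => ?_) ?_
  · rw [waveL_apply, waveL_apply, inner_wave_left, coeff_wave, if_neg hkl.symm, inner_zero_right]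
  · rw [top_le_iff, Submodule.topologicalClosure_eq_top_iff, eq_bot_iff]
    intro f hf
    rw [Submodule.mem_bot]
    refine eq_zero_of_coeff_eq_zero fun k => ?_
    refine ext_inner_left ℂ fun a => ?_
    rw [← inner_wave_left, inner_zero_right]
    exact hf _ (Submodule.mem_iSup_of_mem k ⟨a, rfl⟩)

lemma linearIsometryEquiv_waveL_apply (f : L2V) (k : Fin 3 → ℤ) :
    isHilbertSum_waveL.linearIsometryEquiv f k = coeffL k f := by
  classical
  refine ext_inner_left ℂ fun a => ?_
  rw [coeffL_apply, ← inner_wave_left]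
  refine (lp.inner_single_left (𝕜 := ℂ) (G := fun _ : Fin 3 → ℤ => C3) k a _).symm.trans ?_
  rw [← isHilbertSum_waveL.linearIsometryEquiv.symm.inner_map_map]
  simp

lemma coeffL_ext {f g : L2V} (h : ∀ k, coeffL k f = coeffL k g) : f = g := by
  rw [← sub_eq_zero]
  exact eq_zero_of_coeff_eq_zero fun k => by rw [← coeffL_apply, map_sub, h, sub_self]

lemma hasSum_inner_coeffL (f g : L2V) :
    HasSum (fun k => inner ℂ (coeffL k f) (coeffL k g)) (inner ℂ f g) := by
  have h := lp.hasSum_inner (𝕜 := ℂ) (isHilbertSum_waveL.linearIsometryEquiv f)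
    (isHilbertSum_waveL.linearIsometryEquiv g)
  simpa only [linearIsometryEquiv_waveL_apply, LinearIsometryEquiv.inner_map_map] using h

lemma hasSum_norm_sq_coeffL (f : L2V) : HasSum (fun k => ‖coeffL k f‖ ^ 2) (‖f‖ ^ 2) := by
  have h := RCLike.hasSum_re ℂ (hasSum_inner_coeffL f f)
  simpa only [inner_self_eq_norm_sq] using h

lemma hasSum_wave (f : L2V) : HasSum (fun k => wave k (coeffL k f)) f := by
  have h := isHilbertSum_waveL.hasSum_linearIsometryEquiv_symm
    (isHilbertSum_waveL.linearIsometryEquiv f)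
  simp only [linearIsometryEquiv_waveL_apply, LinearIsometryEquiv.symm_apply_apply] at h
  exact h

lemma exists_coeffL_eq {a : (Fin 3 → ℤ) → C3} (ha : Summable fun k => ‖a k‖ ^ 2) :
    ∃ f : L2V, ∀ k, coeffL k f = a k := by
  have hm : Memℓp a 2 := by
    rw [memℓp_gen_iff (by norm_num)]
    simpa using ha
  refine ⟨isHilbertSum_waveL.linearIsometryEquiv.symm ⟨a, hm⟩, fun k => ?_⟩
  rw [← linearIsometryEquiv_waveL_apply, LinearIsometryEquiv.apply_symm_apply]

/-! ### Fourier multipliers -/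

/-- `T` is the Fourier multiplier with symbol `M`. -/
def HasSymbol (T : L2V →L[ℂ] L2V) (M : (Fin 3 → ℤ) → C3 →L[ℂ] C3) : Prop :=
  ∀ k f, coeffL k (T f) = M k (coeffL k f)

lemma norm_le_of_coeffL_le {f g : L2V} {C : ℝ} (hC : 0 ≤ C)
    (h : ∀ k, ‖coeffL k g‖ ≤ C * ‖coeffL k f‖) : ‖g‖ ≤ C * ‖f‖ := by
  have h1 : ‖g‖ ^ 2 ≤ (C * ‖f‖) ^ 2 := by
    rw [mul_pow]
    refine hasSum_le (fun k => ?_) (hasSum_norm_sq_coeffL g)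
      ((hasSum_norm_sq_coeffL f).mul_left (C ^ 2))
    rw [← mul_pow]
    exact pow_le_pow_left₀ (norm_nonneg _) (h k) 2
  exact (sq_le_sq₀ (norm_nonneg _) (by positivity)).1 h1

lemma HasSymbol.norm_le {T : L2V →L[ℂ] L2V} {M : (Fin 3 → ℤ) → C3 →L[ℂ] C3}
    (hT : HasSymbol T M) {C : ℝ} (hC : 0 ≤ C) (hM : ∀ k, ‖M k‖ ≤ C) : ‖T‖ ≤ C :=
  T.opNorm_le_bound hC fun f => norm_le_of_coeffL_le hC fun k => by
    rw [hT k f]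
    exact (M k).le_of_opNorm_le (hM k) _

lemma exists_hasSymbol {M : (Fin 3 → ℤ) → C3 →L[ℂ] C3} {C : ℝ} (hM : ∀ k, ‖M k‖ ≤ C) :
    ∃ T : L2V →L[ℂ] L2V, HasSymbol T M := by
  have hC : 0 ≤ C := (norm_nonneg _).trans (hM 0)
  have hex : ∀ f : L2V, ∃ g : L2V, ∀ k, coeffL k g = M k (coeffL k f) := fun f => by
    refine exists_coeffL_eq (Summable.of_nonneg_of_le (fun k => by positivity) (fun k => ?_)
      ((hasSum_norm_sq_coeffL f).summable.mul_left (C ^ 2)))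
    rw [← mul_pow]
    exact pow_le_pow_left₀ (norm_nonneg _) ((M k).le_of_opNorm_le (hM k) _) 2
  choose T hT using hex
  refine ⟨LinearMap.mkContinuous
    { toFun := T
      map_add' := fun f g => coeffL_ext fun k => by simp [hT]
      map_smul' := fun c f => coeffL_ext fun k => by simp [hT] } C fun f => ?_, fun k f => hT f k⟩
  refine norm_le_of_coeffL_le hC fun k => ?_
  simp only [LinearMap.coe_mk, AddHom.coe_mk, hT]
  exact (M k).le_of_opNorm_le (hM k) _

/-- Cutting the symbol off to the finitely many `k` with norm above `1 / (n + 1)` gives compact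
operators within `1 / (n + 1)` of `T` in norm. -/
lemma HasSymbol.isCompactOperator {T : L2V →L[ℂ] L2V} {M : (Fin 3 → ℤ) → C3 →L[ℂ] C3}
    (hT : HasSymbol T M) (hM : ∀ ε > 0, {k | ε < ‖M k‖}.Finite) : IsCompactOperator T := by
  classical
  set s : ℕ → Finset (Fin 3 → ℤ) := fun n =>
    (hM (1 / ((n : ℝ) + 1)) (by positivity)).toFinset with hs
  set Tn : ℕ → L2V →L[ℂ] L2V := fun n =>
    ∑ k ∈ s n, (waveL k).toContinuousLinearMap ∘L M k ∘L coeffL k with hTn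
  have hTs : ∀ n, HasSymbol (T - Tn n) fun k => if k ∈ s n then 0 else M k := by
    intro n k f
    have h1 : coeffL k (Tn n f) = if k ∈ s n then M k (coeffL k f) else 0 := by
      simp only [hTn, sum_apply, map_sum]
      rw [← Finset.sum_ite_eq' (s n) k fun l => M l (coeffL l f)]
      refine Finset.sum_congr rfl fun l _ => ?_
      simp [coeffL_apply, coeff_wave]
    rw [sub_apply, map_sub, h1, hT k f]
    by_cases hk : k ∈ s n <;> simp [hk]
  have hle : ∀ n : ℕ, ‖T - Tn n‖ ≤ 1 / ((n : ℝ) + 1) := fun n => by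
    refine (hTs n).norm_le (by positivity) fun k => ?_
    split_ifs with h
    · rw [norm_zero]; positivity
    · simpa [hs] using h
  have hlim : Tendsto Tn atTop (𝓝 T) := by
    rw [tendsto_iff_norm_sub_tendsto_zero]
    refine squeeze_zero (fun n => norm_nonneg _) (fun n => ?_)
      (tendsto_one_div_add_atTop_nhds_zero_nat (𝕜 := ℝ))
    rw [norm_sub_rev]
    exact hle n
  refine isCompactOperator_of_tendsto hlim (Eventually.of_forall fun n => ?_)
  have : Tn n ∈ compactOperator (RingHom.id ℂ) L2V L2V := by
    refine Submodule.sum_mem _ fun k _ => ?_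
    exact (isCompactOperator_of_locallyCompactSpace_dom (coeffL k)).clm_comp
      ((waveL k).toContinuousLinearMap ∘L M k)
  exact this

/-! ### Line integrals of closed forms along homotopic curves -/

section ClosedForms

variable {E : Type*} [NormedAddCommGroup E] [NormedSpace ℝ E]

/-- The integral of the form `η` along the segment from `a` to `b`. -/
def seg (η : E → E →L[ℝ] ℂ) (a b : E) : ℂ :=
  ∫ t in (0 : ℝ)..1, η (a + t • (b - a)) (b - a)

/-- The integral of the form `η` along the polygon through the points `γ (k / n)`. -/
def polySum (η : E → E →L[ℝ] ℂ) (γ : ℝ → E) (n : ℕ) : ℂ :=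
  ∑ k ∈ Finset.range n, seg η (γ (k / n)) (γ ((k + 1 : ℕ) / n))

/-- `η` has a primitive on each ball of radius `r` around a point of `S`. -/
def HasPrimitives (η : E → E →L[ℝ] ℂ) (S : Set E) (r : ℝ) : Prop :=
  ∀ x ∈ S, ∃ f : E → ℂ, ∀ y ∈ Metric.ball x r, HasFDerivAt f (η y) y

lemma integral_curve_eq_sub {η : E → E →L[ℝ] ℂ} (hη : Continuous η) {f : E → ℂ} {s : Set E}
    (hf : ∀ y ∈ s, HasFDerivAt f (η y) y) {Γ : ℝ → E} (hΓ : ContDiff ℝ 1 Γ) {a b : ℝ}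
    (hab : a ≤ b) (hs : ∀ t ∈ Set.Icc a b, Γ t ∈ s) :
    ∫ t in a..b, η (Γ t) (deriv Γ t) = f (Γ b) - f (Γ a) := by
  have hd : Continuous (deriv Γ) := hΓ.continuous_deriv le_rfl
  refine intervalIntegral.integral_eq_sub_of_hasDerivAt (f := fun t => f (Γ t)) (fun t ht => ?_) ?_
  · rw [Set.uIcc_of_le hab] at ht
    exact (hf _ (hs t ht)).comp_hasDerivAt t (hΓ.differentiable one_ne_zero t).hasDerivAt
  · exact ((hη.comp hΓ.continuous).clm_apply hd).intervalIntegrable _ _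

lemma seg_eq_sub {η : E → E →L[ℝ] ℂ} (hη : Continuous η) {f : E → ℂ} {s : Set E}
    (hs : Convex ℝ s) (hf : ∀ y ∈ s, HasFDerivAt f (η y) y) {a b : E} (ha : a ∈ s) (hb : b ∈ s) :
    seg η a b = f b - f a := by
  have h1 : ∀ t : ℝ, deriv (fun t : ℝ => a + t • (b - a)) t = b - a := fun t => by
    have : HasDerivAt (fun t : ℝ => a + t • (b - a)) ((1 : ℝ) • (b - a)) t :=
      ((hasDerivAt_id t).smul_const (b - a)).const_add a
    simpa using this.deriv
  have h := integral_curve_eq_sub hη hf (Γ := fun t : ℝ => a + t • (b - a)) (by fun_prop)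
    zero_le_one fun t ht => by
      have := hs ha hb (sub_nonneg.2 ht.2) ht.1 (by ring)
      convert this using 1
      module
  simpa [h1, seg] using h

/-- Two discrete curves that stay close to each other have the same integral, up to the
contributions of the end points. -/
lemma sum_seg_add_seg {η : E → E →L[ℝ] ℂ} (hη : Continuous η) {S : Set E} {r : ℝ}
    (hp : HasPrimitives η S r) {p q : ℕ → E} {n : ℕ} (hS : ∀ k < n, p k ∈ S)
    (h1 : ∀ k < n, dist (p (k + 1)) (p k) < r) (h2 : ∀ k < n, dist (q k) (p k) < r)
    (h3 : ∀ k < n, dist (q (k + 1)) (p k) < r) :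
    ∑ k ∈ Finset.range n, seg η (p k) (p (k + 1)) + seg η (p n) (q n) =
      seg η (p 0) (q 0) + ∑ k ∈ Finset.range n, seg η (q k) (q (k + 1)) := by
  induction n with
  | zero => simp
  | succ n ih =>
    have ih := ih (fun k hk => hS k (hk.trans n.lt_succ_self))
      (fun k hk => h1 k (hk.trans n.lt_succ_self)) (fun k hk => h2 k (hk.trans n.lt_succ_self))
      (fun k hk => h3 k (hk.trans n.lt_succ_self))
    have hn := n.lt_succ_self
    obtain ⟨f, hf⟩ := hp (p n) (hS n hn)
    have hc := convex_ball (p n) r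
    have hr : 0 < r := dist_nonneg.trans_lt (h1 n hn)
    have e0 := Metric.mem_ball_self (x := p n) hr
    have e1 := Metric.mem_ball.2 (h1 n hn)
    have e2 := Metric.mem_ball.2 (h2 n hn)
    have e3 := Metric.mem_ball.2 (h3 n hn)
    -- The four points of one mesh lie in a ball with a primitive, so both ways around it give the
    -- same sum; induction adds the meshes up.
    rw [Finset.sum_range_succ, Finset.sum_range_succ, ← add_assoc, ← ih,
      seg_eq_sub hη hc hf e0 e1, seg_eq_sub hη hc hf e1 e3, seg_eq_sub hη hc hf e0 e2,
      seg_eq_sub hη hc hf e2 e3]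
    ring

lemma seg_add_period {η : E → E →L[ℝ] ℂ} {e : E} (he : ∀ x, η (x + e) = η x) (a b : E) :
    seg η (a + e) (b + e) = seg η a b := by
  unfold seg
  refine intervalIntegral.integral_congr fun t _ => ?_
  simp only [add_sub_add_right_eq_sub]
  rw [add_right_comm, he]

lemma seg_self (η : E → E →L[ℝ] ℂ) (a : E) : seg η a a = 0 := by simp [seg]

/-- The polygonal integrals of a fine subdivision agree for the ends of a homotopy. -/
lemma polySum_homotopy {H : ℝ × ℝ → E} (hH : UniformContinuous H) {a b : E}
    (h0 : ∀ s, H (s, 0) = a) (h1 : ∀ s, H (s, 1) = b) {S : Set E} (hS : ∀ p, H p ∈ S)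
    {r : ℝ} (hr : 0 < r) :
    ∀ᶠ n : ℕ in atTop, ∀ η : E → E →L[ℝ] ℂ, Continuous η → HasPrimitives η S r →
      polySum η (fun t => H (0, t)) n = polySum η (fun t => H (1, t)) n := by
  obtain ⟨δ, hδ, hHδ⟩ := Metric.uniformContinuous_iff.1 hH r hr
  obtain ⟨N, hN⟩ := exists_nat_one_div_lt hδ
  filter_upwards [eventually_ge_atTop (N + 1)] with n hn η hη hp
  have hn0 : (0 : ℝ) < n := by exact_mod_cast (Nat.succ_pos N).trans_le hn
  have hnδ : 1 / (n : ℝ) < δ := by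
    refine lt_of_le_of_lt ?_ hN
    apply one_div_le_one_div_of_le (by positivity)
    exact_mod_cast hn
  have hstep : ∀ k : ℕ, ((k + 1 : ℕ) : ℝ) / n - k / n = 1 / n := fun k => by
    push_cast; ring
  have hd : ∀ k : ℕ, dist (((k + 1 : ℕ) : ℝ) / n) (k / n) < δ := fun k => by
    rw [Real.dist_eq, hstep, abs_of_pos (by positivity)]; exact hnδ
  -- Adjacent rows of the grid on the square stay within `r` of each other, and the end
  -- contributions vanish because the homotopy fixes the end points.
  have hrow : ∀ j : ℕ, polySum η (fun t => H (j / n, t)) n =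
      polySum η (fun t => H ((j + 1 : ℕ) / n, t)) n := by
    intro j
    have h := sum_seg_add_seg hη hp (p := fun k : ℕ => H (j / n, k / n))
      (q := fun k : ℕ => H ((j + 1 : ℕ) / n, k / n)) (n := n) (fun k _ => hS _)
      (fun k _ => hHδ (by simpa [Prod.dist_eq, hδ] using hd k))
      (fun k _ => hHδ (by simpa [Prod.dist_eq, hδ] using hd j))
      (fun k _ => hHδ (by rw [Prod.dist_eq]; exact max_lt (hd j) (hd k)))
    simpa [polySum, h0, h1, div_self hn0.ne', seg_self] using h
  have hall : ∀ j : ℕ, polySum η (fun t => H (0, t)) n =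
      polySum η (fun t => H (j / n, t)) n := by
    intro j
    induction j with
    | zero => simp
    | succ j ih => rw [ih, hrow]
  simpa [div_self hn0.ne'] using hall n

/-- For a fine subdivision the polygonal integral is the line integral. -/
lemma polySum_eq_integral {Γ : ℝ → E} (hΓ : ContDiff ℝ 1 Γ) {S : Set E}
    (hS : ∀ t ∈ Set.Icc (0 : ℝ) 1, Γ t ∈ S) {r : ℝ} (hr : 0 < r) :
    ∀ᶠ n : ℕ in atTop, ∀ η : E → E →L[ℝ] ℂ, Continuous η → HasPrimitives η S r →
      polySum η Γ n = ∫ t in (0 : ℝ)..1, η (Γ t) (deriv Γ t) := by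
  have hu := (isCompact_Icc (a := (0 : ℝ)) (b := 1)).uniformContinuousOn_of_continuous
    hΓ.continuous.continuousOn
  obtain ⟨δ, hδ, hHδ⟩ := Metric.uniformContinuousOn_iff.1 hu r hr
  obtain ⟨N, hN⟩ := exists_nat_one_div_lt hδ
  filter_upwards [eventually_ge_atTop (N + 1)] with n hn η hη hp
  have hn0 : (0 : ℝ) < n := by exact_mod_cast (Nat.succ_pos N).trans_le hn
  have hnδ : 1 / (n : ℝ) < δ := by
    refine lt_of_le_of_lt ?_ hN
    apply one_div_le_one_div_of_le (by positivity)
    exact_mod_cast hn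
  have hint : ∀ a b : ℝ, IntervalIntegrable (fun t => η (Γ t) (deriv Γ t)) volume a b :=
    fun a b => ((hη.comp hΓ.continuous).clm_apply
      (hΓ.continuous_deriv le_rfl)).intervalIntegrable _ _
  have hsum := intervalIntegral.sum_integral_adjacent_intervals (n := n)
    (a := fun k : ℕ => (k : ℝ) / n) (f := fun t => η (Γ t) (deriv Γ t)) (μ := volume)
    fun k _ => hint _ _
  simp only [div_self hn0.ne', Nat.cast_zero, zero_div] at hsum
  rw [← hsum, polySum]
  refine Finset.sum_congr rfl fun k hk => ?_
  have hk : ((k + 1 : ℕ) : ℝ) ≤ n := by exact_mod_cast Finset.mem_range.1 hk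
  have hk0 : (0 : ℝ) ≤ k / n := by positivity
  have hk1 : ((k + 1 : ℕ) : ℝ) / n ≤ 1 := (div_le_one hn0).2 hk
  have hstep : ((k + 1 : ℕ) : ℝ) / n - k / n = 1 / n := by push_cast; ring
  have hpos : 0 < 1 / (n : ℝ) := by positivity
  obtain ⟨f, hf⟩ := hp (Γ (k / n)) (hS _ ⟨hk0, by linarith⟩)
  have hball : ∀ t ∈ Set.Icc ((k : ℝ) / n) (((k + 1 : ℕ) : ℝ) / n),
      Γ t ∈ Metric.ball (Γ (k / n)) r := fun t ht =>
    hHδ t ⟨hk0.trans ht.1, ht.2.trans hk1⟩ _ ⟨hk0, by linarith⟩ (by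
      rw [Real.dist_eq, abs_of_nonneg (by linarith [ht.1])]
      linarith [ht.2])
  have hle : (k : ℝ) / n ≤ ((k + 1 : ℕ) : ℝ) / n := by linarith
  rw [integral_curve_eq_sub hη hf hΓ hle hball, seg_eq_sub hη (convex_ball _ _) hf
    (hball _ ⟨le_rfl, hle⟩) (hball _ ⟨hle, le_rfl⟩)]

/-- Concatenation runs each half at double speed, so an even number of subdivision points splits it
exactly at the midpoint. -/
lemma polySum_trans {η : E → E →L[ℝ] ℂ} {P f g : ℝ → E} (hfg : f 1 = g 0)
    (hPf : ∀ t, 0 ≤ t → t ≤ 1 / 2 → P t = f (2 * t))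
    (hPg : ∀ t, 1 / 2 < t → t ≤ 1 → P t = g (2 * t - 1))
    {n : ℕ} (hn : 0 < n) :
    polySum η P (n + n) = polySum η f n + polySum η g n := by
  have hn0 : (0 : ℝ) < n := by exact_mod_cast hn
  have h1 : ∀ k : ℕ, k ≤ n → P (k / (n + n : ℕ)) = f (k / n) := by
    intro k hk
    have hk : (k : ℝ) ≤ n := by exact_mod_cast hk
    rw [hPf _ (by positivity)]
    · congr 1; push_cast; field_simp; ring
    · push_cast
      rw [div_le_div_iff₀ (by positivity) (by norm_num)]; linarith
  have h2 : ∀ k : ℕ, k ≤ n → P ((n + k : ℕ) / (n + n : ℕ)) = g (k / n) := by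
    intro k hkn
    have hkn : (k : ℝ) ≤ n := by exact_mod_cast hkn
    -- The midpoint belongs to the first half only, so `k = 0` needs the matching condition `f 1 = g
    -- 0`.
    rcases Nat.eq_zero_or_pos k with rfl | hk
    · rw [Nat.add_zero, h1 n le_rfl, div_self hn0.ne', hfg]; simp
    · have hk : (0 : ℝ) < k := by exact_mod_cast hk
      rw [hPg]
      · congr 1; push_cast; field_simp; ring
      · push_cast
        rw [div_lt_div_iff₀ (by norm_num) (by positivity)]; linarith
      · push_cast
        rw [div_le_one (by positivity)]; linarith
  unfold polySum
  rw [Finset.sum_range_add]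
  congr 1
  · refine Finset.sum_congr rfl fun k hk => ?_
    have hk := Finset.mem_range.1 hk
    rw [h1 k hk.le, h1 (k + 1) hk]
  · refine Finset.sum_congr rfl fun k hk => ?_
    have hk := Finset.mem_range.1 hk
    rw [h2 k hk.le, add_assoc, h2 (k + 1) hk]

lemma polySum_add_period {η : E → E →L[ℝ] ℂ} {e : E} (he : ∀ x, η (x + e) = η x) (f : ℝ → E)
    (n : ℕ) : polySum η (fun t => f t + e) n = polySum η f n := by
  simp [polySum, seg_add_period he]

/-- A form that is closed on an open ball has a primitive there. -/
lemma exists_primitive_ball {η : E → E →L[ℝ] ℂ} (hη : ContDiff ℝ 1 η) {x : E} {r : ℝ}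
    (hcl : ∀ y ∈ Metric.ball x r, ∀ a b, fderiv ℝ η y a b = fderiv ℝ η y b a) :
    ∃ f : E → ℂ, ∀ y ∈ Metric.ball x r, HasFDerivAt f (η y) y :=
  (convex_ball x r).exists_forall_hasFDerivAt_of_fderiv_symmetric Metric.isOpen_ball
    (hη.differentiable one_ne_zero).differentiableOn hcl

omit [NormedSpace ℝ E] in
lemma exists_ball_subset_of_isCompact {S U : Set E} (hS : IsCompact S) (hU : IsOpen U)
    (hSU : S ⊆ U) : ∃ r > 0, ∀ x ∈ S, Metric.ball x r ⊆ U := by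
  obtain ⟨r, hr, h⟩ := hS.exists_thickening_subset_open hU hSU
  exact ⟨r, hr, fun x hx => (Metric.ball_subset_thickening hx r).trans h⟩

/-- Closedness is only available at points whose `r`-ball lies in `U`, which is what mollification
at scale `r` provides; the doubled radius ensures it throughout each `r`-ball around `S`. -/
lemma hasPrimitives_of_closed {S U : Set E} {r : ℝ}
    (hSU : ∀ x ∈ S, Metric.ball x (r + r) ⊆ U) {η : E → E →L[ℝ] ℂ} (hη : ContDiff ℝ 1 η)
    (hcl : ∀ x, Metric.ball x r ⊆ U → ∀ a b, fderiv ℝ η x a b = fderiv ℝ η x b a) :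
    HasPrimitives η S r := fun x hx =>
  exists_primitive_ball hη fun y hy => hcl y <| by
    refine (Metric.ball_subset_ball' ?_).trans (hSU x hx)
    have := Metric.mem_ball.1 hy
    linarith

/-- A periodic form that is closed in a simply connected periodic open set has equal line
integrals along all curves in that set which join a point to its translate. -/
theorem exists_radius_integral_eq {U : Set E} (hU : IsOpen U) (hsc : IsSimplyConnected U)
    {e : E} (he : ∀ x ∈ U, x + e ∈ U) {Γ Γ' : ℝ → E} (hΓ : ContDiff ℝ 1 Γ)
    (hΓ' : ContDiff ℝ 1 Γ') (hΓU : ∀ t ∈ Set.Icc (0 : ℝ) 1, Γ t ∈ U)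
    (hΓU' : ∀ t ∈ Set.Icc (0 : ℝ) 1, Γ' t ∈ U) (hΓe : Γ 1 = Γ 0 + e) (hΓe' : Γ' 1 = Γ' 0 + e) :
    ∃ r > 0, ∀ η : E → E →L[ℝ] ℂ, ContDiff ℝ 1 η → (∀ x, η (x + e) = η x) →
      (∀ x, Metric.ball x r ⊆ U → ∀ a b, fderiv ℝ η x a b = fderiv ℝ η x b a) →
      ∫ t in (0 : ℝ)..1, η (Γ t) (deriv Γ t) = ∫ t in (0 : ℝ)..1, η (Γ' t) (deriv Γ' t) := by
  have := hsc.simplyConnectedSpace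
  have h0 : (0 : ℝ) ∈ Set.Icc (0 : ℝ) 1 := by simp
  have h1 : (1 : ℝ) ∈ Set.Icc (0 : ℝ) 1 := by simp
  set x : U := ⟨Γ 0, hΓU 0 h0⟩ with hx
  set x' : U := ⟨Γ' 0, hΓU' 0 h0⟩ with hx'
  set y : U := ⟨Γ 0 + e, he _ (hΓU 0 h0)⟩ with hy
  set y' : U := ⟨Γ' 0 + e, he _ (hΓU' 0 h0)⟩ with hy'
  -- A path between the two initial points and its translate close up the two curves. By periodicity
  -- `δ` and `δ'` have the same integral, so their contributions cancel.
  set δ : Path x' x := PathConnectedSpace.somePath x' x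
  set τ : U → U := fun z => ⟨z.1 + e, he _ z.2⟩
  have hτ : Continuous τ := by fun_prop
  set δ' : Path y' y := δ.map hτ
  set p : Path x y :=
    { toFun := fun t => ⟨Γ t, hΓU t t.2⟩
      continuous_toFun := (hΓ.continuous.comp continuous_subtype_val).subtype_mk _
      source' := rfl
      target' := Subtype.ext hΓe } with hp
  set p' : Path x' y' :=
    { toFun := fun t => ⟨Γ' t, hΓU' t t.2⟩
      continuous_toFun := (hΓ'.continuous.comp continuous_subtype_val).subtype_mk _
      source' := rfl
      target' := Subtype.ext hΓe' } with hp'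
  obtain ⟨H⟩ : (δ.trans p).Homotopic (p'.trans δ') := SimplyConnectedSpace.paths_homotopic _ _
  -- Clamping extends the homotopy to the plane while keeping it uniformly continuous.
  set pr : ℝ → unitInterval := Set.projIcc (0 : ℝ) 1 zero_le_one with hpr
  have hpru : UniformContinuous pr := (LipschitzWith.projIcc zero_le_one).uniformContinuous
  set h : ℝ × ℝ → E := fun q => (H (pr q.1, pr q.2) : U) with hh
  have hhu : UniformContinuous h := by
    have hc : UniformContinuous fun q : unitInterval × unitInterval => ((H q : U) : E) :=
      CompactSpace.uniformContinuous_of_continuous (by fun_prop)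
    exact hc.comp ((hpru.comp uniformContinuous_fst).prodMk (hpru.comp uniformContinuous_snd))
  set S : Set E := Set.range fun q : unitInterval × unitInterval => ((H q : U) : E) with hS
  have hSc : IsCompact S := isCompact_range (by fun_prop)
  have hSU : S ⊆ U := by rintro _ ⟨q, rfl⟩; exact (H q).2
  set S' : Set E := S ∪ (Γ '' Set.Icc 0 1 ∪ Γ' '' Set.Icc 0 1) with hS'
  have hSc' : IsCompact S' := hSc.union ((isCompact_Icc.image hΓ.continuous).union
    (isCompact_Icc.image hΓ'.continuous))
  have hSU' : S' ⊆ U := by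
    rintro z (hz | ⟨t, ht, rfl⟩ | ⟨t, ht, rfl⟩)
    exacts [hSU hz, hΓU t ht, hΓU' t ht]
  obtain ⟨r, hr, hrU⟩ := exists_ball_subset_of_isCompact hSc' hU hSU'
  refine ⟨r / 2, half_pos hr, fun η hη hper hcl => ?_⟩
  have hprim : HasPrimitives η S' (r / 2) :=
    hasPrimitives_of_closed (by simpa using hrU) hη hcl
  have hdbl : Tendsto (fun n : ℕ => n + n) atTop atTop :=
    tendsto_atTop_mono (fun n => Nat.le_add_left n n) tendsto_id
  have e1 := hdbl.eventually (polySum_homotopy hhu (a := x') (b := y) (fun s => by simp [hh, hpr])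
    (fun s => by simp [hh, hpr]) (S := S') (fun q => Or.inl ⟨_, rfl⟩) (half_pos hr))
  have e2 := polySum_eq_integral hΓ (S := S') (fun t ht => Or.inr (Or.inl ⟨t, ht, rfl⟩))
    (half_pos hr)
  have e3 := polySum_eq_integral hΓ' (S := S') (fun t ht => Or.inr (Or.inr ⟨t, ht, rfl⟩))
    (half_pos hr)
  obtain ⟨n, e1, e2, e3, hn⟩ := (e1.and (e2.and (e3.and (eventually_gt_atTop 0)))).exists
  rw [← e2 η hη.continuous hprim, ← e3 η hη.continuous hprim]
  have e4 := e1 η hη.continuous hprim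
  have hδ1 : ((δ.extend 1 : U) : E) = Γ 0 := by simp [hx]
  have hδ0 : ((δ.extend 0 : U) : E) + e = Γ' 1 := by simp [hx', hΓe']
  have e5 := polySum_trans (η := η) (P := fun t => h (0, t)) (f := fun t => ((δ.extend t : U) : E))
    (g := Γ) hδ1 (fun t ht0 ht => ?_) (fun t ht ht1 => ?_) hn
  · have e6 := polySum_trans (η := η) (P := fun t => h (1, t)) (f := Γ')
      (g := fun t => ((δ.extend t : U) : E) + e) hδ0.symm (fun t ht0 ht => ?_)
      (fun t ht ht1 => ?_) hn
    · rw [e5, e6, polySum_add_period hper, add_comm (polySum η Γ' n)] at e4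
      exact add_left_cancel e4
    · have ht1 : t ∈ Set.Icc (0 : ℝ) 1 := ⟨ht0, by linarith⟩
      have ht2 : 2 * t ∈ Set.Icc (0 : ℝ) 1 := ⟨by linarith, by linarith⟩
      have : h (1, t) = ((p'.trans δ') ⟨t, ht1⟩ : U) := by
        simp [hh, hpr, Set.projIcc_of_mem zero_le_one ht1]
      rw [this, Path.trans_apply, dif_pos ht]
      rfl
    · have ht1 : t ∈ Set.Icc (0 : ℝ) 1 := ⟨by linarith, ht1⟩
      have ht2 : 2 * t - 1 ∈ Set.Icc (0 : ℝ) 1 := ⟨by linarith, by linarith [ht1.2]⟩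
      have : h (1, t) = ((p'.trans δ') ⟨t, ht1⟩ : U) := by
        simp [hh, hpr, Set.projIcc_of_mem zero_le_one ht1]
      rw [this, Path.trans_apply, dif_neg (not_le.2 ht), Path.extend_apply _ ht2]
      rfl
  · have ht1 : t ∈ Set.Icc (0 : ℝ) 1 := ⟨ht0, by linarith⟩
    have ht2 : 2 * t ∈ Set.Icc (0 : ℝ) 1 := ⟨by linarith, by linarith⟩
    have : h (0, t) = ((δ.trans p) ⟨t, ht1⟩ : U) := by
      simp [hh, hpr, Set.projIcc_of_mem zero_le_one ht1]
    rw [this, Path.trans_apply, dif_pos ht, Path.extend_apply _ ht2]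
  · have ht1 : t ∈ Set.Icc (0 : ℝ) 1 := ⟨by linarith, ht1⟩
    have : h (0, t) = ((δ.trans p) ⟨t, ht1⟩ : U) := by
      simp [hh, hpr, Set.projIcc_of_mem zero_le_one ht1]
    rw [this, Path.trans_apply, dif_neg (not_le.2 ht)]
    rfl

/-- Shifting a closed curve of the torus a little does not change the line integral of a form
that is closed near the curve. -/
theorem exists_radius_integral_shift_eq {U : Set E} (hU : IsOpen U)
    {e : E} {Γ : ℝ → E} (hΓ : ContDiff ℝ 1 Γ) (hΓU : ∀ t ∈ Set.Icc (0 : ℝ) 1, Γ t ∈ U)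
    (hΓe : Γ 1 = Γ 0 + e) :
    ∃ r > 0, ∀ η : E → E →L[ℝ] ℂ, ContDiff ℝ 1 η → (∀ x, η (x + e) = η x) →
      (∀ x, Metric.ball x r ⊆ U → ∀ a b, fderiv ℝ η x a b = fderiv ℝ η x b a) →
      ∀ z, ‖z‖ < r → ∫ t in (0 : ℝ)..1, η (Γ t + z) (deriv Γ t) =
        ∫ t in (0 : ℝ)..1, η (Γ t) (deriv Γ t) := by
  obtain ⟨ρ, hρ, hρU⟩ := exists_ball_subset_of_isCompact
    (isCompact_Icc.image hΓ.continuous) hU (Set.image_subset_iff.2 hΓU)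
  -- A point shifted by less than `r` keeps a ball of radius `r + r` inside `U`.
  set r := ρ / 3 with hr'
  have hr : 0 < r := by positivity
  set S : Set E := {x | Metric.ball x (r + r) ⊆ U} with hS
  have hSΓ : ∀ t ∈ Set.Icc (0 : ℝ) 1, ∀ z, ‖z‖ < r → Γ t + z ∈ S := fun t ht z hz => by
    refine (Metric.ball_subset_ball' ?_).trans (hρU _ ⟨t, ht, rfl⟩)
    rw [dist_self_add_left]
    linarith
  -- Shifts and subdivision steps below `r / 2` add up to less than `r`, as the comparison of the
  -- two discrete curves requires.
  refine ⟨r / 2, half_pos hr, fun η hη hper hcl z hz => ?_⟩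
  have hprim : HasPrimitives η S r := hasPrimitives_of_closed (fun x hx => hx) hη
    fun x hx => hcl x ((Metric.ball_subset_ball (half_le_self hr.le)).trans hx)
  have hSΓ0 : ∀ t ∈ Set.Icc (0 : ℝ) 1, Γ t ∈ S := fun t ht => by
    simpa using hSΓ t ht 0 (by simpa using hr)
  have hdz : ∀ t, deriv (fun t => Γ t + z) t = deriv Γ t := fun t => deriv_add_const _
  have e1 := polySum_eq_integral hΓ hSΓ0 hr
  have e2 := polySum_eq_integral (Γ := fun t => Γ t + z) (hΓ.add contDiff_const)
    (fun t ht => hSΓ t ht z (by linarith)) hr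
  have hu := (isCompact_Icc (a := (0 : ℝ)) (b := 1)).uniformContinuousOn_of_continuous
    hΓ.continuous.continuousOn
  obtain ⟨δ, hδ, hHδ⟩ := Metric.uniformContinuousOn_iff.1 hu (r / 2) (half_pos hr)
  obtain ⟨N, hN⟩ := exists_nat_one_div_lt hδ
  obtain ⟨n, e1, e2, hn⟩ := (e1.and (e2.and (eventually_ge_atTop (N + 1)))).exists
  have e1 := e1 η hη.continuous hprim
  have e2 := e2 η hη.continuous hprim
  simp only [hdz] at e2
  rw [← e1, ← e2]
  have hn0 : (0 : ℝ) < n := by exact_mod_cast (Nat.succ_pos N).trans_le hn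
  have hnδ : 1 / (n : ℝ) < δ := by
    refine lt_of_le_of_lt ?_ hN
    apply one_div_le_one_div_of_le (by positivity)
    exact_mod_cast hn
  have hmem : ∀ k ≤ n, (k : ℝ) / n ∈ Set.Icc (0 : ℝ) 1 := fun k hk =>
    ⟨by positivity, (div_le_one hn0).2 (by exact_mod_cast hk)⟩
  have hd : ∀ k < n, dist (Γ ((k + 1 : ℕ) / n)) (Γ (k / n)) < r / 2 := fun k hk => by
    refine hHδ _ (hmem _ hk) _ (hmem _ hk.le) ?_
    have : ((k + 1 : ℕ) : ℝ) / n - k / n = 1 / n := by push_cast; ring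
    rw [Real.dist_eq, this, abs_of_pos (by positivity)]
    exact hnδ
  have h := sum_seg_add_seg hη.continuous hprim (p := fun k : ℕ => Γ (k / n))
    (q := fun k : ℕ => Γ (k / n) + z) (n := n) (fun k hk => hSΓ0 _ (hmem k hk.le))
    (fun k hk => (hd k hk).trans (half_lt_self hr))
    (fun k hk => by rw [dist_self_add_left]; linarith)
    (fun k hk => (dist_triangle _ (Γ ((k + 1 : ℕ) / n)) _).trans_lt (by
      rw [dist_self_add_left]; linarith [hd k hk]))
  simp only [div_self hn0.ne', Nat.cast_zero, zero_div, hΓe] at h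
  -- The connecting segments at the two ends are translates by the period and cancel.
  rw [add_right_comm (Γ 0), seg_add_period hper, add_comm] at h
  exact (add_left_cancel h).symm

end ClosedForms

/-! ### Periodic test functions and weak derivatives -/

lemma shift_single (x : E3) (j : Fin 3) : shift x (Pi.single j 1) = x + e j := by
  ext i
  by_cases h : i = j
  · subst h; simp [shift, e]
  · simp [shift, e, h]

lemma cell_ae_eq : (WithLp.toLp 2 ⁻¹' cell : Set (Fin 3 → ℝ)) =ᵐ[volume] Set.Icc 0 1 := by
  have h : (WithLp.toLp 2 ⁻¹' cell : Set (Fin 3 → ℝ)) =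
      Set.pi Set.univ fun i => Set.Ioc ((0 : Fin 3 → ℝ) i) ((1 : Fin 3 → ℝ) i) := by
    ext x; simp [cell]
  rw [h]
  exact Measure.univ_pi_Ioc_ae_eq_Icc

lemma setIntegral_cell {F : Type*} [NormedAddCommGroup F] [NormedSpace ℝ F] (f : E3 → F) :
    ∫ x, f x ∂cellMeasure = ∫ x in Set.Icc (0 : Fin 3 → ℝ) 1, f (WithLp.toLp 2 x) := by
  rw [← setIntegral_congr_set cell_ae_eq, cellMeasure,
    ← (PiLp.volume_preserving_toLp (Fin 3)).setIntegral_preimage_emb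
      (MeasurableEquiv.toLp 2 (Fin 3 → ℝ)).measurableEmbedding]

/-- The divergence theorem on the unit box for the field with `j`-th component `ψ` and all others
zero: opposite faces cancel by periodicity. -/
lemma integral_fderiv_eq_zero {ψ : E3 → ℂ} (hψ : ContDiff ℝ 1 ψ)
    (hper : ∀ x n, ψ (shift x n) = ψ x) (j : Fin 3) :
    ∫ x, fderiv ℝ ψ x (e j) ∂cellMeasure = 0 := by
  rw [setIntegral_cell]
  set T : (Fin 3 → ℝ) →L[ℝ] E3 :=
    (PiLp.continuousLinearEquiv 2 ℝ (fun _ : Fin 3 => ℝ)).symm.toContinuousLinearMap with hT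
  have hTx : ∀ x, T x = WithLp.toLp 2 x := fun x => rfl
  have hd : ∀ x, HasFDerivAt (fun x => ψ (T x)) ((fderiv ℝ ψ (T x)).comp T) x := fun x =>
    (hψ.differentiable one_ne_zero (T x)).hasFDerivAt.comp x T.hasFDerivAt
  have hc : Continuous fun x => fderiv ℝ ψ (T x) :=
    (hψ.continuous_fderiv one_ne_zero).comp T.continuous
  have hTe : T (Pi.single j 1) = e j := by
    ext i; simp [hTx, e]
  have h := integral_divergence_of_hasFDerivAt_off_countable' (n := 2) (E := ℂ) 0 1 zero_le_one
    (fun i x => if i = j then ψ (T x) else 0)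
    (fun i x => if i = j then (fderiv ℝ ψ (T x)).comp T else 0) ∅ Set.countable_empty
    (fun i => ?_) (fun x _ i => ?_) ?_
  · have h1 : ∀ x : Fin 3 → ℝ, ∑ i, (if i = j then (fderiv ℝ ψ (T x)).comp T else 0)
        (Pi.single i 1) = fderiv ℝ ψ (WithLp.toLp 2 x) (e j) := fun x => by
      rw [Finset.sum_eq_single j]
      · simp [hTe, ← hTx]
      · intro i _ hi; simp [hi]
      · simp
    simp only [h1] at h
    rw [h]
    refine Finset.sum_eq_zero fun i _ => ?_
    by_cases hi : i = j
    · subst hi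
      rw [sub_eq_zero]
      refine setIntegral_congr_fun measurableSet_Icc fun y _ => ?_
      simp only [if_true, Pi.one_apply, Pi.zero_apply]
      rw [← hper (T (i.insertNth 0 y)) (Pi.single i 1), shift_single, ← hTe, ← map_add]
      congr 2
      ext l
      rcases Fin.eq_self_or_eq_succAbove i l with rfl | ⟨l, rfl⟩ <;> simp
    · simp [hi]
  · by_cases hi : i = j
    · simpa [hi, Function.comp_def] using (hψ.continuous.comp T.continuous).continuousOn
    · simpa [hi] using continuousOn_const
  · by_cases hi : i = j
    · simpa [hi] using hd x
    · simpa [hi] using hasFDerivAt_const (0 : ℂ) x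
  · refine Continuous.integrableOn_Icc (continuous_finsetSum _ fun i _ => ?_)
    by_cases hi : i = j
    · simp only [hi, if_true]
      exact (hc.clm_comp continuous_const).clm_apply continuous_const
    · simpa [hi] using continuous_const

lemma contDiff_character (k : Fin 3 → ℤ) : ContDiff ℝ ∞ (character k) := by
  have h : ContDiff ℝ ∞ fun x : E3 => ∑ i, (k i : ℝ) * x i :=
    ContDiff.sum fun i _ => contDiff_const.mul (EuclideanSpace.proj (𝕜 := ℝ) i).contDiff
  exact Complex.contDiff_exp.comp (contDiff_const.mul (Complex.ofRealCLM.contDiff.comp h))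

lemma character_shift (k : Fin 3 → ℤ) (x : E3) (n : Fin 3 → ℤ) :
    character k (shift x n) = character k x := by
  unfold character shift
  have h : (∑ i, (k i : ℝ) * (x i + n i) : ℝ) = (∑ i, (k i : ℝ) * x i) + ((∑ i, k i * n i : ℤ) : ℝ) := by
    push_cast
    rw [← Finset.sum_add_distrib]
    exact Finset.sum_congr rfl fun i _ => by ring
  simp only [h]
  rw [Complex.ofReal_add, mul_add, Complex.exp_add]
  have h2 : Complex.exp (2 * Real.pi * Complex.I * (((∑ i, k i * n i : ℤ) : ℝ) : ℂ)) = 1 := by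
    rw [Complex.exp_eq_one_iff]
    exact ⟨∑ i, k i * n i, by push_cast; ring⟩
  rw [h2, mul_one]

lemma isTestFunction_character (k : Fin 3 → ℤ) : IsTestFunction (character k) :=
  ⟨contDiff_character k, character_shift k⟩

lemma fderiv_character (k : Fin 3 → ℤ) (x : E3) (j : Fin 3) :
    fderiv ℝ (character k) x (e j) = 2 * Real.pi * Complex.I * k j * character k x := by
  set T : E3 →L[ℝ] ℝ := ∑ i, (k i : ℝ) • EuclideanSpace.proj (𝕜 := ℝ) i with hT
  have hTx : ∀ y : E3, T y = ∑ i, (k i : ℝ) * y i := fun y => by simp [hT]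
  have h1 : HasFDerivAt (fun y : E3 => (2 * Real.pi * Complex.I * ((T y : ℝ) : ℂ)))
      ((2 * Real.pi * Complex.I) • (Complex.ofRealCLM.comp T)) x :=
    (Complex.ofRealCLM.comp T).hasFDerivAt.const_mul _
  have h2 := h1.cexp
  simp only [hTx] at h2
  rw [show character k = fun y : E3 => Complex.exp (2 * Real.pi * Complex.I *
    ((∑ i, (k i : ℝ) * y i : ℝ) : ℂ)) from rfl, h2.fderiv]
  have h3 : T (e j) = k j := by simp [hTx, e]
  simp [h3]
  ring

lemma memLp_of_continuous {F : Type*} [NormedAddCommGroup F] {φ : E3 → F}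
    (hφ : Continuous φ) (p : ENNReal) : MemLp φ p cellMeasure := by
  have hK : IsCompact (WithLp.toLp 2 '' Set.Icc (0 : Fin 3 → ℝ) 1 : Set E3) :=
    isCompact_Icc.image (PiLp.continuous_toLp 2 _)
  obtain ⟨C, hC⟩ := hK.exists_bound_of_continuousOn hφ.continuousOn
  refine MemLp.of_bound hφ.aestronglyMeasurable C ?_
  filter_upwards [ae_restrict_mem measurableSet_cell] with x hx
  exact hC x ⟨WithLp.ofLp x, ⟨fun i => (hx i).1.le, fun i => (hx i).2⟩, rfl⟩

/-- The integral of a field against a continuous function, by Fourier series. -/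
lemma hasSum_integral_mul (f : L2V) {φ : E3 → ℂ} (hφ : Continuous φ) (i : Fin 3) :
    HasSum (fun k => coeffL k f i * ∫ x, character k x * φ x ∂cellMeasure)
      (∫ x, f x i * φ x ∂cellMeasure) := by
  -- The integral is the inner product with the field `conj φ · eᵢ`, hence continuous in `f`, and
  -- the Fourier series may be integrated termwise.
  have hm : MemLp (fun x => EuclideanSpace.single i (starRingEnd ℂ (φ x)) : E3 → C3) 2
      cellMeasure := by
    have h : Continuous fun _ : E3 => (EuclideanSpace.single i (1 : ℂ) : C3) := continuous_const
    have h2 : (fun x => EuclideanSpace.single i (starRingEnd ℂ (φ x)) : E3 → C3) =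
        fun x => starRingEnd ℂ (φ x) • (EuclideanSpace.single i (1 : ℂ) : C3) := by
      ext x j; simp
    rw [h2]
    exact memLp_of_continuous ((Complex.continuous_conj.comp hφ).smul h) 2
  have hg : ∀ f : L2V, inner ℂ (hm.toLp _) f = ∫ x, f x i * φ x ∂cellMeasure := fun f => by
    rw [L2.inner_def]
    refine integral_congr_ae ?_
    filter_upwards [hm.coeFn_toLp] with x hx
    rw [hx, EuclideanSpace.inner_single_left, Complex.conj_conj, mul_comm]
  have h := (hasSum_wave f).mapL (innerSL ℂ (hm.toLp _))
  simp only [innerSL_apply_apply] at h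
  rw [hg] at h
  refine h.congr_fun fun k => ?_
  rw [hg, ← integral_const_mul]
  refine integral_congr_ae ?_
  filter_upwards [wave_coe k (coeffL k f)] with x hx
  rw [hx]
  simp
  ring

lemma IsTestFunction.continuous {φ : E3 → ℂ} (hφ : IsTestFunction φ) : Continuous φ :=
  hφ.1.continuous

lemma coeffL_apply_eq_integral (k : Fin 3 → ℤ) (f : L2V) (i : Fin 3) :
    coeffL k f i = ∫ y, f y i * character (-k) y ∂cellMeasure := by
  rw [coeffL_apply, coeff_apply]
  exact integral_congr_ae (Eventually.of_forall fun x => by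
    simp only [conj_character]; ring)

/-- The weak gradient in terms of Fourier coefficients. -/
theorem mem_W12_iff {p : Jet} :
    p ∈ W12 ↔ ∀ j k, coeffL k (p.2 j) = (2 * Real.pi * Complex.I * k j : ℂ) • coeffL k p.1 := by
  constructor
  · intro hp j k
    ext i
    -- Characters are admissible test functions, and they already determine the weak gradient.
    have h := hp _ (isTestFunction_character (-k)) i j
    simp only [fderiv_character] at h
    rw [PiLp.smul_apply, coeffL_apply_eq_integral, coeffL_apply_eq_integral, smul_eq_mul,
      ← integral_const_mul, ← neg_eq_iff_eq_neg.2 h, ← integral_neg]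
    refine integral_congr_ae (Eventually.of_forall fun x => ?_)
    simp only [Pi.neg_apply]
    push_cast
    ring
  · intro hp φ hφ i j
    have hφd : Continuous fun x => fderiv ℝ φ x (e j) :=
      (hφ.1.continuous_fderiv (by simp)).clm_apply continuous_const
    have h1 := hasSum_integral_mul p.1 hφd i
    have h2 := (hasSum_integral_mul (p.2 j) hφ.continuous i).neg
    refine h1.unique (h2.congr_fun fun k => ?_)
    -- Conversely, the identity holds term by term: integrate the derivative of the periodic
    -- function `character k * φ`.
    have h3 := integral_fderiv_eq_zero (ψ := fun x => character k x * φ x)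
      (((contDiff_character k).mul hφ.1).of_le (by simp))
      (fun x n => by rw [character_shift, hφ.2]) j
    have h4 : ∀ x, fderiv ℝ (fun x => character k x * φ x) x (e j) =
        2 * Real.pi * Complex.I * k j * (character k x * φ x) +
          character k x * fderiv ℝ φ x (e j) := fun x => by
      rw [fderiv_fun_mul ((contDiff_character k).differentiable (by simp) x)
        (hφ.1.differentiable (by simp) x)]
      simp only [add_apply, smul_apply, fderiv_character, smul_eq_mul]
      ring
    simp only [h4] at h3
    rw [integral_add, integral_const_mul] at h3
    · rw [hp j k, PiLp.smul_apply, smul_eq_mul]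
      linear_combination (coeffL k p.1 i) * h3
    · exact ((memLp_of_continuous ((continuous_character k).mul hφ.continuous) 1).integrable
        le_rfl).const_mul _
    · exact (memLp_of_continuous ((continuous_character k).mul hφd) 1).integrable le_rfl

/-- The weak gradient is determined by the field, so a jet in `W12` may be identified with its first
component. -/
lemma W12_ext {p q : Jet} (hp : p ∈ W12) (hq : q ∈ W12) (h : p.1 = q.1) : p = q := by
  refine Prod.ext h (funext fun j => coeffL_ext fun k => ?_)
  rw [mem_W12_iff.1 hp, mem_W12_iff.1 hq, h]

/-! ### The Biot-Savart operator -/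

/-- The cross product `a ↦ v × a`. -/
def crossL (v : Fin 3 → ℂ) : C3 →L[ℂ] C3 :=
  LinearMap.toContinuousLinearMap
    { toFun := fun a => !₂[v 1 * a 2 - v 2 * a 1, v 2 * a 0 - v 0 * a 2, v 0 * a 1 - v 1 * a 0]
      map_add' := fun a b => by
        ext i; fin_cases i <;> simp <;> ring
      map_smul' := fun c a => by
        ext i; fin_cases i <;> simp <;> ring }

lemma crossL_apply (v : Fin 3 → ℂ) (a : C3) :
    crossL v a = !₂[v 1 * a 2 - v 2 * a 1, v 2 * a 0 - v 0 * a 2, v 0 * a 1 - v 1 * a 0] := rfl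

/-- For an amplitude transversal to `v` only the multiple of `a` survives; this makes the
Biot–Savart symbol an inverse of the curl. -/
lemma crossL_crossL (v : Fin 3 → ℂ) (a : C3) :
    crossL v (crossL v a) = (∑ i, v i * a i) • WithLp.toLp 2 v - (∑ i, v i ^ 2) • a := by
  ext i
  fin_cases i <;> simp [crossL_apply, Fin.sum_univ_three] <;> ring

lemma dot_crossL (v : Fin 3 → ℂ) (a : C3) : ∑ i, v i * crossL v a i = 0 := by
  simp [crossL_apply, Fin.sum_univ_three]; ring

lemma sum_smul_crossL_single (v : Fin 3 → ℂ) (a : C3) :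
    ∑ j, v j • crossL (Pi.single j 1) a = crossL v a := by
  ext i
  fin_cases i <;> simp [crossL_apply, Fin.sum_univ_three] <;> ring

/-- The wave vector with complex entries. -/
def waveVec (k : Fin 3 → ℤ) : Fin 3 → ℂ := fun i => k i

/-- The square of the length of a wave vector. -/
def lenSq (k : Fin 3 → ℤ) : ℝ := ∑ i, (k i : ℝ) ^ 2

lemma lenSq_nonneg (k : Fin 3 → ℤ) : 0 ≤ lenSq k := Finset.sum_nonneg fun _ _ => sq_nonneg _

lemma abs_le_sqrt_lenSq (k : Fin 3 → ℤ) (i : Fin 3) : |(k i : ℝ)| ≤ √(lenSq k) := by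
  refine Real.abs_le_sqrt ?_
  exact Finset.single_le_sum (f := fun i => (k i : ℝ) ^ 2) (fun _ _ => sq_nonneg _)
    (Finset.mem_univ i)

lemma one_le_lenSq {k : Fin 3 → ℤ} (hk : k ≠ 0) : 1 ≤ lenSq k := by
  obtain ⟨i, hi⟩ := Function.ne_iff.1 hk
  have h1 : (1 : ℝ) ≤ (k i : ℝ) ^ 2 := by
    have : (1 : ℤ) ≤ k i ^ 2 := Int.one_le_abs hi |> fun h => by
      rw [← sq_abs]; nlinarith
    exact_mod_cast this
  exact h1.trans (Finset.single_le_sum (f := fun i => (k i : ℝ) ^ 2) (fun _ _ => sq_nonneg _)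
    (Finset.mem_univ i))

lemma sum_waveVec_sq (k : Fin 3 → ℤ) : ∑ i, waveVec k i ^ 2 = lenSq k := by
  simp [waveVec, lenSq]

lemma norm_C3_le_sum (a : C3) : ‖a‖ ≤ ∑ i, ‖a i‖ := by
  rw [EuclideanSpace.norm_eq]
  refine Real.sqrt_le_left (Finset.sum_nonneg fun i _ => norm_nonneg _) |>.2 ?_
  rw [Fin.sum_univ_three, Fin.sum_univ_three]
  nlinarith [mul_nonneg (norm_nonneg (a 0)) (norm_nonneg (a 1)),
    mul_nonneg (norm_nonneg (a 0)) (norm_nonneg (a 2)),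
    mul_nonneg (norm_nonneg (a 1)) (norm_nonneg (a 2))]

lemma norm_crossL_waveVec_le (k : Fin 3 → ℤ) : ‖crossL (waveVec k)‖ ≤ 6 * √(lenSq k) := by
  refine ContinuousLinearMap.opNorm_le_bound _ (by positivity) fun a => ?_
  have h1 : ∀ i j : Fin 3, ‖waveVec k i * a j‖ ≤ √(lenSq k) * ‖a‖ := fun i j => by
    rw [norm_mul]
    refine mul_le_mul ?_ (PiLp.norm_apply_le a j) (norm_nonneg _) (Real.sqrt_nonneg _)
    simpa [waveVec] using abs_le_sqrt_lenSq k i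
  have h2 : ∀ i j l m : Fin 3, ‖waveVec k i * a j - waveVec k l * a m‖ ≤
      √(lenSq k) * ‖a‖ + √(lenSq k) * ‖a‖ := fun i j l m =>
    (norm_sub_le _ _).trans (add_le_add (h1 _ _) (h1 _ _))
  refine (norm_C3_le_sum _).trans ?_
  rw [Fin.sum_univ_three, crossL_apply]
  simp only [Matrix.cons_val_zero, Matrix.cons_val_one, Matrix.cons_val]
  linarith [h2 1 2 2 1, h2 2 0 0 2, h2 0 1 1 0]

/-- The symbol of the Biot-Savart operator. -/
def biotSavartSymbol (k : Fin 3 → ℤ) : C3 →L[ℂ] C3 :=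
  (Complex.I / (2 * Real.pi * lenSq k)) • crossL (waveVec k)

lemma norm_biotSavartSymbol_le (k : Fin 3 → ℤ) : ‖biotSavartSymbol k‖ ≤ 1 / √(lenSq k) := by
  -- At frequency zero both sides vanish, as division by zero gives zero.
  by_cases hk : k = 0
  · subst hk
    have h0 : biotSavartSymbol 0 = 0 := by
      simp only [biotSavartSymbol, lenSq, Pi.zero_apply, Int.cast_zero, ne_eq,
        OfNat.ofNat_ne_zero, not_false_eq_true, zero_pow, Finset.sum_const_zero,
        Complex.ofReal_zero, mul_zero, div_zero]
      exact zero_smul ℂ (crossL (waveVec 0))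
    rw [h0, norm_zero]
    positivity
  have hs : 0 < √(lenSq k) := Real.sqrt_pos.2 (zero_lt_one.trans_le (one_le_lenSq hk))
  have h1 : ‖Complex.I / (2 * Real.pi * lenSq k)‖ = 1 / (2 * Real.pi * lenSq k) := by
    rw [norm_div, Complex.norm_I]
    congr 1
    have h : (2 * Real.pi * lenSq k : ℂ) = ((2 * Real.pi * lenSq k : ℝ) : ℂ) := by push_cast; rfl
    rw [h, Complex.norm_real, Real.norm_eq_abs, abs_of_nonneg]
    exact mul_nonneg (by positivity) (lenSq_nonneg k)
  rw [biotSavartSymbol, norm_smul, h1]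
  have h2 : lenSq k = √(lenSq k) * √(lenSq k) := (Real.mul_self_sqrt (lenSq_nonneg k)).symm
  calc 1 / (2 * Real.pi * lenSq k) * ‖crossL (waveVec k)‖
      ≤ 1 / (2 * Real.pi * lenSq k) * (6 * √(lenSq k)) :=
        mul_le_mul_of_nonneg_left (norm_crossL_waveVec_le k)
          (by have := lenSq_nonneg k; positivity)
    _ = 3 / Real.pi * (1 / √(lenSq k)) := by
        nth_rewrite 1 [h2]; field_simp; norm_num
    _ ≤ 1 * (1 / √(lenSq k)) := by
        refine mul_le_mul_of_nonneg_right ?_ (by positivity)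
        rw [div_le_one Real.pi_pos]; exact Real.pi_gt_three.le
    _ = 1 / √(lenSq k) := one_mul _

lemma norm_two_pi_I_mul (k : Fin 3 → ℤ) (j : Fin 3) :
    ‖(2 * Real.pi * Complex.I * k j : ℂ)‖ ≤ 2 * Real.pi * √(lenSq k) := by
  have h : ‖(2 * Real.pi * Complex.I * k j : ℂ)‖ = 2 * Real.pi * |(k j : ℝ)| := by
    simp [abs_of_pos Real.pi_pos]
  rw [h]
  exact mul_le_mul_of_nonneg_left (abs_le_sqrt_lenSq k j) (by positivity)

lemma sqrt_mul_one_div_sqrt_le (k : Fin 3 → ℤ) : √(lenSq k) * (1 / √(lenSq k)) ≤ 1 := by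
  rw [mul_one_div]; exact div_self_le_one _

lemma exists_biotSavart : ∃ T : L2V →L[ℂ] L2V, HasSymbol T biotSavartSymbol :=
  exists_hasSymbol (C := 1) fun k => by
    refine (norm_biotSavartSymbol_le k).trans ?_
    by_cases hk : k = 0
    · subst hk; simp [lenSq]
    · rw [div_le_one (Real.sqrt_pos.2 (zero_lt_one.trans_le (one_le_lenSq hk)))]
      exact Real.one_le_sqrt.2 (one_le_lenSq hk)

/-- The Biot-Savart operator: the inverse of the curl on divergence free fields of mean zero. -/
def biotSavart : L2V →L[ℂ] L2V := Classical.choose exists_biotSavart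

lemma hasSymbol_biotSavart : HasSymbol biotSavart biotSavartSymbol :=
  Classical.choose_spec exists_biotSavart

/-- One derivative costs a factor of order |k|, exactly compensating the decay of the symbol, so
Biot–Savart maps L² boundedly into `W^{1,2}`. -/
lemma exists_biotSavartDeriv (j : Fin 3) : ∃ T : L2V →L[ℂ] L2V,
    HasSymbol T fun k => (2 * Real.pi * Complex.I * k j : ℂ) • biotSavartSymbol k :=
  exists_hasSymbol (C := 2 * Real.pi) fun k => by
    rw [norm_smul]
    calc _ ≤ 2 * Real.pi * √(lenSq k) * (1 / √(lenSq k)) :=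
          mul_le_mul (norm_two_pi_I_mul k j) (norm_biotSavartSymbol_le k) (norm_nonneg _)
            (by positivity)
      _ = 2 * Real.pi * (√(lenSq k) * (1 / √(lenSq k))) := by ring
      _ ≤ 2 * Real.pi * 1 :=
          mul_le_mul_of_nonneg_left (sqrt_mul_one_div_sqrt_le k) (by positivity)
      _ = 2 * Real.pi := mul_one _

/-- The partial derivatives of the Biot-Savart operator. -/
def biotSavartDeriv (j : Fin 3) : L2V →L[ℂ] L2V := Classical.choose (exists_biotSavartDeriv j)

lemma hasSymbol_biotSavartDeriv (j : Fin 3) : HasSymbol (biotSavartDeriv j)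
    fun k => (2 * Real.pi * Complex.I * k j : ℂ) • biotSavartSymbol k :=
  Classical.choose_spec (exists_biotSavartDeriv j)

/-- The Biot-Savart operator with its weak gradient. -/
def biotSavartJet : L2V →L[ℂ] Jet :=
  biotSavart.prod (ContinuousLinearMap.pi biotSavartDeriv)

lemma biotSavartJet_fst (f : L2V) : (biotSavartJet f).1 = biotSavart f := rfl

lemma biotSavartJet_mem_W12 (f : L2V) : biotSavartJet f ∈ W12 := by
  rw [mem_W12_iff]
  intro j k
  change coeffL k (biotSavartDeriv j f) = _ • coeffL k (biotSavart f)
  rw [hasSymbol_biotSavartDeriv, hasSymbol_biotSavart, smul_apply]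

/-- The symbol decays like 1/|k|, so it exceeds `ε` in norm only on a finite box of frequencies. -/
lemma isCompactOperator_biotSavart : IsCompactOperator biotSavart := by
  refine hasSymbol_biotSavart.isCompactOperator fun ε hε => ?_
  obtain ⟨N, hN⟩ := exists_nat_gt (1 / ε)
  refine (Set.finite_Icc (fun _ => -(N : ℤ) : Fin 3 → ℤ) (fun _ => (N : ℤ))).subset fun k hk => ?_
  have h1 : ε < 1 / √(lenSq k) := lt_of_lt_of_le hk (norm_biotSavartSymbol_le k)
  have hs : 0 < √(lenSq k) := by
    by_contra h
    rw [le_antisymm (not_lt.1 h) (Real.sqrt_nonneg _), div_zero] at h1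
    exact absurd h1 (not_lt.2 hε.le)
  have h2 : √(lenSq k) < N := by
    refine lt_trans ?_ hN
    rwa [lt_one_div hs hε]
  have h3 : ∀ i, |k i| ≤ (N : ℤ) := fun i => by
    have : |(k i : ℝ)| ≤ N := (abs_le_sqrt_lenSq k i).trans h2.le
    exact_mod_cast this
  exact ⟨fun i => (abs_le.1 (h3 i)).1, fun i => (abs_le.1 (h3 i)).2⟩

/-- The cross product with a real vector is skew, and the factor `i` makes it Hermitian. -/
lemma inner_biotSavartSymbol (k : Fin 3 → ℤ) (a b : C3) :
    inner ℂ (biotSavartSymbol k a) b = inner ℂ a (biotSavartSymbol k b) := by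
  simp only [biotSavartSymbol, smul_apply, crossL_apply, PiLp.inner_apply, Fin.sum_univ_three]
  simp [waveVec, Complex.conj_ofNat]
  ring

lemma isSymmetric_biotSavart (f g : L2V) :
    inner ℂ (biotSavart f) g = inner ℂ f (biotSavart g) := by
  refine (hasSum_inner_coeffL _ _).unique ((hasSum_inner_coeffL _ _).congr_fun fun k => ?_)
  rw [hasSymbol_biotSavart, hasSymbol_biotSavart, inner_biotSavartSymbol]

/-! ### Curl and divergence -/

/-- The curl as an operator on jets. -/
def curlL : Jet →L[ℂ] L2V :=
  ∑ j, ((crossL (Pi.single j 1)).compLpL 2 cellMeasure) ∘L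
    (ContinuousLinearMap.proj j) ∘L (ContinuousLinearMap.snd ℂ L2V (Fin 3 → L2V))

lemma curlL_apply (p : Jet) :
    curlL p = ∑ j, (crossL (Pi.single j 1)).compLp (p.2 j) := by
  rw [curlL, sum_apply]
  rfl

lemma curlL_coe (p : Jet) : curlL p =ᵐ[cellMeasure] curl p := by
  have h := ae_all_iff.2 fun j => (crossL (Pi.single j 1)).coeFn_compLp (p.2 j)
  rw [curlL_apply]
  filter_upwards [h, Lp.coeFn_finsetSum Finset.univ
    (fun j => (crossL (Pi.single j 1)).compLp (p.2 j))] with x hx hs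
  rw [hs, Finset.sum_apply]
  simp only [hx]
  ext i
  fin_cases i <;> simp [crossL_apply, curl, Fin.sum_univ_three] <;> ring

lemma coeffL_compLp (X : C3 →L[ℂ] C3) (f : L2V) (k : Fin 3 → ℤ) :
    coeffL k (X.compLp f) = X (coeffL k f) := by
  rw [coeffL_apply, coeffL_apply, coeff, coeff,
    ← X.integral_comp_comm (integrable_character_smul k (integrable_L2V f))]
  refine integral_congr_ae ?_
  filter_upwards [X.coeFn_compLp f] with x hx
  rw [hx, map_smul]

lemma coeffL_curlL {p : Jet} (hp : p ∈ W12) (k : Fin 3 → ℤ) :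
    coeffL k (curlL p) = (2 * Real.pi * Complex.I) • crossL (waveVec k) (coeffL k p.1) := by
  rw [curlL_apply, map_sum, ← sum_smul_crossL_single, Finset.smul_sum]
  refine Finset.sum_congr rfl fun j _ => ?_
  rw [coeffL_compLp, mem_W12_iff.1 hp, map_smul, smul_smul]
  rfl

lemma l2Form_eq (u v : L2V) : l2Form u v = inner ℂ v u := by
  rw [L2.inner_def, l2Form]
  refine integral_congr_ae (Eventually.of_forall fun x => ?_)
  simp only [PiLp.inner_apply, RCLike.inner_apply]

lemma curlForm_eq (p q : Jet) : curlForm p q = inner ℂ (curlL q) (curlL p) := by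
  rw [← l2Form_eq, l2Form, curlForm]
  refine integral_congr_ae ?_
  filter_upwards [curlL_coe p, curlL_coe q] with x hp hq
  rw [hp, hq]

lemma mean_eq (u : L2V) : mean u = coeffL 0 u := by
  rw [coeffL_apply, coeff, mean]
  simp [character]

/-- The projection to the `j`-th coordinate, as a vector. -/
def coordL (j : Fin 3) : C3 →L[ℂ] C3 :=
  (EuclideanSpace.proj (𝕜 := ℂ) j).smulRight (EuclideanSpace.single 0 1)

/-- The divergence as an operator on jets, with values in the first coordinate. -/
def divL (p : Jet) : L2V := ∑ j, (coordL j).compLp (p.2 j)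

lemma divL_coe (p : Jet) :
    divL p =ᵐ[cellMeasure] fun x => divergence p x • (EuclideanSpace.single 0 1 : C3) := by
  have h := ae_all_iff.2 fun j => (coordL j).coeFn_compLp (p.2 j)
  filter_upwards [h, Lp.coeFn_finsetSum Finset.univ
    (fun j => (coordL j).compLp (p.2 j))] with x hx hs
  rw [divL, hs, Finset.sum_apply]
  simp only [hx, divergence, Finset.sum_smul]
  rfl

lemma divergence_eq_zero_iff {p : Jet} (hp : p ∈ W12) :
    (∀ᵐ x ∂cellMeasure, divergence p x = 0) ↔ ∀ k, ∑ i, waveVec k i * coeffL k p.1 i = 0 := by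
  have h1 : (∀ᵐ x ∂cellMeasure, divergence p x = 0) ↔ divL p = 0 := by
    rw [Lp.eq_zero_iff_ae_eq_zero]
    constructor
    · intro h
      filter_upwards [h, divL_coe p] with x hx hd
      rw [hd, hx, zero_smul]; rfl
    · intro h
      filter_upwards [h, divL_coe p] with x hx hd
      rw [hd] at hx
      simpa using congrArg (fun v : C3 => v 0) hx
  have h2 : ∀ k, coeffL k (divL p) = ((2 * Real.pi * Complex.I) *
      ∑ i, waveVec k i * coeffL k p.1 i) • (EuclideanSpace.single 0 1 : C3) := fun k => by
    rw [divL, map_sum, Finset.mul_sum, Finset.sum_smul]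
    refine Finset.sum_congr rfl fun j _ => ?_
    rw [coeffL_compLp, mem_W12_iff.1 hp]
    change ((2 * Real.pi * Complex.I * k j : ℂ) * coeffL k p.1 j) •
      (EuclideanSpace.single 0 1 : C3) = _
    congr 1
    simp only [waveVec]
    ring
  rw [h1]
  constructor
  · intro h k
    have h3 := h2 k
    rw [h, map_zero] at h3
    have h4 := congrArg (fun v : C3 => v 0) h3
    simpa [Real.pi_ne_zero] using h4.symm
  · intro h
    refine coeffL_ext fun k => ?_
    rw [h2, h, mul_zero, zero_smul, map_zero]

/-- The curls of the fields in `W2 D`. -/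
def curlSpace (D : Set E3) : Submodule ℂ L2V where
  -- Membership avoids derivatives: divergence and mean are read from Fourier coefficients, so the
  -- space is closed in L².
  carrier := {w | (∀ k, ∑ i, waveVec k i * coeffL k w i = 0) ∧ coeffL 0 w = 0 ∧
    ∀ᵐ x ∂cellMeasure, x ∉ D → w x = 0}
  zero_mem' := ⟨fun k => by simp, by simp, by
    filter_upwards [Lp.coeFn_zero C3 2 cellMeasure] with x hx _
    rw [hx]; rfl⟩
  add_mem' := fun {v w} hv hw => ⟨fun k => by
      simp only [map_add, PiLp.add_apply, mul_add, Finset.sum_add_distrib, hv.1 k, hw.1 k, add_zero],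
    by rw [map_add, hv.2.1, hw.2.1, add_zero], by
      filter_upwards [hv.2.2, hw.2.2, Lp.coeFn_add v w] with x h1 h2 h3 hx
      rw [h3, Pi.add_apply, h1 hx, h2 hx, add_zero]⟩
  smul_mem' := fun c w hw => ⟨fun k => by
      have h : ∀ i, waveVec k i * coeffL k (c • w) i = c * (waveVec k i * coeffL k w i) :=
        fun i => by rw [map_smul, PiLp.smul_apply, smul_eq_mul]; ring
      simp only [h, ← Finset.mul_sum, hw.1 k, mul_zero],
    by rw [map_smul, hw.2.1, smul_zero], by
      filter_upwards [hw.2.2, Lp.coeFn_smul c w] with x h1 h3 hx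
      rw [h3, Pi.smul_apply, h1 hx, smul_zero]⟩

lemma isClosed_curlSpace {D : Set E3} (hD : IsOpen D) : IsClosed (curlSpace D : Set L2V) := by
  have h1 : IsClosed {w : L2V | ∀ k, ∑ i, waveVec k i * coeffL k w i = 0} := by
    simp only [Set.ofPred_forall]
    refine isClosed_iInter fun k => isClosed_eq ?_ continuous_const
    refine continuous_finsetSum _ fun i _ => continuous_const.mul ?_
    exact (EuclideanSpace.proj (𝕜 := ℂ) i).continuous.comp (coeffL k).continuous
  have h2 : IsClosed {w : L2V | coeffL 0 w = 0} := isClosed_eq (coeffL 0).continuous continuous_const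
  have h3 : IsClosed {w : L2V | ∀ᵐ x ∂cellMeasure, x ∉ D → w x = 0} := by
    have h4 : {w : L2V | ∀ᵐ x ∂cellMeasure, x ∉ D → w x = 0} =
        {w : L2V | LpToLpRestrictCLM E3 C3 ℂ cellMeasure 2 Dᶜ w = 0} := by
      ext w
      simp only [Set.mem_ofPred_eq]
      rw [Lp.eq_zero_iff_ae_eq_zero]
      change (∀ᵐ x ∂cellMeasure, x ∈ Dᶜ → w x = 0) ↔ _
      rw [← ae_restrict_iff' hD.measurableSet.compl]
      have h5 := LpToLpRestrictCLM_coeFn ℂ Dᶜ w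
      constructor
      · intro h; exact h5.trans h
      · intro h; exact h5.symm.trans h
    rw [h4]
    exact isClosed_eq (ContinuousLinearMap.continuous _) continuous_const
  exact h1.inter (h2.inter h3)

lemma biotSavartJet_mem_J (w : L2V) : biotSavartJet w ∈ J := by
  refine ⟨biotSavartJet_mem_W12 w, ?_, ?_⟩
  · rw [divergence_eq_zero_iff (biotSavartJet_mem_W12 w)]
    intro k
    rw [biotSavartJet_fst, hasSymbol_biotSavart, biotSavartSymbol]
    have h := dot_crossL (waveVec k) (coeffL k w)
    have h2 : ∀ i, waveVec k i * ((Complex.I / (2 * Real.pi * lenSq k)) •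
        crossL (waveVec k)) (coeffL k w) i = (Complex.I / (2 * Real.pi * lenSq k)) *
          (waveVec k i * crossL (waveVec k) (coeffL k w) i) := fun i => by
      rw [smul_apply, PiLp.smul_apply, smul_eq_mul]; ring
    simp only [h2, ← Finset.mul_sum, h, mul_zero]
  · rw [mean_eq, biotSavartJet_fst, hasSymbol_biotSavart]
    simp [biotSavartSymbol, lenSq]

lemma lenSq_ne_zero {k : Fin 3 → ℤ} (hk : k ≠ 0) : (lenSq k : ℂ) ≠ 0 := by
  have := one_le_lenSq hk
  exact_mod_cast (zero_lt_one.trans_le this).ne'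

lemma cross_identity {k : Fin 3 → ℤ} (hk : k ≠ 0) {a : C3} (ha : ∑ i, waveVec k i * a i = 0) :
    (2 * Real.pi * Complex.I : ℂ) • crossL (waveVec k) (biotSavartSymbol k a) = a := by
  rw [biotSavartSymbol, smul_apply, map_smul, crossL_crossL, ha, sum_waveVec_sq, zero_smul,
    zero_sub, smul_neg, smul_neg, smul_smul, smul_smul, ← neg_smul]
  have h := lenSq_ne_zero hk
  have hpi : (Real.pi : ℂ) ≠ 0 := by exact_mod_cast Real.pi_ne_zero
  have h1 : -(2 * Real.pi * Complex.I * (Complex.I / (2 * Real.pi * lenSq k)) * lenSq k) = 1 := by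
    field_simp
    rw [Complex.I_sq]; norm_num
  rw [mul_assoc] at h1 ⊢
  rw [h1, one_smul]

/-- Transversality inverts the curl at each nonzero frequency, and the mean zero condition settles
frequency zero. -/
lemma curlL_biotSavartJet {D : Set E3} {w : L2V} (hw : w ∈ curlSpace D) :
    curlL (biotSavartJet w) = w := by
  refine coeffL_ext fun k => ?_
  rw [coeffL_curlL (biotSavartJet_mem_W12 w), biotSavartJet_fst, hasSymbol_biotSavart]
  by_cases hk : k = 0
  · subst hk; rw [hw.2.1]; simp
  · exact cross_identity hk (hw.1 k)

lemma biotSavartJet_mem_W2 {D : Set E3} {w : L2V} (hw : w ∈ curlSpace D) :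
    biotSavartJet w ∈ W2 D := by
  refine ⟨biotSavartJet_mem_J w, ?_⟩
  have h := curlL_coe (biotSavartJet w)
  rw [curlL_biotSavartJet hw] at h
  filter_upwards [h, hw.2.2] with x hx hx' hxD
  rw [← hx, hx' hxD]

lemma curlL_mem_curlSpace {D : Set E3} {p : Jet} (hp : p ∈ W12)
    (hc : ∀ᵐ x ∂cellMeasure, x ∉ D → curl p x = 0) : curlL p ∈ curlSpace D := by
  refine ⟨fun k => ?_, ?_, ?_⟩
  · have h := dot_crossL (waveVec k) (coeffL k p.1)
    have h2 : ∀ i, waveVec k i * coeffL k (curlL p) i = (2 * Real.pi * Complex.I) *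
        (waveVec k i * crossL (waveVec k) (coeffL k p.1) i) := fun i => by
      rw [coeffL_curlL hp, PiLp.smul_apply, smul_eq_mul]; ring
    simp only [h2, ← Finset.mul_sum, h, mul_zero]
  · rw [coeffL_curlL hp]
    ext i
    fin_cases i <;> simp [crossL_apply, waveVec]
  · filter_upwards [hc, curlL_coe p] with x hx hx' hxD
    rw [hx', hx hxD]

/-- The other half of the bijection between `W2 D` and `curlSpace D`: divergence zero and mean zero
leave the curl no kernel. -/
lemma biotSavart_curlL {p : Jet} (hp : p ∈ J) : biotSavartJet (curlL p) = p := by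
  refine W12_ext (biotSavartJet_mem_W12 _) hp.1 (coeffL_ext fun k => ?_)
  rw [biotSavartJet_fst, hasSymbol_biotSavart, coeffL_curlL hp.1]
  by_cases hk : k = 0
  · subst hk
    have h := hp.2.2
    rw [mean_eq] at h
    simp [h]
  · have h := cross_identity hk ((divergence_eq_zero_iff hp.1).1 hp.2.1 k)
    rw [biotSavartSymbol, smul_apply, map_smul] at h ⊢
    rwa [smul_comm]

/-! ### The inverse Laplacian and its curl -/

/-- The first bound makes the series square summable, the second does the same for its gradient; `k
= 0` is covered by the inverse of zero being zero. -/
lemma invLaplacian_symbol_bound (k : Fin 3 → ℤ) :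
    (((2 * Real.pi) ^ 2 * lenSq k)⁻¹ : ℝ) ≤ 1 ∧
    2 * Real.pi * √(lenSq k) * (((2 * Real.pi) ^ 2 * lenSq k)⁻¹ : ℝ) ≤ 1 := by
  by_cases hk : k = 0
  · subst hk; simp [lenSq]
  have h1 := one_le_lenSq hk
  have h2 : 1 ≤ √(lenSq k) := Real.one_le_sqrt.2 h1
  have h3 : (1 : ℝ) ≤ 2 * Real.pi := by linarith [Real.pi_gt_three]
  have h4 : (1 : ℝ) ≤ 2 * Real.pi * √(lenSq k) := one_le_mul_of_one_le_of_one_le h3 h2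
  have h5 : (2 * Real.pi) ^ 2 * lenSq k = (2 * Real.pi * √(lenSq k)) ^ 2 := by
    rw [mul_pow (2 * Real.pi), Real.sq_sqrt (lenSq_nonneg k)]
  rw [h5]
  set x := 2 * Real.pi * √(lenSq k)
  have hx : 0 < x := by linarith
  constructor
  · exact inv_le_one_of_one_le₀ (one_le_pow₀ h4)
  · have : x * (x ^ 2)⁻¹ = x⁻¹ := by field_simp
    rw [this]
    exact inv_le_one_of_one_le₀ h4

/-- The inverse Laplacian is a Fourier multiplier. -/
lemma coeffL_invLaplacian (f : L2V) (k : Fin 3 → ℤ) :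
    coeffL k (invLaplacian f) = ((((2 * Real.pi) ^ 2 * lenSq k)⁻¹ : ℝ) : ℂ) • coeffL k f := by
  have hs : Summable fun k => ‖((((2 * Real.pi) ^ 2 * lenSq k)⁻¹ : ℝ) : ℂ) • coeffL k f‖ ^ 2 := by
    refine Summable.of_nonneg_of_le (fun k => by positivity) (fun k => ?_)
      (hasSum_norm_sq_coeffL f).summable
    refine pow_le_pow_left₀ (norm_nonneg _) ?_ 2
    rw [norm_smul, Complex.norm_real, Real.norm_eq_abs,
      abs_of_nonneg (inv_nonneg.2 (mul_nonneg (by positivity) (lenSq_nonneg k)))]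
    exact mul_le_of_le_one_left (norm_nonneg _) (invLaplacian_symbol_bound k).1
  obtain ⟨g, hg⟩ := exists_coeffL_eq hs
  suffices invLaplacian f = g by rw [this, hg]
  have h1 := hasSum_wave g
  have h2 : Function.support (fun k => wave k (coeffL k g)) ⊆ {k | k ≠ 0} := by
    intro k hk
    rintro rfl
    refine hk ?_
    simp only [hg]
    simp only [lenSq, Pi.zero_apply, Int.cast_zero, ne_eq, OfNat.ofNat_ne_zero,
      not_false_eq_true, zero_pow, Finset.sum_const_zero, mul_zero, inv_zero,
      Complex.ofReal_zero, zero_smul]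
    exact (waveL 0).map_zero
  have h3 := (hasSum_subtype_iff_of_support_subset h2).2 h1
  rw [← h3.tsum_eq, invLaplacian]
  refine tsum_congr fun k => ?_
  simp only [Function.comp_apply, hg, coeffL_apply]
  congr 1

lemma exists_jet_invLaplacian (f : L2V) : ∃ w ∈ W12, w.1 = invLaplacian f := by
  have hs : ∀ j, Summable fun k =>
      ‖(2 * Real.pi * Complex.I * k j : ℂ) • coeffL k (invLaplacian f)‖ ^ 2 := fun j => by
    refine Summable.of_nonneg_of_le (fun k => by positivity) (fun k => ?_)
      (hasSum_norm_sq_coeffL f).summable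
    refine pow_le_pow_left₀ (norm_nonneg _) ?_ 2
    have h0 : 0 ≤ ((2 * Real.pi) ^ 2 * lenSq k)⁻¹ :=
      inv_nonneg.2 (mul_nonneg (by positivity) (lenSq_nonneg k))
    rw [coeffL_invLaplacian, norm_smul, norm_smul, Complex.norm_real, Real.norm_eq_abs,
      abs_of_nonneg h0, ← mul_assoc]
    exact mul_le_of_le_one_left (norm_nonneg _)
      ((mul_le_mul_of_nonneg_right (norm_two_pi_I_mul k j) h0).trans
        (invLaplacian_symbol_bound k).2)
  choose g hg using fun j => exists_coeffL_eq (hs j)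
  exact ⟨(invLaplacian f, g), mem_W12_iff.2 fun j k => hg j k, rfl⟩

/-- The factor `2πi k ×` against `(2π|k|)⁻²` is precisely the Biot–Savart symbol, without any
divergence condition on `f`. -/
lemma curlL_of_invLaplacian {w : Jet} (hw : w ∈ W12) {f : L2V} (hf : w.1 = invLaplacian f) :
    curlL w = biotSavart f := by
  refine coeffL_ext fun k => ?_
  rw [coeffL_curlL hw, hf, coeffL_invLaplacian, hasSymbol_biotSavart, biotSavartSymbol, map_smul,
    smul_smul, smul_apply]
  congr 1
  by_cases hk : k = 0
  · subst hk; simp [lenSq]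
  have h := lenSq_ne_zero hk
  have hpi : (Real.pi : ℂ) ≠ 0 := by exact_mod_cast Real.pi_ne_zero
  push_cast
  field_simp

/-! ### The limit operator -/

/-- The orthogonal projection to the curls of the fields in `W2 D`. -/
def limitOperator {D : Set E3} (hD : IsOpen D) : L2V →L[ℂ] L2V :=
  have : CompleteSpace (curlSpace D) := (isClosed_curlSpace hD).completeSpace_coe
  biotSavart ∘L (curlSpace D).starProjection ∘L biotSavart

/-- Test fields enter the curl form only through their curls, and these exhaust `curlSpace D`; the
projection becomes an L² projection of `biotSavart f`. -/
lemma isProjW2_iff {D : Set E3} {f : L2V} {w : Jet} (hw : w ∈ W12)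
    (hf : w.1 = invLaplacian f) {p : Jet} :
    IsProjW2 D w p ↔ p ∈ W2 D ∧ ∀ v ∈ curlSpace D, inner ℂ v (curlL p) = inner ℂ v (biotSavart f) := by
  refine and_congr_right fun hp => ⟨fun h v hv => ?_, fun h v hv => ?_⟩
  · have := h _ (biotSavartJet_mem_W2 hv)
    rwa [curlForm_eq, curlForm_eq, curlL_biotSavartJet hv, curlL_of_invLaplacian hw hf] at this
  · rw [curlForm_eq, curlForm_eq, curlL_of_invLaplacian hw hf]
    exact h _ (curlL_mem_curlSpace hv.1.1 hv.2)

/-- The curl of the projected field is the orthogonal projection of `biotSavart f` to `curlSpace D`,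
and Biot–Savart recovers the field from it. Existence and uniqueness of the limit operator both
follow. -/
theorem isLimitOperator_iff {D : Set E3} (hD : IsOpen D) {A : L2V →L[ℂ] L2V} :
    IsLimitOperator D A ↔ A = limitOperator hD := by
  have : CompleteSpace (curlSpace D) := (isClosed_curlSpace hD).completeSpace_coe
  constructor
  · intro h
    ext1 f
    obtain ⟨w, hw, hwf, p, hp, hA⟩ := h f
    obtain ⟨hpW, hp⟩ := (isProjW2_iff hw hwf).1 hp
    have h1 : (curlSpace D).starProjection (biotSavart f) = curlL p := by
      refine Submodule.eq_starProjection_of_mem_of_inner_eq_zero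
        (curlL_mem_curlSpace hpW.1.1 hpW.2) fun v hv => ?_
      rw [← inner_conj_symm, inner_sub_right, hp v hv, sub_self, map_zero]
    change A f = biotSavart ((curlSpace D).starProjection (biotSavart f))
    rw [h1, hA, ← biotSavartJet_fst, biotSavart_curlL hpW.1]
  · rintro rfl f
    obtain ⟨w, hw, hwf⟩ := exists_jet_invLaplacian f
    have hm := Submodule.starProjection_apply_mem (curlSpace D) (biotSavart f)
    refine ⟨w, hw, hwf, biotSavartJet ((curlSpace D).starProjection (biotSavart f)), ?_, rfl⟩
    refine (isProjW2_iff hw hwf).2 ⟨biotSavartJet_mem_W2 hm, fun v hv => ?_⟩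
    rw [curlL_biotSavartJet hm, ← Submodule.inner_starProjection_left_eq_right,
      Submodule.starProjection_eq_self_iff.mpr hv]

/-! ### Mollification -/

/-- The convolution of the field `w` with the kernel `θ`. -/
def mollify (θ : E3 → ℝ) (w : E3 → C3) (x : E3) : C3 := ∫ t, θ t • w (x - t)

lemma mollify_eq_convolution (θ : E3 → ℝ) (w : E3 → C3) :
    mollify θ w = convolution θ w (ContinuousLinearMap.lsmul ℝ ℝ) volume := rfl

lemma contDiff_mollify {θ : E3 → ℝ} (hθ : ContDiff ℝ ∞ θ) (hc : HasCompactSupport θ)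
    {w : E3 → C3} (hw : LocallyIntegrable w) : ContDiff ℝ ∞ (mollify θ w) :=
  hc.contDiff_convolution_left (ContinuousLinearMap.lsmul ℝ ℝ) hθ hw

lemma integrable_mollify {θ : E3 → ℝ} (hθ : Continuous θ) (hc : HasCompactSupport θ)
    {w : E3 → C3} (hw : LocallyIntegrable w) (x : E3) :
    Integrable fun t => θ t • w (x - t) :=
  hc.convolutionExists_left (ContinuousLinearMap.lsmul ℝ ℝ) hθ hw x

lemma fderiv_mollify {θ : E3 → ℝ} (hθ : ContDiff ℝ ∞ θ) (hc : HasCompactSupport θ)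
    {w : E3 → C3} (hw : LocallyIntegrable w) (x v : E3) :
    fderiv ℝ (mollify θ w) x v = mollify (fun t => fderiv ℝ θ t v) w x := by
  have h1 : ContDiff ℝ 1 θ := hθ.of_le (by simp)
  have h := hc.hasFDerivAt_convolution_left (ContinuousLinearMap.lsmul ℝ ℝ) (μ := volume) h1 hw x
  rw [mollify_eq_convolution, h.fderiv, convolution_def, ContinuousLinearMap.integral_apply]
  · rfl
  · exact (hc.fderiv ℝ).convolutionExists_left _ (h1.continuous_fderiv one_ne_zero) hw x

lemma exists_bound_of_hasCompactSupport {θ : E3 → ℝ} (hθ : Continuous θ)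
    (hc : HasCompactSupport θ) :
    ∃ M R : ℝ, 0 ≤ M ∧ (∀ t, ‖θ t‖ ≤ M) ∧ ∀ t, R ≤ ‖t‖ → θ t = 0 := by
  obtain ⟨M, hM⟩ := hc.exists_bound_of_continuous hθ
  obtain ⟨R, hR⟩ := hc.isCompact.isBounded.subset_ball 0
  refine ⟨M, R, (norm_nonneg _).trans (hM 0), hM, fun t ht => ?_⟩
  refine image_eq_zero_of_notMem_tsupport fun h => ?_
  have := mem_ball_zero_iff.1 (hR h)
  linarith

/-- The integrand of a superposition of mollifications is jointly integrable. -/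
lemma integrable_prod_mollify {α : Type*} [MeasurableSpace α] {μ : Measure α} [IsFiniteMeasure μ]
    {G : Type*} [NormedAddCommGroup G] [NormedSpace ℝ G]
    {w : E3 → C3} (hw : StronglyMeasurable w) (hwi : LocallyIntegrable w)
    {θ : E3 → ℝ} (hθ : Measurable θ) {M R : ℝ} (hθM : ∀ t, ‖θ t‖ ≤ M)
    (hθR : ∀ t, R ≤ ‖t‖ → θ t = 0) {h : α → C3 →L[ℝ] G} (hh : StronglyMeasurable h)
    {C : ℝ} (hhC : ∀ᵐ a ∂μ, ‖h a‖ ≤ C) {g : α → E3} (hg : Measurable g) {B : ℝ}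
    (hgB : ∀ᵐ a ∂μ, ‖g a‖ ≤ B) :
    Integrable (fun z : α × E3 => h z.1 (θ z.2 • w (g z.1 - z.2))) (μ.prod volume) := by
  have hm : StronglyMeasurable fun z : α × E3 => h z.1 (θ z.2 • w (g z.1 - z.2)) := by
    have h1 : StronglyMeasurable fun z : α × E3 => h z.1 := hh.comp_measurable measurable_fst
    have h2 : StronglyMeasurable fun z : α × E3 => θ z.2 • w (g z.1 - z.2) :=
      (hθ.comp measurable_snd).stronglyMeasurable.smul
        (hw.comp_measurable ((hg.comp measurable_fst).sub measurable_snd))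
    exact isBoundedBilinearMap_apply.continuous.comp_stronglyMeasurable (h1.prodMk h2)
  refine ⟨hm.aestronglyMeasurable, ?_⟩
  rw [HasFiniteIntegral, lintegral_prod _ hm.enorm.aemeasurable]
  -- For `‖g a‖ ≤ B` the kernel only sees `w` on the ball of radius `B + R`, which bounds the inner
  -- integral uniformly in `a`.
  set I : ENNReal := ∫⁻ y in Metric.ball (0 : E3) (B + R), ‖w y‖ₑ with hI
  have hIfin : I < ⊤ :=
    (hwi.integrableOn_isCompact (isCompact_closedBall (0 : E3) (B + R))).mono_set
      Metric.ball_subset_closedBall |>.2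
  have hle : ∀ᵐ a ∂μ, ∫⁻ t, ‖h a (θ t • w (g a - t))‖ₑ ≤ ENNReal.ofReal (C * M) * I := by
    filter_upwards [hhC, hgB] with a ha hga
    calc ∫⁻ t, ‖h a (θ t • w (g a - t))‖ₑ
        ≤ ∫⁻ t, (fun y => ENNReal.ofReal (C * M) *
            (Metric.ball (0 : E3) (B + R)).indicator (fun y => ‖w y‖ₑ) y) (g a - t) := by
          refine lintegral_mono fun t => ?_
          by_cases ht : R ≤ ‖t‖
          · simp [hθR t ht]
          · have hmem : g a - t ∈ Metric.ball (0 : E3) (B + R) := by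
              rw [mem_ball_zero_iff]
              exact (norm_sub_le _ _).trans_lt (by linarith)
            simp only [Set.indicator_of_mem hmem]
            rw [← ofReal_norm (w _), ← ofReal_norm,
              ← ENNReal.ofReal_mul' (norm_nonneg _)]
            refine ENNReal.ofReal_le_ofReal ?_
            refine ((h a).le_of_opNorm_le ha _).trans ?_
            rw [norm_smul, mul_assoc]
            exact mul_le_mul_of_nonneg_left
              (mul_le_mul_of_nonneg_right (hθM t) (norm_nonneg _)) ((norm_nonneg _).trans ha)
      _ = ENNReal.ofReal (C * M) * I := by
          rw [lintegral_sub_left_eq_self (fun y => ENNReal.ofReal (C * M) *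
            (Metric.ball (0 : E3) (B + R)).indicator (fun y => ‖w y‖ₑ) y),
            lintegral_const_mul' _ _ ENNReal.ofReal_ne_top,
            lintegral_indicator Metric.isOpen_ball.measurableSet]
  calc ∫⁻ a, ∫⁻ t, ‖h a (θ t • w (g a - t))‖ₑ ∂volume ∂μ
      ≤ ∫⁻ _a, ENNReal.ofReal (C * M) * I ∂μ := lintegral_mono_ae hle
    _ < ⊤ := by
      rw [lintegral_const]
      exact ENNReal.mul_lt_top (ENNReal.mul_lt_top ENNReal.ofReal_lt_top hIfin)
        (measure_lt_top _ _)

lemma mollify_comm {ρ θ : E3 → ℝ} (hρ : Continuous ρ) (hρc : HasCompactSupport ρ)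
    (hθ : Continuous θ) (hθc : HasCompactSupport θ) {w : E3 → C3} (hw : StronglyMeasurable w)
    (hwi : LocallyIntegrable w) (x : E3) :
    mollify ρ (mollify θ w) x = mollify θ (mollify ρ w) x := by
  obtain ⟨M, R, -, hM, hR⟩ := exists_bound_of_hasCompactSupport hθ hθc
  obtain ⟨C, R', hC0, hC, hR'⟩ := exists_bound_of_hasCompactSupport hρ hρc
  set μ : Measure E3 := volume.restrict (Metric.ball 0 R') with hμ
  have hμf : IsFiniteMeasure μ := ⟨by
    rw [hμ, Measure.restrict_apply_univ]; exact measure_ball_lt_top⟩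
  have hres : ∀ f : E3 → C3, (∀ z, ρ z = 0 → f z = 0) → ∫ z, f z = ∫ z, f z ∂μ := fun f hf =>
    (setIntegral_eq_integral_of_forall_compl_eq_zero fun z hz => hf z (hR' z (by
      simpa using hz))).symm
  have hint := integrable_prod_mollify (μ := μ) hw hwi hθ.measurable hM hR
    (h := fun z => ρ z • ContinuousLinearMap.id ℝ C3) (C := C)
    ((hρ.smul continuous_const).stronglyMeasurable) (Eventually.of_forall fun z => by
      rw [norm_smul]
      exact (mul_le_mul (hC z) ContinuousLinearMap.norm_id_le (norm_nonneg _) hC0).trans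
        (mul_one C).le)
    (g := fun z => x - z) (by fun_prop) (B := ‖x‖ + R') (by
      filter_upwards [ae_restrict_mem Metric.isOpen_ball.measurableSet] with z hz
      exact (norm_sub_le _ _).trans (by have := mem_ball_zero_iff.1 hz; linarith))
  have hswap := integral_integral_swap (f := fun z t => ρ z • θ t • w (x - z - t)) hint
  unfold mollify
  rw [hres _ fun z hz => by rw [hz, zero_smul]]
  simp_rw [← integral_smul]
  rw [hswap]
  refine integral_congr_ae (Eventually.of_forall fun t => ?_)
  simp only
  rw [← hres (fun z => ρ z • θ t • w (x - z - t)) fun z hz => by rw [hz, zero_smul]]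
  refine integral_congr_ae (Eventually.of_forall fun z => ?_)
  simp only
  rw [smul_comm, sub_right_comm]

/-- The pairing of a field vector with a tangent vector. -/
def pairing : C3 →L[ℝ] E3 →L[ℝ] ℂ :=
  ∑ j, (ContinuousLinearMap.mul ℝ ℂ).bilinearComp
    ((EuclideanSpace.proj (𝕜 := ℂ) j).restrictScalars ℝ)
    (Complex.ofRealCLM.comp (EuclideanSpace.proj (𝕜 := ℝ) j))

lemma pairing_apply (v : C3) (h : E3) : pairing v h = ∑ j, v j * ((h j : ℝ) : ℂ) := by
  simp [pairing, sum_apply]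

/-- The line integral of the field `w` along the curve `Γ`. -/
def circulation (Γ : ℝ → E3) (w : E3 → C3) : ℂ :=
  ∫ s in (0 : ℝ)..1, pairing (w (Γ s)) (deriv Γ s)

lemma integrable_prod_circulation {Γ : ℝ → E3} (hΓ : ContDiff ℝ 1 Γ)
    {w : E3 → C3} (hw : StronglyMeasurable w) (hwi : LocallyIntegrable w)
    {θ : E3 → ℝ} (hθ : Measurable θ) {M R : ℝ} (hθM : ∀ t, ‖θ t‖ ≤ M)
    (hθR : ∀ t, R ≤ ‖t‖ → θ t = 0) :
    Integrable (fun z : ℝ × E3 => pairing (θ z.2 • w (Γ z.1 - z.2)) (deriv Γ z.1))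
      ((volume.restrict (Set.Ioc (0 : ℝ) 1)).prod volume) := by
  have hd : Continuous (deriv Γ) := hΓ.continuous_deriv le_rfl
  have hd' : Continuous fun s => pairing.flip (deriv Γ s) := pairing.flip.continuous.comp hd
  obtain ⟨C, hC⟩ := isCompact_Icc.exists_bound_of_continuousOn (s := Set.Icc (0 : ℝ) 1)
    hd'.continuousOn
  obtain ⟨B, hB⟩ := isCompact_Icc.exists_bound_of_continuousOn (s := Set.Icc (0 : ℝ) 1)
    hΓ.continuous.continuousOn
  have hmem : ∀ᵐ s ∂(volume.restrict (Set.Ioc (0 : ℝ) 1)), s ∈ Set.Icc (0 : ℝ) 1 := by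
    filter_upwards [ae_restrict_mem measurableSet_Ioc] with s hs using Set.Ioc_subset_Icc_self hs
  exact integrable_prod_mollify hw hwi hθ hθM hθR hd'.stronglyMeasurable
    (hmem.mono fun s hs => hC s hs) hΓ.continuous.measurable (hmem.mono fun s hs => hB s hs)

/-- Fubini: averaging the line integral over translates gives the line integral of the mollified
field. This links curves with fields known only almost everywhere. -/
lemma integral_smul_circulation {Γ : ℝ → E3} (hΓ : ContDiff ℝ 1 Γ)
    {w : E3 → C3} (hw : StronglyMeasurable w) (hwi : LocallyIntegrable w)
    {θ : E3 → ℝ} (hθ : Continuous θ) (hc : HasCompactSupport θ) :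
    ∫ t, θ t • circulation Γ (fun x => w (x - t)) = circulation Γ (mollify θ w) := by
  obtain ⟨M, R, -, hM, hR⟩ := exists_bound_of_hasCompactSupport hθ hc
  have hint := integrable_prod_circulation hΓ hw hwi hθ.measurable hM hR
  have hswap := integral_integral_swap
    (f := fun s t => pairing (θ t • w (Γ s - t)) (deriv Γ s)) hint
  unfold circulation
  simp_rw [intervalIntegral.integral_of_le zero_le_one]
  simp_rw [← integral_smul]
  have h1 : ∀ t, ∫ s in Set.Ioc (0 : ℝ) 1, θ t • pairing (w (Γ s - t)) (deriv Γ s) =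
      ∫ s in Set.Ioc (0 : ℝ) 1, pairing (θ t • w (Γ s - t)) (deriv Γ s) := fun t => by
    refine integral_congr_ae (Eventually.of_forall fun s => ?_)
    simp only [map_smul, smul_apply]
  simp_rw [h1]
  rw [← hswap]
  refine integral_congr_ae (Eventually.of_forall fun s => ?_)
  simp only
  rw [mollify]
  exact (pairing.flip (deriv Γ s)).integral_comp_comm (integrable_mollify hθ hc hwi (Γ s))

/-! ### Periodic extension -/

lemma measurable_wrap : Measurable wrap := by
  refine (WithLp.measurable_toLp 2 _).comp (measurable_pi_lambda _ fun i => ?_)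
  have h : Measurable fun x : E3 => x i := by fun_prop
  exact (h.sub ((measurable_from_top (f := fun n : ℤ => (n : ℝ))).comp
    (Int.measurable_ceil.comp h))).add_const 1

lemma wrap_mem_cell (x : E3) : wrap x ∈ cell := fun i => by
  simp only [wrap]
  constructor
  · linarith [Int.ceil_lt_add_one (x i)]
  · linarith [Int.le_ceil (x i)]

lemma wrap_eq_shift (x : E3) : wrap x = shift x fun i => 1 - ⌈x i⌉ := by
  ext i
  simp only [wrap, shift]
  push_cast
  ring

lemma wrap_shift (x : E3) (n : Fin 3 → ℤ) : wrap (shift x n) = wrap x := by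
  ext i
  simp only [wrap, shift, Int.ceil_add_intCast]
  push_cast
  ring

lemma shift_shift (x : E3) (m n : Fin 3 → ℤ) : shift (shift x m) n = shift x (m + n) := by
  ext i
  simp only [shift, Pi.add_apply]
  push_cast
  ring

lemma shift_eq_add (x : E3) (n : Fin 3 → ℤ) : shift x n = x + shift 0 n := by
  ext i; simp [shift]

lemma volume_preimage_shift (n : Fin 3 → ℤ) (s : Set E3) :
    volume ((fun x => shift x n) ⁻¹' s) = volume s := by
  rw [show (fun x => shift x n) = fun x => x + shift 0 n from funext fun x => shift_eq_add x n]
  exact measure_preimage_add_right volume (shift 0 n) s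

/-- The preimage of a null set lies in countably many lattice translates of its part in the cell;
statements holding almost everywhere on the cell extend to space. -/
lemma quasiMeasurePreserving_wrap : Measure.QuasiMeasurePreserving wrap volume cellMeasure := by
  refine ⟨measurable_wrap, Measure.AbsolutelyContinuous.mk fun s hs h0 => ?_⟩
  rw [Measure.map_apply measurable_wrap hs]
  rw [cellMeasure, Measure.restrict_apply hs] at h0
  refine measure_mono_null (t := ⋃ n : Fin 3 → ℤ, (fun x => shift x n) ⁻¹' (s ∩ cell))
    (fun x hx => ?_) (measure_iUnion_null fun n => by rw [volume_preimage_shift, h0])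
  refine Set.mem_iUnion.2 ⟨fun i => 1 - ⌈x i⌉, ?_⟩
  rw [Set.mem_preimage, ← wrap_eq_shift]
  exact ⟨hx, wrap_mem_cell x⟩

lemma exists_map_wrap_le (R : ℝ) :
    ∃ N : ℝ≥0, (volume.restrict (Metric.ball (0 : E3) R)).map wrap ≤ N • cellMeasure := by
  -- The lattice vector taking `x` into the half-open cell has entries `1 - ⌈x i⌉`, hence the
  -- additional 1.
  set M : ℤ := ⌈R⌉ + 1
  set s : Finset (Fin 3 → ℤ) := Finset.Icc (fun _ => -M) (fun _ => M)
  refine ⟨s.card, Measure.le_iff.2 fun t ht => ?_⟩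
  rw [Measure.map_apply measurable_wrap ht, Measure.restrict_apply (measurable_wrap ht),
    Measure.smul_apply, cellMeasure, Measure.restrict_apply ht]
  have hsub : wrap ⁻¹' t ∩ Metric.ball (0 : E3) R ⊆
      ⋃ n ∈ s, (fun x => shift x n) ⁻¹' (t ∩ cell) := by
    rintro x ⟨hx, hxR⟩
    refine Set.mem_iUnion₂.2 ⟨fun i => 1 - ⌈x i⌉, ?_, ?_⟩
    · have hxi : ∀ i, |x i| ≤ R := fun i =>
        (PiLp.norm_apply_le x i).trans (mem_ball_zero_iff.1 hxR).le
      have h1 : ∀ i, ⌈x i⌉ ≤ ⌈R⌉ := fun i => Int.ceil_mono (abs_le.1 (hxi i)).2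
      have h2 : ∀ i, -⌈R⌉ ≤ ⌈x i⌉ := fun i => by
        have h3 : (-⌈R⌉ : ℝ) ≤ x i := by linarith [(abs_le.1 (hxi i)).1, Int.le_ceil R]
        exact_mod_cast h3.trans (Int.le_ceil (x i))
      refine Finset.mem_Icc.2 ⟨fun i => ?_, fun i => ?_⟩
      · have := h1 i; simp only [M]; omega
      · have := h2 i; simp only [M]; omega
    · rw [Set.mem_preimage, ← wrap_eq_shift]
      exact ⟨hx, wrap_mem_cell x⟩
  refine (measure_mono hsub).trans ((measure_biUnion_finset_le _ _).trans ?_)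
  simp only [volume_preimage_shift]
  rw [Finset.sum_const, nsmul_eq_mul, ENNReal.smul_def, smul_eq_mul]
  simp

lemma stronglyMeasurable_periodicExt (u : L2V) : StronglyMeasurable (periodicExt u) :=
  (Lp.stronglyMeasurable u).comp_measurable measurable_wrap

lemma exists_lintegral_periodicExt_le (R : ℝ) :
    ∃ N : ℝ≥0, ∀ u : L2V, ∫⁻ x in Metric.ball (0 : E3) R, ‖periodicExt u x‖ₑ ≤ N * ‖u‖ₑ := by
  obtain ⟨N, hN⟩ := exists_map_wrap_le R
  refine ⟨N, fun u => ?_⟩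
  have hm : Measurable fun x => ‖u x‖ₑ := (Lp.stronglyMeasurable u).enorm
  have h1 : ∫⁻ x in Metric.ball (0 : E3) R, ‖periodicExt u x‖ₑ =
      ∫⁻ x, ‖u x‖ₑ ∂((volume.restrict (Metric.ball (0 : E3) R)).map wrap) :=
    (lintegral_map hm measurable_wrap).symm
  rw [h1]
  refine (lintegral_mono' hN le_rfl).trans ?_
  rw [lintegral_smul_measure, ENNReal.smul_def, smul_eq_mul]
  gcongr
  rw [← eLpNorm_one_eq_lintegral_enorm]
  refine (eLpNorm_le_eLpNorm_of_exponent_le (q := 2) (by norm_num)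
    (Lp.stronglyMeasurable u).aestronglyMeasurable).trans ?_
  rw [Lp.enorm_def]

lemma locallyIntegrable_periodicExt (u : L2V) : LocallyIntegrable (periodicExt u) := by
  intro x
  refine ⟨Metric.ball 0 (‖x‖ + 1), Metric.isOpen_ball.mem_nhds (by simp),
    (stronglyMeasurable_periodicExt u).aestronglyMeasurable, ?_⟩
  obtain ⟨N, hN⟩ := exists_lintegral_periodicExt_le (‖x‖ + 1)
  exact (hN u).trans_lt (ENNReal.mul_lt_top ENNReal.coe_lt_top enorm_lt_top)

lemma periodicExt_shift (u : L2V) (x : E3) (n : Fin 3 → ℤ) :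
    periodicExt u (shift x n) = periodicExt u x := by
  rw [periodicExt, periodicExt, wrap_shift]

lemma character_wrap (k : Fin 3 → ℤ) (x : E3) : character k (wrap x) = character k x := by
  rw [wrap_eq_shift, character_shift]

lemma periodicExt_wave (k : Fin 3 → ℤ) (a : C3) :
    periodicExt (wave k a) =ᵐ[volume] fun x => character k x • a := by
  filter_upwards [quasiMeasurePreserving_wrap.ae (wave_coe k a)] with x hx
  rw [periodicExt, hx, character_wrap]

lemma ae_sub_left {P : E3 → Prop} (h : ∀ᵐ y, P y) (x : E3) : ∀ᵐ t, P (x - t) :=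
  (Measure.measurePreserving_sub_left volume x).quasiMeasurePreserving.ae h

/-- Point values of a mollified field are bounded functionals on L², so identities for them need
only be checked on plane waves. -/
lemma exists_norm_mollify_le {θ : E3 → ℝ} (hθ : Continuous θ) (hc : HasCompactSupport θ) (B : ℝ) :
    ∃ C : ℝ, ∀ u x, ‖x‖ ≤ B → ‖mollify θ (periodicExt u) x‖ ≤ C * ‖u‖ := by
  obtain ⟨M, R, hM0, hM, hR⟩ := exists_bound_of_hasCompactSupport hθ hc
  obtain ⟨N, hN⟩ := exists_lintegral_periodicExt_le (B + R)
  refine ⟨M * N, fun u x hx => ?_⟩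
  have h1 : ‖mollify θ (periodicExt u) x‖ₑ ≤ ENNReal.ofReal M * (N * ‖u‖ₑ) := by
    calc ‖mollify θ (periodicExt u) x‖ₑ ≤ ∫⁻ t, ‖θ t • periodicExt u (x - t)‖ₑ :=
          enorm_integral_le_lintegral_enorm _
      _ ≤ ∫⁻ t, (fun y => ENNReal.ofReal M *
            (Metric.ball (0 : E3) (B + R)).indicator (fun y => ‖periodicExt u y‖ₑ) y) (x - t) := by
          refine lintegral_mono fun t => ?_
          by_cases ht : R ≤ ‖t‖
          · simp [hR t ht]
          · have hmem : x - t ∈ Metric.ball (0 : E3) (B + R) := by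
              rw [mem_ball_zero_iff]
              exact (norm_sub_le _ _).trans_lt (by linarith)
            simp only [Set.indicator_of_mem hmem]
            rw [← ofReal_norm (periodicExt u _), ← ofReal_norm,
              ← ENNReal.ofReal_mul' (norm_nonneg _)]
            refine ENNReal.ofReal_le_ofReal ?_
            rw [norm_smul]
            exact mul_le_mul_of_nonneg_right (hM t) (norm_nonneg _)
      _ = ENNReal.ofReal M * ∫⁻ y in Metric.ball (0 : E3) (B + R), ‖periodicExt u y‖ₑ := by
          rw [lintegral_sub_left_eq_self (fun y => ENNReal.ofReal M *
            (Metric.ball (0 : E3) (B + R)).indicator (fun y => ‖periodicExt u y‖ₑ) y),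
            lintegral_const_mul' _ _ ENNReal.ofReal_ne_top,
            lintegral_indicator Metric.isOpen_ball.measurableSet]
      _ ≤ ENNReal.ofReal M * (N * ‖u‖ₑ) := by gcongr; exact hN u
  have h2 := ENNReal.toReal_mono (by
    exact ENNReal.mul_ne_top ENNReal.ofReal_ne_top
      (ENNReal.mul_ne_top ENNReal.coe_ne_top enorm_ne_top)) h1
  rw [ENNReal.toReal_mul, ENNReal.toReal_mul, ENNReal.toReal_ofReal hM0, toReal_enorm,
    toReal_enorm] at h2
  simpa [mul_assoc] using h2

lemma mollify_periodicExt_add {θ : E3 → ℝ} (hθ : Continuous θ) (hc : HasCompactSupport θ)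
    (u v : L2V) (x : E3) : mollify θ (periodicExt (u + v)) x =
      mollify θ (periodicExt u) x + mollify θ (periodicExt v) x := by
  unfold mollify
  rw [← integral_add (integrable_mollify hθ hc (locallyIntegrable_periodicExt u) x)
    (integrable_mollify hθ hc (locallyIntegrable_periodicExt v) x)]
  refine integral_congr_ae ?_
  filter_upwards [ae_sub_left (quasiMeasurePreserving_wrap.ae (Lp.coeFn_add u v)) x] with t ht
  simp only [periodicExt, ht, Pi.add_apply, smul_add]

lemma mollify_periodicExt_smul (θ : E3 → ℝ) (c : ℂ) (u : L2V) (x : E3) :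
    mollify θ (periodicExt (c • u)) x = c • mollify θ (periodicExt u) x := by
  unfold mollify
  rw [← integral_smul]
  refine integral_congr_ae ?_
  filter_upwards [ae_sub_left (quasiMeasurePreserving_wrap.ae (Lp.coeFn_smul c u)) x] with t ht
  simp only [periodicExt, ht, Pi.smul_apply]
  rw [smul_comm]

/-- The value at `x` of the mollification of a periodic field, as a linear map. -/
lemma exists_mollifyL {θ : E3 → ℝ} (hθ : Continuous θ) (hc : HasCompactSupport θ) (x : E3) :
    ∃ T : L2V →L[ℂ] C3, ∀ u, T u = mollify θ (periodicExt u) x := by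
  obtain ⟨C, hC⟩ := exists_norm_mollify_le hθ hc ‖x‖
  exact ⟨LinearMap.mkContinuous
    { toFun := fun u => mollify θ (periodicExt u) x
      map_add' := fun u v => mollify_periodicExt_add hθ hc u v x
      map_smul' := fun c u => mollify_periodicExt_smul θ c u x } C fun u => hC u x le_rfl,
    fun u => rfl⟩

lemma mollify_wave (θ : E3 → ℝ) (k : Fin 3 → ℤ) (a : C3) (x : E3) :
    mollify θ (periodicExt (wave k a)) x = (∫ t, (θ t : ℂ) * character k (x - t)) • a := by
  rw [mollify, ← integral_smul_const]
  refine integral_congr_ae ?_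
  filter_upwards [ae_sub_left (periodicExt_wave k a) x] with t ht
  rw [ht, mul_smul, Complex.coe_smul]

lemma integral_fderiv_mul_character {θ : E3 → ℝ} (hθ : ContDiff ℝ ∞ θ)
    (hc : HasCompactSupport θ) (k : Fin 3 → ℤ) (x : E3) (j : Fin 3) :
    ∫ t, ((fderiv ℝ θ t (e j) : ℝ) : ℂ) * character k (x - t) =
      2 * Real.pi * Complex.I * k j * ∫ t, (θ t : ℂ) * character k (x - t) := by
  have hθd : Differentiable ℝ θ := hθ.differentiable (by simp)
  set f : E3 → ℂ := fun t => (θ t : ℂ) with hf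
  set g : E3 → ℂ := fun t => character k (x - t) with hg
  have hfd : Differentiable ℝ f := Complex.ofRealCLM.differentiable.comp hθd
  have hgd : Differentiable ℝ g :=
    ((contDiff_character k).differentiable (by simp)).comp (by fun_prop)
  have hgc : Continuous g := hgd.continuous
  have hf' : ∀ t, fderiv ℝ f t (e j) = ((fderiv ℝ θ t (e j) : ℝ) : ℂ) := fun t => by
    have h := Complex.ofRealCLM.hasFDerivAt.comp t (hθd t).hasFDerivAt
    exact congrArg (fun L : E3 →L[ℝ] ℂ => L (e j)) h.fderiv
  have hg' : ∀ t, fderiv ℝ g t (e j) = -(2 * Real.pi * Complex.I * k j * g t) := fun t => by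
    have h := ((contDiff_character k).differentiable (by simp) (x - t)).hasFDerivAt.comp t
      ((hasFDerivAt_id t).const_sub x)
    have h2 := congrArg (fun L : E3 →L[ℝ] ℂ => L (e j)) h.fderiv
    refine h2.trans ?_
    simp [fderiv_character, hg]
  have hfc : HasCompactSupport f := hc.comp_left (g := fun r : ℝ => (r : ℂ)) (by simp)
  have h1c : HasCompactSupport fun t => fderiv ℝ θ t (e j) :=
    hc.fderiv_apply ℝ (e j)
  have hθ'c : Continuous fun t => fderiv ℝ θ t (e j) :=
    (hθ.continuous_fderiv (by simp)).clm_apply continuous_const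
  have h := integral_mul_fderiv_eq_neg_fderiv_mul_of_integrable (μ := (volume : Measure E3))
    (f := f) (g := g) (v := e j) ?_ ?_ ?_ (fun t _ => hfd t) (fun t _ => hgd t)
  · simp only [hf', hg'] at h
    rw [← integral_const_mul, ← neg_eq_iff_eq_neg.2 h, ← integral_neg]
    refine integral_congr_ae (Eventually.of_forall fun t => ?_)
    simp only [hf, hg]
    ring
  · simp only [hf']
    refine ((Complex.continuous_ofReal.comp hθ'c).mul hgc).integrable_of_hasCompactSupport ?_
    exact (h1c.comp_left (g := fun r : ℝ => (r : ℂ)) (by simp)).mul_right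
  · simp only [hg']
    exact (hfd.continuous.mul (continuous_const.mul hgc).neg).integrable_of_hasCompactSupport
      hfc.mul_right
  · exact (hfd.continuous.mul hgc).integrable_of_hasCompactSupport hfc.mul_right

/-- Mollification turns weak derivatives into derivatives of the kernel. -/
lemma mollify_fderiv {θ : E3 → ℝ} (hθ : ContDiff ℝ ∞ θ) (hc : HasCompactSupport θ)
    {p : Jet} (hp : p ∈ W12) (j : Fin 3) (x : E3) :
    mollify (fun t => fderiv ℝ θ t (e j)) (periodicExt p.1) x =
      mollify θ (periodicExt (p.2 j)) x := by
  obtain ⟨T, hT⟩ := exists_mollifyL hθ.continuous hc x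
  obtain ⟨T', hT'⟩ := exists_mollifyL
    ((hθ.continuous_fderiv (by simp)).clm_apply continuous_const) (hc.fderiv_apply ℝ (e j)) x
  rw [← hT, ← hT']
  refine ((hasSum_wave p.1).mapL T').unique (((hasSum_wave (p.2 j)).mapL T).congr_fun fun k => ?_)
  rw [hT, hT', mollify_wave, mollify_wave, integral_fderiv_mul_character hθ hc,
    mem_W12_iff.1 hp, smul_smul]
  congr 1
  ring

/-! ### The host phase -/

lemma wrap_eq_self {x : E3} (hx : x ∈ cell) : wrap x = x := by
  ext i
  have h : ⌈x i⌉ = 1 := Int.ceil_eq_iff.2 ⟨by simpa using (hx i).1, by simpa using (hx i).2⟩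
  simp [wrap, h]

lemma mem_host_iff {D : Set E3} (hD : closure D ⊆ cell) {x : E3} :
    x ∈ host D ↔ wrap x ∉ closure D := by
  constructor
  · intro h
    rw [wrap_eq_shift]
    exact h _
  · intro h n hn
    rw [← wrap_shift x n, wrap_eq_self (hD hn)] at h
    exact h hn

lemma IsInclusion.closure_subset_cell {γ : ℝ≥0} {D : Set E3} (hD : IsInclusion γ D) :
    closure D ⊆ cell := fun _ hx i =>
  ⟨(hD.closure_subset hx i).1, (hD.closure_subset hx i).2.le⟩

/-- The lattice translates of the bounded closed set `closure D` form a locally finite family, so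
their union is closed. -/
lemma isOpen_host {D : Set E3} (hD : closure D ⊆ cell) : IsOpen (host D) := by
  have h : (host D)ᶜ = ⋃ n : Fin 3 → ℤ, (fun x => shift x n) ⁻¹' closure D := by
    ext x; simp [host]
  rw [← isClosed_compl_iff, h]
  refine LocallyFinite.isClosed_iUnion (fun x => ⟨Metric.ball x 1, Metric.ball_mem_nhds _ one_pos,
    (Set.finite_Icc (fun i => -⌈x i⌉ - 2 : Fin 3 → ℤ) (fun i => -⌊x i⌋ + 2)).subset ?_⟩)
    fun n => ?_
  · rintro n ⟨y, hy, hyx⟩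
    have h1 : ∀ i, |y i - x i| < 1 := fun i =>
      (PiLp.norm_apply_le (y - x) i).trans_lt (mem_ball_iff_norm.1 hyx)
    have h2 := fun i => hD hy i
    simp only [shift] at h2
    refine ⟨fun i => ?_, fun i => ?_⟩
    · have h3 : ((-⌈x i⌉ - 2 : ℤ) : ℝ) < n i := by
        push_cast
        linarith [(abs_lt.1 (h1 i)).2, (h2 i).1, Int.le_ceil (x i)]
      exact_mod_cast h3.le
    · have h3 : (n i : ℝ) < ((-⌊x i⌋ + 2 : ℤ) : ℝ) := by
        push_cast
        linarith [(abs_lt.1 (h1 i)).1, (h2 i).2, Int.floor_le (x i)]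
      exact_mod_cast h3.le
  · refine isClosed_closure.preimage ?_
    rw [show (fun x => shift x n) = fun x => x + shift 0 n from funext fun x => shift_eq_add x n]
    fun_prop

lemma add_e_mem_host {D : Set E3} {x : E3} (hx : x ∈ host D) (i : Fin 3) : x + e i ∈ host D := by
  intro n
  rw [← shift_single, shift_shift]
  exact hx _

/-- On a translate of a coordinate axis by a lattice vector the other two coordinates are integers,
while `closure D` lies in the open cell. The axes thus serve as reference curves in the host. -/
lemma smul_e_mem_host {γ : ℝ≥0} {D : Set E3} (hD : IsInclusion γ D) (t : ℝ) (i : Fin 3) :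
    t • e i ∈ host D := by
  intro n hn
  have h : ∀ j : Fin 3, j ≠ i → False := fun j hj => by
    have h1 := hD.closure_subset hn j
    simp only [shift, e, PiLp.smul_apply, PiLp.single_apply, if_neg hj, smul_zero,
      zero_add] at h1
    have h2 : (0 : ℤ) < n j := by exact_mod_cast h1.1
    have h3 : n j < (1 : ℤ) := by exact_mod_cast h1.2
    omega
  exact h (i + 1) (by fin_cases i <;> decide)

lemma contDiff_smul_e (i : Fin 3) : ContDiff ℝ 1 fun t : ℝ => t • e i :=
  contDiff_id.smul contDiff_const

/-! ### Mollified fields of `F D` are curl free in the host -/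

lemma eq_sum_smul_e (x : E3) : x = ∑ j, x j • e j := by
  ext i
  simp [e, Pi.single_apply]

/-- A kernel supported in radius `r` only sees the field in the host, where vanishing curl makes the
weak gradient matrix symmetric almost everywhere. -/
lemma mollify_weakGradient_symm {D : Set E3} (hD : closure D ⊆ cell) {p : Jet}
    (hcurl : ∀ᵐ x ∂cellMeasure, x ∉ D → curl p x = 0) {θ : E3 → ℝ} (hθ : Continuous θ)
    (hc : HasCompactSupport θ) {r : ℝ} (hr : ∀ t, r ≤ ‖t‖ → θ t = 0) {x : E3}
    (hx : Metric.ball x r ⊆ host D) (l j : Fin 3) :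
    mollify θ (periodicExt (p.2 l)) x j = mollify θ (periodicExt (p.2 j)) x l := by
  have hcomp : ∀ (w : E3 → C3) (_ : LocallyIntegrable w) (i : Fin 3), mollify θ w x i =
      ∫ t, θ t • w (x - t) i := fun w hw i =>
    ((EuclideanSpace.proj (𝕜 := ℂ) i).integral_comp_comm (integrable_mollify hθ hc hw x)).symm
  rw [hcomp _ (locallyIntegrable_periodicExt _), hcomp _ (locallyIntegrable_periodicExt _)]
  refine integral_congr_ae ?_
  filter_upwards [ae_sub_left (quasiMeasurePreserving_wrap.ae hcurl) x] with t ht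
  by_cases htr : r ≤ ‖t‖
  · simp [hr t htr]
  have hmem : x - t ∈ host D := hx (by
    rw [mem_ball_iff_norm, sub_sub_cancel_left, norm_neg]; exact not_le.1 htr)
  have h0 := ht fun h => (mem_host_iff hD).1 hmem (subset_closure h)
  have h1 : p.2 1 (wrap (x - t)) 2 = p.2 2 (wrap (x - t)) 1 := by
    have := congrArg (fun v : C3 => v 0) h0
    simpa [curl, sub_eq_zero] using this
  have h2 : p.2 2 (wrap (x - t)) 0 = p.2 0 (wrap (x - t)) 2 := by
    have := congrArg (fun v : C3 => v 1) h0
    simpa [curl, sub_eq_zero] using this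
  have h3 : p.2 0 (wrap (x - t)) 1 = p.2 1 (wrap (x - t)) 0 := by
    have := congrArg (fun v : C3 => v 2) h0
    simpa [curl, sub_eq_zero] using this
  congr 1
  simp only [periodicExt]
  fin_cases l <;> fin_cases j <;> simp [h1, h2, h3]

lemma closed_mollify {D : Set E3} (hD : closure D ⊆ cell) {p : Jet} (hp : p ∈ W12)
    (hcurl : ∀ᵐ x ∂cellMeasure, x ∉ D → curl p x = 0) {θ : E3 → ℝ} (hθ : ContDiff ℝ ∞ θ)
    (hc : HasCompactSupport θ) {r : ℝ} (hr : ∀ t, r ≤ ‖t‖ → θ t = 0) {x : E3}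
    (hx : Metric.ball x r ⊆ host D) (a b : E3) :
    pairing (fderiv ℝ (mollify θ (periodicExt p.1)) x a) b =
      pairing (fderiv ℝ (mollify θ (periodicExt p.1)) x b) a := by
  have h1 : ∀ j, fderiv ℝ (mollify θ (periodicExt p.1)) x (e j) =
      mollify θ (periodicExt (p.2 j)) x := fun j => by
    rw [fderiv_mollify hθ hc (locallyIntegrable_periodicExt _), mollify_fderiv hθ hc hp]
  have h2 : ∀ v : E3, fderiv ℝ (mollify θ (periodicExt p.1)) x v =
      ∑ l, v l • mollify θ (periodicExt (p.2 l)) x := fun v => by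
    conv_lhs => rw [eq_sum_smul_e v]
    rw [map_sum]
    exact Finset.sum_congr rfl fun l _ => by rw [map_smul, h1]
  have h3 := mollify_weakGradient_symm hD hcurl hθ.continuous hc hr hx
  rw [h2, h2, pairing_apply, pairing_apply]
  simp only [Fin.sum_univ_three, PiLp.add_apply, PiLp.smul_apply, Complex.real_smul]
  rw [h3 1 0, h3 2 0, h3 2 1]
  ring

/-! ### Line integrals of mollified fields -/

lemma mollify_periodicExt_add_e (θ : E3 → ℝ) (u : L2V) (x : E3) (i : Fin 3) :
    mollify θ (periodicExt u) (x + e i) = mollify θ (periodicExt u) x := by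
  unfold mollify
  refine integral_congr_ae (Eventually.of_forall fun t => ?_)
  simp only
  rw [add_sub_right_comm, ← shift_single, periodicExt_shift]

lemma contDiff_pairing_mollify {θ : E3 → ℝ} (hθ : ContDiff ℝ ∞ θ) (hc : HasCompactSupport θ)
    (u : L2V) : ContDiff ℝ 1 fun x => pairing (mollify θ (periodicExt u) x) :=
  pairing.contDiff.comp
    ((contDiff_mollify hθ hc (locallyIntegrable_periodicExt u)).of_le (by simp))

lemma fderiv_pairing_mollify {θ : E3 → ℝ} (hθ : ContDiff ℝ ∞ θ) (hc : HasCompactSupport θ)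
    (u : L2V) (x a b : E3) : fderiv ℝ (fun x => pairing (mollify θ (periodicExt u) x)) x a b =
      pairing (fderiv ℝ (mollify θ (periodicExt u)) x a) b := by
  have h := pairing.hasFDerivAt.comp x ((contDiff_mollify hθ hc
    (locallyIntegrable_periodicExt u)).differentiable (by simp) x).hasFDerivAt
  exact congrArg (fun L : E3 →L[ℝ] E3 →L[ℝ] ℂ => L a b) h.fderiv

/-- The curl free fields in the host, as a condition on jets. -/
def IsCurlFreeOff (D : Set E3) (p : Jet) : Prop :=
  p ∈ W12 ∧ ∀ᵐ x ∂cellMeasure, x ∉ D → curl p x = 0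

lemma exists_radius_circulation_shift {γ : ℝ≥0} {D : Set E3} (hD : IsInclusion γ D) (i : Fin 3) :
    ∃ r > 0, ∀ p, IsCurlFreeOff D p → ∀ θ : E3 → ℝ, ContDiff ℝ ∞ θ → HasCompactSupport θ →
      (∀ t, r ≤ ‖t‖ → θ t = 0) → ∀ z, ‖z‖ < r →
      circulation (fun t => t • e i) (fun x => mollify θ (periodicExt p.1) (x - z)) =
        circulation (fun t => t • e i) (mollify θ (periodicExt p.1)) := by
  obtain ⟨r, hr, h⟩ := exists_radius_integral_shift_eq (isOpen_host hD.closure_subset_cell)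
    (e := e i) (contDiff_smul_e i) (fun t _ => smul_e_mem_host hD t i) (by simp)
  refine ⟨r, hr, fun p hp θ hθ hc hθr z hz => ?_⟩
  have := h _ (contDiff_pairing_mollify hθ hc p.1)
    (fun x => by rw [mollify_periodicExt_add_e]) (fun x hx a b => by
      rw [fderiv_pairing_mollify hθ hc, fderiv_pairing_mollify hθ hc]
      exact closed_mollify hD.closure_subset_cell hp.1 hp.2 hθ hc hθr hx a b) (-z) (by simpa)
  simpa only [circulation, sub_eq_add_neg] using this

/-- Simple connectivity of the host enters here: a host curve can be replaced by the coordinate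
axis, for all fields and all sufficiently concentrated kernels at once. -/
lemma exists_radius_circulation_eq {γ : ℝ≥0} {D : Set E3} (hD : IsInclusion γ D) (i : Fin 3)
    {Γ : ℝ → E3} (hΓ : ContDiff ℝ 1 Γ) (hΓe : Γ 1 = Γ 0 + e i)
    (hΓU : ∀ t ∈ Set.Icc (0 : ℝ) 1, Γ t ∈ host D) :
    ∃ r > 0, ∀ p, IsCurlFreeOff D p → ∀ θ : E3 → ℝ, ContDiff ℝ ∞ θ → HasCompactSupport θ →
      (∀ t, r ≤ ‖t‖ → θ t = 0) → circulation Γ (mollify θ (periodicExt p.1)) =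
        circulation (fun t => t • e i) (mollify θ (periodicExt p.1)) := by
  obtain ⟨r, hr, h⟩ := exists_radius_integral_eq (isOpen_host hD.closure_subset_cell)
    hD.host_simplyConnected (e := e i) (fun x hx => add_e_mem_host hx i) hΓ (contDiff_smul_e i) hΓU
    (fun t _ => smul_e_mem_host hD t i) hΓe (by simp)
  refine ⟨r, hr, fun p hp θ hθ hc hθr => ?_⟩
  exact h _ (contDiff_pairing_mollify hθ hc p.1)
    (fun x => by rw [mollify_periodicExt_add_e]) (fun x hx a b => by
      rw [fderiv_pairing_mollify hθ hc, fderiv_pairing_mollify hθ hc]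
      exact closed_mollify hD.closure_subset_cell hp.1 hp.2 hθ hc hθr hx a b)

/-- The circulation of a mollified field does not depend on the normalized kernel. -/
lemma circulation_mollify_eq {γ : ℝ≥0} {D : Set E3} (hD : IsInclusion γ D) :
    ∃ r > 0, ∀ p, IsCurlFreeOff D p → ∀ ρ θ : E3 → ℝ, ContDiff ℝ ∞ ρ → HasCompactSupport ρ →
      (∀ t, r ≤ ‖t‖ → ρ t = 0) → ∫ t, ρ t = 1 → ContDiff ℝ ∞ θ → HasCompactSupport θ →
      (∀ t, r ≤ ‖t‖ → θ t = 0) → ∀ i,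
      circulation (fun t => t • e i) (mollify θ (periodicExt p.1)) =
        (∫ t, θ t) • circulation (fun t => t • e i) (mollify ρ (periodicExt p.1)) := by
  choose r hr h using exists_radius_circulation_shift hD
  obtain ⟨r₀, hr₀, hle⟩ : ∃ r₀ > 0, ∀ i, r₀ ≤ r i :=
    ⟨min (r 0) (min (r 1) (r 2)), lt_min (hr 0) (lt_min (hr 1) (hr 2)), fun i => by
      fin_cases i <;> simp⟩
  refine ⟨r₀, hr₀, fun p hp ρ θ hρ hρc hρr hρ1 hθ hθc hθr i => ?_⟩
  -- Small shifts do not change the circulation, so a second mollification only multiplies it by the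
  -- integral of the kernel. Commuting the two mollifications compares the kernels.
  have key : ∀ ρ θ : E3 → ℝ, ContDiff ℝ ∞ ρ → HasCompactSupport ρ →
      (∀ t, r₀ ≤ ‖t‖ → ρ t = 0) → ContDiff ℝ ∞ θ → HasCompactSupport θ →
      (∀ t, r₀ ≤ ‖t‖ → θ t = 0) →
      circulation (fun t => t • e i) (mollify ρ (mollify θ (periodicExt p.1))) =
        (∫ t, ρ t) • circulation (fun t => t • e i) (mollify θ (periodicExt p.1)) := by
    intro ρ θ hρ hρc hρr hθ hθc hθr
    have hw := contDiff_mollify hθ hθc (locallyIntegrable_periodicExt p.1)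
    rw [← integral_smul_circulation (contDiff_smul_e i) hw.continuous.stronglyMeasurable
      hw.continuous.locallyIntegrable hρ.continuous hρc, ← integral_smul_const]
    refine integral_congr_ae (Eventually.of_forall fun t => ?_)
    simp only
    by_cases ht : r₀ ≤ ‖t‖
    · rw [hρr t ht, zero_smul, zero_smul]
    · rw [h i p hp θ hθ hθc (fun t ht => hθr t ((hle i).trans ht)) t
        ((not_le.1 ht).trans_le (hle i))]
  have h1 := key ρ θ hρ hρc hρr hθ hθc hθr
  rw [hρ1, one_smul] at h1
  rw [← h1, ← key θ ρ hθ hθc hθr hρ hρc hρr]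
  congr 1
  ext1 x
  exact mollify_comm hρ.continuous hρc hθ.continuous hθc (stronglyMeasurable_periodicExt _)
    (locallyIntegrable_periodicExt _) x

/-! ### The geometric average -/

lemma lineIntegral_add (u : L2V) (Γ : ℝ → E3) (y : E3) :
    lineIntegral u (fun t => Γ t + y) = circulation Γ fun x => periodicExt u (x + y) := by
  unfold lineIntegral circulation
  refine intervalIntegral.integral_congr fun t _ => ?_
  simp only [pairing_apply, deriv_add_const]

lemma pairing_e (v : C3) (i : Fin 3) : pairing v (e i) = v i := by
  rw [pairing_apply, Finset.sum_eq_single i]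
  · simp [e]
  · intro j _ hj
    simp [e, hj]
  · simp

lemma exists_kernel {r : ℝ} (hr : 0 < r) : ∃ ρ : E3 → ℝ, ContDiff ℝ ∞ ρ ∧ HasCompactSupport ρ ∧
    (∀ t, r ≤ ‖t‖ → ρ t = 0) ∧ ∫ t, ρ t = 1 := by
  set φ : ContDiffBump (0 : E3) := ⟨r / 2, r, by positivity, by linarith⟩
  refine ⟨φ.normed volume, φ.contDiff_normed, φ.hasCompactSupport_normed, fun t ht => ?_,
    φ.integral_normed⟩
  refine Function.notMem_support.1 fun h => ?_
  rw [φ.support_normed_eq] at h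
  exact absurd (mem_ball_zero_iff.1 h) (not_lt.2 ht)

lemma exists_circulationL {ρ : E3 → ℝ} (hρ : ContDiff ℝ ∞ ρ) (hc : HasCompactSupport ρ) :
    ∃ T : L2V →L[ℂ] C3, ∀ u i,
      T u i = circulation (fun t => t • e i) (mollify ρ (periodicExt u)) := by
  obtain ⟨C, hC⟩ := exists_norm_mollify_le hρ.continuous hc 1
  have hcirc : ∀ (u : L2V) (i : Fin 3),
      circulation (fun t => t • e i) (mollify ρ (periodicExt u)) =
        ∫ t in (0 : ℝ)..1, mollify ρ (periodicExt u) (t • e i) i := fun u i => by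
    unfold circulation
    refine intervalIntegral.integral_congr fun t _ => ?_
    have hd : deriv (fun t : ℝ => t • e i) t = e i := by
      simpa using ((hasDerivAt_id t).smul_const (e i)).deriv
    simp only [hd, pairing_e]
  have hint : ∀ (u : L2V) (i : Fin 3),
      IntervalIntegrable (fun t : ℝ => mollify ρ (periodicExt u) (t • e i) i) volume 0 1 :=
    fun u i => by
    have h1 : Continuous (mollify ρ (periodicExt u)) :=
      (contDiff_mollify hρ hc (locallyIntegrable_periodicExt u)).continuous
    have h2 : Continuous fun t : ℝ => mollify ρ (periodicExt u) (t • e i) i :=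
      (EuclideanSpace.proj (𝕜 := ℂ) i).continuous.comp
        (h1.comp (continuous_id.smul continuous_const))
    exact h2.intervalIntegrable 0 1
  refine ⟨LinearMap.mkContinuous
    { toFun := fun u => WithLp.toLp 2 fun i =>
        circulation (fun t => t • e i) (mollify ρ (periodicExt u))
      map_add' := fun u v => ?_
      map_smul' := fun c u => ?_ } (3 * C) fun u => ?_, fun u i => rfl⟩
  · ext i
    simp only [PiLp.add_apply, hcirc]
    rw [← intervalIntegral.integral_add (hint u i) (hint v i)]
    simp only [mollify_periodicExt_add hρ.continuous hc, PiLp.add_apply]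
  · ext i
    simp only [PiLp.smul_apply, hcirc, smul_eq_mul, RingHom.id_apply]
    rw [← intervalIntegral.integral_const_mul]
    simp only [mollify_periodicExt_smul, PiLp.smul_apply, smul_eq_mul]
  · refine (norm_C3_le_sum _).trans ?_
    have h1 : ∀ i : Fin 3, ‖circulation (fun t => t • e i) (mollify ρ (periodicExt u))‖ ≤
        C * ‖u‖ := fun i => by
      rw [hcirc]
      have := intervalIntegral.norm_integral_le_of_norm_le_const (a := 0) (b := 1) (C := C * ‖u‖)
        (f := fun t : ℝ => mollify ρ (periodicExt u) (t • e i) i) fun t ht => by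
          refine (PiLp.norm_apply_le _ _).trans (hC u _ ?_)
          rw [Set.uIoc_of_le zero_le_one] at ht
          rw [norm_smul, e, PiLp.norm_single, norm_one, mul_one, Real.norm_eq_abs,
            abs_of_pos ht.1]
          exact ht.2
      simpa using this
    calc ∑ i : Fin 3, ‖circulation (fun t => t • e i) (mollify ρ (periodicExt u))‖
        ≤ ∑ _i : Fin 3, C * ‖u‖ := Finset.sum_le_sum fun i _ => h1 i
      _ = 3 * C * ‖u‖ := by simp; ring

lemma isOpen_setOf_forall_mem {U : Set E3} (hU : IsOpen U) {Γ : ℝ → E3} (hΓ : Continuous Γ) :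
    IsOpen {y | ∀ t ∈ Set.Icc (0 : ℝ) 1, Γ t + y ∈ U} := by
  rw [isOpen_iff_mem_nhds]
  intro y hy
  obtain ⟨r, hr, h⟩ := exists_ball_subset_of_isCompact
    (isCompact_Icc.image (hΓ.add continuous_const : Continuous fun t => Γ t + y)) hU
    (Set.image_subset_iff.2 hy)
  filter_upwards [Metric.ball_mem_nhds y hr] with z hz t ht
  refine h _ ⟨t, ht, rfl⟩ ?_
  change dist (Γ t + z) (Γ t + y) < r
  rwa [dist_add_left]

/-- The fields that are curl free in the host have a geometric average, and it extends to a
bounded linear map. -/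
theorem exists_geometricAverage {γ : ℝ≥0} {D : Set E3} (hD : IsInclusion γ D) :
    ∃ T : L2V →L[ℂ] C3, (∀ a, T (wave 0 a) = a) ∧
      ∀ p, IsCurlFreeOff D p → HasGeometricAverage D p.1 (T p.1) := by
  obtain ⟨r₀, hr₀, h₀⟩ := circulation_mollify_eq hD
  obtain ⟨ρ, hρ, hρc, hρr, hρ1⟩ := exists_kernel hr₀
  obtain ⟨T, hT⟩ := exists_circulationL hρ hρc
  refine ⟨T, fun a => ?_, fun p hp i Γ hΓ hΓe => ?_⟩
  · ext i
    rw [hT, circulation]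
    have h1 : ∀ x, mollify ρ (periodicExt (wave 0 a)) x = a := fun x => by
      rw [mollify_wave]
      have : ∀ y, character 0 y = 1 := fun y => by simp [character]
      simp only [this, mul_one]
      rw [integral_complex_ofReal, hρ1, Complex.ofReal_one, one_smul]
    have hd : ∀ t, deriv (fun t : ℝ => t • e i) t = e i := fun t => by
      simpa using ((hasDerivAt_id t).smul_const (e i)).deriv
    simp only [h1, hd, pairing_e, intervalIntegral.integral_const]
    simp
  set w := periodicExt p.1 with hw
  have hws : StronglyMeasurable w := stronglyMeasurable_periodicExt _
  have hwi : LocallyIntegrable w := locallyIntegrable_periodicExt _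
  set O : Set E3 := {y | ∀ t ∈ Set.Icc (0 : ℝ) 1, Γ t + y ∈ host D} with hO
  set f : E3 → ℂ := fun y => circulation Γ fun x => w (x + y) with hf
  suffices h : volume {y | ¬ (y ∈ O → f y = T p.1 i)} = 0 by
    filter_upwards [mem_ae_iff.2 h] with y hy hyO
    rw [lineIntegral_add]
    simpa using hy hyO
  -- The admissible radius depends on the position of the curve, so the exceptional set is shown to
  -- be null near each of its points.
  refine measure_null_of_locally_null _ fun y hy => ?_
  have hyO : y ∈ O := by
    by_contra h
    exact hy fun h' => absurd h' h
  have hΓy : ContDiff ℝ 1 fun t => Γ t + y := hΓ.add contDiff_const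
  obtain ⟨r₁, hr₁, h₁⟩ := exists_radius_circulation_eq hD i hΓy
    (by simp only [hΓe]; abel) hyO
  set r := min r₀ r₁ with hr
  have hr0 : 0 < r := lt_min hr₀ hr₁
  have hcirc : ∀ v : E3 → C3, circulation (fun t => Γ t + y) v =
      circulation Γ fun x => v (x + y) := fun v => by
    unfold circulation
    refine intervalIntegral.integral_congr fun t _ => ?_
    simp only [deriv_add_const]
  have hint : IntegrableOn f (Metric.ball y r) := by
    have h := (integrable_prod_circulation hΓy hws hwi
      (θ := (Metric.ball (0 : E3) r).indicator fun _ => 1)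
      (measurable_const.indicator Metric.isOpen_ball.measurableSet) (M := 1) (R := r)
      (fun t => (norm_indicator_le_norm_self _ _).trans (by simp)) (fun t ht => by
        simpa using ht)).integral_prod_right
    have h2 : Integrable fun t => (Metric.ball (0 : E3) r).indicator (fun t => f (y - t)) t := by
      refine h.congr (Eventually.of_forall fun t => ?_)
      simp only [hf]
      by_cases ht : t ∈ Metric.ball (0 : E3) r
      · simp only [Set.indicator_of_mem ht, one_smul]
        unfold circulation
        rw [intervalIntegral.integral_of_le zero_le_one]
        simp only [deriv_add_const, add_sub_assoc]
      · simp [Set.indicator_of_notMem ht]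
    have h3 := h2.comp_sub_left y
    rw [← integrable_indicator_iff Metric.isOpen_ball.measurableSet]
    refine h3.congr (Eventually.of_forall fun t => ?_)
    simp only [Set.indicator]
    rw [sub_sub_cancel]
    congr 1
    rw [mem_ball_zero_iff, mem_ball_iff_norm']
  have hzero : ∀ᵐ z, z ∈ Metric.ball y r → f z - T p.1 i = 0 := by
    -- The fundamental lemma of the calculus of variations: a test function near `y`, reflected at
    -- `y`, serves as the mollification kernel `θ`.
    refine Metric.isOpen_ball.ae_eq_zero_of_integral_contDiff_smul_eq_zero ?_ fun φ hφ hφc hφs => ?_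
    · exact (hint.sub (integrableOn_const measure_ball_lt_top.ne)).locallyIntegrableOn
    set θ : E3 → ℝ := fun t => φ (y - t) with hθ
    have hθd : ContDiff ℝ ∞ θ := hφ.comp (contDiff_const.sub contDiff_id)
    have hθc : HasCompactSupport θ := hφc.comp_homeomorph (Homeomorph.subLeft y)
    have hφ0 : ∀ z, z ∉ Metric.ball y r → φ z = 0 := fun z hz =>
      image_eq_zero_of_notMem_tsupport fun h => hz (hφs h)
    have hθr : ∀ t, r ≤ ‖t‖ → θ t = 0 := fun t ht => hφ0 _ (by
      rw [mem_ball_iff_norm, sub_sub_cancel_left, norm_neg]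
      exact not_lt.2 ht)
    have e1 : ∫ z, φ z • f z = ∫ t, θ t • circulation (fun t => Γ t + y) fun x => w (x - t) := by
      rw [← integral_sub_left_eq_self (fun z => φ z • f z) volume y]
      refine integral_congr_ae (Eventually.of_forall fun t => ?_)
      simp only [hcirc, hf, hθ, add_sub_assoc]
    have e2 : ∫ z, φ z = ∫ t, θ t := (integral_sub_left_eq_self φ volume y).symm
    have hφf : Integrable fun z => φ z • f z := by
      rw [← integrableOn_iff_integrable_of_support_subset (s := Metric.ball y r)]
      · obtain ⟨C, hC⟩ := hφc.exists_bound_of_continuous hφ.continuous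
        exact hint.bdd_smul C hφ.continuous.aestronglyMeasurable (Eventually.of_forall hC)
      · intro z hz
        by_contra h
        exact hz (by simp [hφ0 z h])
    simp only [smul_sub]
    rw [integral_sub hφf ((hφ.continuous.integrable_of_hasCompactSupport hφc).smul_const _),
      integral_smul_const, e1, integral_smul_circulation hΓy hws hwi hθd.continuous hθc,
      h₁ p hp θ hθd hθc (fun t ht => hθr t ((min_le_right _ _).trans ht)),
      h₀ p hp ρ θ hρ hρc hρr hρ1 hθd hθc (fun t ht => hθr t ((min_le_left _ _).trans ht)),
      e2, hT, sub_self]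
  refine ⟨Metric.ball y r ∩ {y | ¬ (y ∈ O → f y = T p.1 i)}, ?_, ?_⟩
  · exact inter_mem (mem_nhdsWithin_of_mem_nhds (Metric.ball_mem_nhds y hr0)) self_mem_nhdsWithin
  · refine measure_mono_null (fun z hz => ?_) (mem_ae_iff.1 hzero)
    intro h
    exact hz.2 fun _ => sub_eq_zero.1 (h hz.1)

/-- The shifts keeping the coordinate segment in the host form a nonempty open set, which meets the
dense set of shifts where both values are attained. -/
lemma HasGeometricAverage.unique {γ : ℝ≥0} {D : Set E3} (hD : IsInclusion γ D) {u : L2V}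
    {c c' : C3} (h : HasGeometricAverage D u c) (h' : HasGeometricAverage D u c') : c = c' := by
  ext i
  have hO : IsOpen {y | ∀ t ∈ Set.Icc (0 : ℝ) 1, t • e i + y ∈ host D} :=
    isOpen_setOf_forall_mem (isOpen_host hD.closure_subset_cell) (contDiff_smul_e i).continuous
  have h0 : {y | ∀ t ∈ Set.Icc (0 : ℝ) 1, t • e i + y ∈ host D}.Nonempty :=
    ⟨0, fun t _ => by rw [add_zero]; exact smul_e_mem_host hD t i⟩
  have hae := (h i _ (contDiff_smul_e i) (by simp)).and (h' i _ (contDiff_smul_e i) (by simp))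
  obtain ⟨y, hy, h1, h2⟩ := (Measure.dense_of_ae hae).inter_open_nonempty _ hO h0
  exact (h1 hy).symm.trans (h2 hy)

/-! ### The space of curls is infinite dimensional -/

/-- The witness is the curl of a bump function times the third unit vector; its second component is
minus the first partial derivative of the bump. -/
lemma exists_mem_curlSpace_ne_zero {U : Set E3} (hU : IsOpen U) (hne : U.Nonempty)
    (hUc : U ⊆ cell) : ∃ w ∈ curlSpace U, w ≠ 0 := by
  obtain ⟨x₀, hx₀⟩ := hne
  obtain ⟨r, hr, hrU⟩ := Metric.isOpen_iff.1 hU x₀ hx₀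
  set φ : ContDiffBump x₀ := ⟨r / 4, r / 2, by positivity, by linarith⟩
  have hφU : tsupport φ ⊆ U := by
    rw [φ.tsupport_eq]
    exact (Metric.closedBall_subset_ball (by simp only [φ]; linarith)).trans hrU
  set f : E3 → ℂ := fun x => (φ x : ℂ) with hf
  have hfs : ContDiff ℝ ∞ f := Complex.ofRealCLM.contDiff.comp φ.contDiff
  have hfd : Differentiable ℝ f := hfs.differentiable (by simp)
  have hfc : HasCompactSupport f :=
    φ.hasCompactSupport.comp_left (g := fun r : ℝ => (r : ℂ)) (by simp)
  have hfU : tsupport f ⊆ U := (closure_mono fun x hx => by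
    rw [Function.mem_support] at hx ⊢
    exact fun h => hx (by simp [hf, h])).trans hφU
  have hf0 : ∀ x, x ∉ U → f x = 0 := fun x hx =>
    image_eq_zero_of_notMem_tsupport fun h => hx (hfU h)
  have hf'0 : ∀ x, x ∉ U → fderiv ℝ f x = 0 := fun x hx =>
    fderiv_of_notMem_tsupport ℝ fun h => hx (hfU h)
  have hf'c : ∀ j, Continuous fun x => fderiv ℝ f x (e j) := fun j =>
    (hfs.continuous_fderiv (by simp)).clm_apply continuous_const
  have hm : ∀ {h : E3 → ℂ}, Continuous h →
      MemLp (fun x => h x • (EuclideanSpace.single 2 1 : C3)) 2 cellMeasure := fun {h} hh =>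
    memLp_of_continuous (hh.smul continuous_const) 2
  set p : Jet := ((hm hfs.continuous).toLp _, fun j => (hm (hf'c j)).toLp _) with hp
  have hp1 : ∀ᵐ x ∂cellMeasure, p.1 x = f x • (EuclideanSpace.single 2 1 : C3) :=
    (hm hfs.continuous).coeFn_toLp
  have hp2 : ∀ᵐ x ∂cellMeasure, ∀ j,
      p.2 j x = fderiv ℝ f x (e j) • (EuclideanSpace.single 2 1 : C3) :=
    ae_all_iff.2 fun j => (hm (hf'c j)).coeFn_toLp
  have hfull : ∀ h : E3 → ℂ, (∀ x, x ∉ U → h x = 0) → ∫ x, h x ∂cellMeasure = ∫ x, h x :=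
    fun h hh => setIntegral_eq_integral_of_forall_compl_eq_zero fun x hx =>
      hh x fun hxU => hx (hUc hxU)
  have hpW : p ∈ W12 := by
    intro ψ hψ i j
    have hψd : Differentiable ℝ ψ := hψ.1.differentiable (by simp)
    have hψc : Continuous fun x => fderiv ℝ ψ x (e j) :=
      (hψ.1.continuous_fderiv (by simp)).clm_apply continuous_const
    set a : ℂ := (EuclideanSpace.single 2 1 : C3) i
    have e1 : ∫ x, p.1 x i * fderiv ℝ ψ x (e j) ∂cellMeasure =
        a * ∫ x, f x * fderiv ℝ ψ x (e j) := by
      rw [← hfull _ fun x hx => by rw [hf0 x hx, zero_mul], ← integral_const_mul]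
      refine integral_congr_ae ?_
      filter_upwards [hp1] with x hx
      rw [hx, PiLp.smul_apply, smul_eq_mul]
      ring
    have e2 : ∫ x, p.2 j x i * ψ x ∂cellMeasure = a * ∫ x, fderiv ℝ f x (e j) * ψ x := by
      rw [← hfull _ fun x hx => by rw [hf'0 x hx, zero_apply, zero_mul], ← integral_const_mul]
      refine integral_congr_ae ?_
      filter_upwards [hp2] with x hx
      rw [hx, PiLp.smul_apply, smul_eq_mul]
      ring
    rw [e1, e2, integral_mul_fderiv_eq_neg_fderiv_mul_of_integrable _ _ _
      (fun x _ => hfd x) (fun x _ => hψd x), mul_neg]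
    · exact ((hf'c j).mul hψ.continuous).integrable_of_hasCompactSupport
        (hfc.fderiv_apply ℝ (e j)).mul_right
    · exact (hfs.continuous.mul hψc).integrable_of_hasCompactSupport hfc.mul_right
    · exact (hfs.continuous.mul hψ.continuous).integrable_of_hasCompactSupport hfc.mul_right
  have hcurl : ∀ᵐ x ∂cellMeasure, x ∉ U → curl p x = 0 := by
    filter_upwards [hp2] with x hx hxU
    simp only [curl, hx, hf'0 x hxU, zero_apply, zero_smul]
    ext i
    fin_cases i <;> simp
  refine ⟨curlL p, curlL_mem_curlSpace hpW hcurl, fun h0 => ?_⟩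
  have h1 : ∀ᵐ x : E3, fderiv ℝ f x (e 0) = 0 := by
    have h2 : ∀ᵐ x ∂cellMeasure, fderiv ℝ f x (e 0) = 0 := by
      have h3 := Lp.eq_zero_iff_ae_eq_zero.1 h0
      filter_upwards [h3, curlL_coe p, hp2] with x hx hc hx2
      rw [hc] at hx
      have := congrArg (fun v : C3 => v 1) hx
      simpa [curl, hx2] using this
    rw [cellMeasure, ae_restrict_iff' measurableSet_cell] at h2
    filter_upwards [h2] with x hx
    by_cases hxc : x ∈ cell
    · exact hx hxc
    · rw [hf'0 x fun h => hxc (hUc h), zero_apply]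
  have h2 : ∀ x, fderiv ℝ f x (e 0) = 0 := fun x =>
    congrFun (Measure.eq_of_ae_eq (g := fun _ => (0 : ℂ)) h1 (hf'c 0) continuous_const) x
  have h3 : ∀ t : ℝ, HasDerivAt (fun t : ℝ => f (x₀ + t • e 0)) 0 t := fun t => by
    have h4 := (hfd (x₀ + t • e 0)).hasFDerivAt.comp_hasDerivAt t
      (((hasDerivAt_id t).smul_const (e 0)).const_add x₀)
    exact h4.congr_deriv (by simp [h2])
  -- A zero curl would make the bump constant along the first axis, but it is 1 at its centre and 0
  -- at distance `r / 2`.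
  have h4 := is_const_of_deriv_eq_zero (fun t => (h3 t).differentiableAt)
    (fun t => (h3 t).deriv) 0 (r / 2)
  simp only [zero_smul, add_zero, hf] at h4
  rw [φ.one_of_mem_closedBall (Metric.mem_closedBall_self (by simp only [φ]; positivity)),
    φ.zero_of_le_dist] at h4
  · simp at h4
  · simp only [φ, dist_self_add_left, norm_smul, e, PiLp.norm_single, norm_one, mul_one]
    exact le_abs_self _

lemma curlSpace_mono {U D : Set E3} (h : U ⊆ D) : curlSpace U ≤ curlSpace D := fun w hw =>
  ⟨hw.1, hw.2.1, by filter_upwards [hw.2.2] with x hx hxD using hx fun hxU => hxD (h hxU)⟩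

/-- Infinitely many disjoint open pieces of `D` carry nonzero curls; disjoint supports make them
orthogonal. -/
lemma not_finiteDimensional_curlSpace {D : Set E3} (hD : IsOpen D) (hne : D.Nonempty)
    (hDc : D ⊆ cell) : ¬ FiniteDimensional ℂ (curlSpace D) := by
  intro hfin
  have hinf : Infinite D := by
    obtain ⟨x, hx⟩ := hne
    exact (infinite_of_mem_nhds x (hD.mem_nhds hx)).to_subtype
  obtain ⟨U, hUinf, hUo, hUd⟩ := exists_seq_infinite_isOpen_pairwise_disjoint D
  have hsub : ∀ n, (↑) '' U n ⊆ D := fun n => Subtype.coe_image_subset D (U n)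
  choose w hw hw0 using fun n => exists_mem_curlSpace_ne_zero
    (hD.isOpenMap_subtype_val _ (hUo n)) ((hUinf n).nonempty.image _) ((hsub n).trans hDc)
  have horth : Pairwise fun m n => inner ℂ (w m) (w n) = 0 := fun m n hmn => by
    change inner ℂ (w m) (w n) = 0
    rw [L2.inner_def]
    refine integral_eq_zero_of_ae ?_
    filter_upwards [(hw m).2.2, (hw n).2.2] with x h1 h2
    by_cases hx : x ∈ ((↑) '' U m : Set E3)
    · have : x ∉ ((↑) '' U n : Set E3) := fun h =>
        (Set.disjoint_image_iff Subtype.val_injective |>.2 (hUd hmn)).le_bot ⟨hx, h⟩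
      rw [h2 this, inner_zero_right]; rfl
    · rw [h1 hx, inner_zero_left]; rfl
  have hli : LinearIndependent ℂ fun n => (⟨w n, curlSpace_mono (hsub n) (hw n)⟩ : curlSpace D) :=
    linearIndependent_of_ne_zero_of_inner_eq_zero (fun n h => hw0 n (congrArg Subtype.val h))
      fun m n hmn => horth hmn
  exact absurd hli.finite (not_finite_iff_infinite.2 inferInstance)

/-! ### The space `chi0 D` in terms of curls -/

/-- The constant fields, as jets. -/
def constJet : C3 →L[ℂ] Jet :=
  (waveL 0).toContinuousLinearMap.prod 0

lemma constJet_fst (a : C3) : (constJet a).1 = wave 0 a := rfl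

lemma constJet_snd (a : C3) : (constJet a).2 = 0 := rfl

lemma W12_add {p q : Jet} (hp : p ∈ W12) (hq : q ∈ W12) : p + q ∈ W12 := by
  rw [mem_W12_iff] at *
  intro j k
  simp only [Prod.snd_add, Prod.fst_add, Pi.add_apply, map_add, hp j k, hq j k, smul_add]

lemma coeffL_wave (k l : Fin 3 → ℤ) (a : C3) :
    coeffL k (wave l a) = if l = k then a else 0 := by
  rw [coeffL_apply, coeff_wave]

lemma constJet_mem_W12 (a : C3) : constJet a ∈ W12 := by
  rw [mem_W12_iff]
  intro j k
  rw [constJet_fst, constJet_snd, coeffL_wave]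
  by_cases hk : 0 = k
  · subst hk; simp
  · simp [hk]

lemma curlL_constJet (a : C3) : curlL (constJet a) = 0 := by
  refine coeffL_ext fun k => ?_
  rw [coeffL_curlL (constJet_mem_W12 a), constJet_fst, coeffL_wave]
  by_cases hk : 0 = k
  · subst hk
    ext i
    fin_cases i <;> simp [crossL_apply, waveVec]
  · simp [hk]

lemma dot_coeffL_wave (k : Fin 3 → ℤ) (a : C3) :
    ∑ i, waveVec k i * coeffL k (wave 0 a) i = 0 := by
  rw [coeffL_wave]
  by_cases hk : 0 = k
  · subst hk; simp [waveVec]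
  · simp [hk]

lemma curl_eq_zero_off {D : Set E3} {p : Jet} (h : curlL p ∈ curlSpace D) :
    ∀ᵐ x ∂cellMeasure, x ∉ D → curl p x = 0 := by
  filter_upwards [h.2.2, curlL_coe p] with x hx hc hxD
  rw [← hc, hx hxD]

section Auxiliary

variable {D : Set E3} (g : L2V →L[ℂ] C3)

/-- The restriction of the Biot-Savart operator to the space of curls. -/
def restrictedBiotSavart (D : Set E3) : curlSpace D →L[ℂ] L2V :=
  biotSavart ∘L (curlSpace D).subtypeL

/-- The geometric average of the field with given curl and mean zero. -/
def averageOfCurl (D : Set E3) : curlSpace D →L[ℂ] C3 := g ∘L restrictedBiotSavart D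

/-- The field of `chi0 D` with given curl, as a jet. -/
def fieldJet (D : Set E3) : curlSpace D →L[ℂ] Jet :=
  biotSavartJet ∘L (curlSpace D).subtypeL - constJet ∘L averageOfCurl g D

/-- The field of `chi0 D` with given curl. -/
def field (D : Set E3) : curlSpace D →L[ℂ] L2V :=
  restrictedBiotSavart D - (waveL 0).toContinuousLinearMap ∘L averageOfCurl g D

lemma fieldJet_apply (w : curlSpace D) :
    fieldJet g D w = biotSavartJet w + constJet (-averageOfCurl g D w) := by
  rw [map_neg, ← sub_eq_add_neg]; rfl

lemma fieldJet_fst (w : curlSpace D) : (fieldJet g D w).1 = field g D w := rfl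

lemma fieldJet_mem_W12 (w : curlSpace D) : fieldJet g D w ∈ W12 := by
  rw [fieldJet_apply]
  exact W12_add (biotSavartJet_mem_W12 _) (constJet_mem_W12 _)

lemma curlL_fieldJet (w : curlSpace D) : curlL (fieldJet g D w) = w := by
  rw [fieldJet_apply, map_add, curlL_constJet, add_zero, curlL_biotSavartJet w.2]

lemma fieldJet_mem_F (w : curlSpace D) : fieldJet g D w ∈ F D := by
  refine ⟨fieldJet_mem_W12 g w, ?_, curl_eq_zero_off (by rw [curlL_fieldJet]; exact w.2)⟩
  rw [divergence_eq_zero_iff (fieldJet_mem_W12 g w)]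
  intro k
  have h1 := (divergence_eq_zero_iff (biotSavartJet_mem_W12 w)).1 (biotSavartJet_mem_J w.1).2.1 k
  rw [fieldJet_apply]
  simp only [Prod.fst_add, map_add, PiLp.add_apply, mul_add, Finset.sum_add_distrib, h1,
    constJet_fst, dot_coeffL_wave, add_zero]

lemma coeffL_zero_biotSavart (f : L2V) : coeffL 0 (biotSavart f) = 0 := by
  have h := (biotSavartJet_mem_J f).2.2
  rwa [mean_eq] at h

lemma mean_field (w : curlSpace D) : mean (field g D w) = -averageOfCurl g D w := by
  rw [mean_eq]
  change coeffL 0 (biotSavart w - wave 0 (averageOfCurl g D w)) = _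
  rw [map_sub, coeffL_zero_biotSavart, coeffL_wave, if_pos rfl, zero_sub]

lemma biotSavart_injective {w : L2V} (hw : w ∈ curlSpace D) (h : biotSavart w = 0) : w = 0 := by
  have h1 : biotSavartJet w = 0 := by
    refine W12_ext (biotSavartJet_mem_W12 w) (mem_W12_iff.2 fun j k => by simp) ?_
    rw [biotSavartJet_fst, h]; rfl
  rw [← curlL_biotSavartJet hw, h1, map_zero]

/-- Biot–Savart fields have mean zero and are orthogonal to constants, so the cross terms vanish.
The second summand is the source of the finite rank term. -/
lemma inner_field (v w : curlSpace D) : inner ℂ (field g D v) (field g D w) =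
    inner ℂ (restrictedBiotSavart D v) (restrictedBiotSavart D w) +
      inner ℂ (averageOfCurl g D v) (averageOfCurl g D w) := by
  change inner ℂ (biotSavart v - wave 0 _) (biotSavart w - wave 0 _) = _
  have h1 : ∀ (a : C3) (f : L2V), inner ℂ (wave 0 a) (biotSavart f) = 0 := fun a f => by
    rw [inner_wave_left, ← coeffL_apply, coeffL_zero_biotSavart, inner_zero_right]
  have h2 : ∀ (a : C3) (f : L2V), inner ℂ (biotSavart f) (wave 0 a) = 0 := fun a f => by
    rw [← inner_conj_symm, h1, map_zero]
  have h3 : ∀ a b : C3, inner ℂ (wave 0 a) (wave 0 b) = inner ℂ a b := fun a b => by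
    rw [inner_wave_left, coeff_wave, if_pos rfl]
  rw [inner_sub_left, inner_sub_right, inner_sub_right, h1, h2, h3]
  simp only [sub_zero, zero_sub, sub_neg_eq_add]
  rfl

end Auxiliary

/-! ### The auxiliary operator and its finite rank perturbation -/

section Operators

variable {D : Set E3} [CompleteSpace (curlSpace D)] (g : L2V →L[ℂ] C3)

/-- The operator of the auxiliary problem in terms of curls. -/
def auxOperator (D : Set E3) [CompleteSpace (curlSpace D)] : curlSpace D →L[ℂ] curlSpace D :=
  (field g D).adjoint ∘L field g D

lemma inner_auxOperator (v w : curlSpace D) :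
    inner ℂ v (auxOperator g D w) = inner ℂ (field g D v) (field g D w) := by
  change inner ℂ v ((field g D).adjoint (field g D w)) = _
  rw [ContinuousLinearMap.adjoint_inner_right]

lemma isSymmetric_auxOperator :
    (auxOperator g D : curlSpace D →ₗ[ℂ] curlSpace D).IsSymmetric :=
  (ContinuousLinearMap.isPositive_adjoint_comp_self (field g D)).isSymmetric

lemma inner_auxOperator_pos (w : curlSpace D) (hw : w ≠ 0) :
    0 < (inner ℂ w (auxOperator g D w)).re := by
  rw [inner_auxOperator, inner_field, Complex.add_re]
  have h1 : (0 : ℝ) < (inner ℂ (restrictedBiotSavart D w) (restrictedBiotSavart D w)).re := by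
    have : restrictedBiotSavart D w ≠ 0 := fun h =>
      hw (Subtype.ext (biotSavart_injective w.2 h))
    have h : RCLike.re (inner ℂ (restrictedBiotSavart D w) (restrictedBiotSavart D w)) = _ :=
      inner_self_eq_norm_sq (restrictedBiotSavart D w)
    exact (pow_pos (norm_pos_iff.2 this) 2).trans_eq h.symm
  have h2 : 0 ≤ (inner ℂ (averageOfCurl g D w) (averageOfCurl g D w)).re :=
    inner_self_nonneg (𝕜 := ℂ) (x := averageOfCurl g D w)
  linarith

omit [CompleteSpace (curlSpace D)] in
lemma isCompactOperator_restrictedBiotSavart : IsCompactOperator (restrictedBiotSavart D) :=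
  isCompactOperator_biotSavart.comp_clm _

lemma isCompactOperator_auxOperator : IsCompactOperator (auxOperator g D) := by
  have h1 : IsCompactOperator ((waveL 0).toContinuousLinearMap ∘L averageOfCurl g D) :=
    isCompactOperator_restrictedBiotSavart.clm_comp ((waveL 0).toContinuousLinearMap ∘L g)
  exact (isCompactOperator_restrictedBiotSavart.sub h1).clm_comp (field g D).adjoint

lemma auxOperator_sub (w : curlSpace D) :
    auxOperator g D w - (averageOfCurl g D).adjoint (averageOfCurl g D w) =
      (restrictedBiotSavart D).adjoint (restrictedBiotSavart D w) := by
  refine ext_inner_left ℂ fun v => ?_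
  rw [inner_sub_right, inner_auxOperator, inner_field, ContinuousLinearMap.adjoint_inner_right,
    ContinuousLinearMap.adjoint_inner_right, add_sub_cancel_right]


end Operators

section ChiZero

variable {D : Set E3} {g : L2V →L[ℂ] C3}

/-- After subtraction of its mean, a field is the Biot–Savart field of its curl; vanishing geometric
average then fixes the constant. -/
lemma mem_chi0_iff {γ : ℝ≥0} (hD : IsInclusion γ D) (hg0 : ∀ a, g (wave 0 a) = a)
    (hg : ∀ p, IsCurlFreeOff D p → HasGeometricAverage D p.1 (g p.1)) {p : Jet} :
    p ∈ chi0 D ↔ ∃ w : curlSpace D, fieldJet g D w = p := by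
  constructor
  · rintro ⟨hp, h0⟩
    set q : Jet := p + constJet (-mean p.1) with hq
    have hqW : q ∈ W12 := W12_add hp.1 (constJet_mem_W12 _)
    have hqc : curlL q = curlL p := by rw [hq, map_add, curlL_constJet, add_zero]
    have hqJ : q ∈ J := by
      refine ⟨hqW, ?_, ?_⟩
      · rw [divergence_eq_zero_iff hqW]
        intro k
        have h1 := (divergence_eq_zero_iff hp.1).1 hp.2.1 k
        simp only [hq, Prod.fst_add, map_add, PiLp.add_apply, mul_add, Finset.sum_add_distrib, h1,
          constJet_fst, dot_coeffL_wave, add_zero]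
      · rw [mean_eq, hq, Prod.fst_add, map_add, constJet_fst, coeffL_wave, if_pos rfl, mean_eq,
          add_neg_cancel]
    have hw := curlL_mem_curlSpace hp.1 hp.2.2
    refine ⟨⟨curlL p, hw⟩, ?_⟩
    have h2 : biotSavartJet (curlL p) = q := by rw [← hqc, biotSavart_curlL hqJ]
    have h3 : g p.1 = 0 := (hg p ⟨hp.1, hp.2.2⟩).unique hD h0
    have h4 : averageOfCurl g D ⟨curlL p, hw⟩ = -mean p.1 := by
      change g (biotSavartJet (curlL p)).1 = _
      rw [h2, hq, Prod.fst_add, map_add, h3, constJet_fst, hg0, zero_add]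
    rw [fieldJet_apply, h4, h2, hq, add_assoc, ← map_add, add_neg_cancel, map_zero, add_zero]
  · rintro ⟨w, rfl⟩
    have hF := fieldJet_mem_F g w
    refine ⟨hF, ?_⟩
    have h := hg _ ⟨hF.1, hF.2.2⟩
    have h0 : g (fieldJet g D w).1 = 0 := by
      change g (biotSavart w - wave 0 (g (biotSavart w))) = 0
      rw [map_sub, hg0, sub_self]
    rwa [h0] at h

end ChiZero

/-! ### The auxiliary eigenvalue problem in terms of curls -/

section Eigenpairs

lemma inner_smul_right_curlSpace {D : Set E3} (x y : curlSpace D) (a : ℂ) :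
    inner ℂ x (a • y) = a * inner ℂ x y := inner_smul_right x y a

lemma inner_smul_left_curlSpace {D : Set E3} (x y : curlSpace D) (a : ℂ) :
    inner ℂ (a • x) y = starRingEnd ℂ a * inner ℂ x y := inner_smul_left x y a

variable {D : Set E3} [CompleteSpace (curlSpace D)] {g : L2V →L[ℂ] C3}

/-- The curl parametrizes `chi0 D`, the curl form is the inner product of the curls, and the L² form
is represented by `auxOperator`. -/
lemma isEigenpair_fieldJet_iff (hchi : ∀ p, p ∈ chi0 D ↔ ∃ w : curlSpace D, fieldJet g D w = p)
    {w : curlSpace D} {β : ℝ} : IsEigenpair D (fieldJet g D w) β ↔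
      0 < β ∧ w ≠ 0 ∧ auxOperator g D w = (β : ℂ) • w := by
  have hform : ∀ v : curlSpace D,
      (l2Form (fieldJet g D w).1 (fieldJet g D v).1 =
        β * curlForm (fieldJet g D w) (fieldJet g D v)) ↔
      inner ℂ v (auxOperator g D w) = inner ℂ v ((β : ℂ) • w) := fun v => by
    rw [l2Form_eq, curlForm_eq, curlL_fieldJet, curlL_fieldJet, inner_auxOperator,
      inner_smul_right_curlSpace]
    rfl
  have h0 : (fieldJet g D w).1 ≠ 0 ↔ w ≠ 0 := by
    refine not_congr ⟨fun h => ?_, fun h => by rw [h, map_zero]; rfl⟩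
    have h1 : fieldJet g D w = 0 :=
      W12_ext (fieldJet_mem_W12 g w) (mem_W12_iff.2 fun j k => by simp) h
    refine Subtype.ext ?_
    rw [← curlL_fieldJet g w, h1, map_zero]; rfl
  constructor
  · rintro ⟨hβ, -, hne, h⟩
    exact ⟨hβ, h0.1 hne, ext_inner_left ℂ fun v => (hform v).1 (h _ ((hchi _).2 ⟨v, rfl⟩))⟩
  · rintro ⟨hβ, hne, h⟩
    refine ⟨hβ, (hchi _).2 ⟨w, rfl⟩, h0.2 hne, fun p hp => ?_⟩
    obtain ⟨v, rfl⟩ := (hchi p).1 hp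
    exact (hform v).2 (by rw [h])

/-- Since `(uₘ, uₙ) = βₙ ⟨wₘ, wₙ⟩` up to the order of arguments, L²-orthonormal eigenfunctions have
curls that become orthonormal after multiplication by `√βₙ`. This accounts for the factor `βₙ⁻¹` in
the formula for the means. -/
lemma exists_hilbertBasis_of_eigenSystem
    (hchi : ∀ p, p ∈ chi0 D ↔ ∃ w : curlSpace D, fieldJet g D w = p) (S : EigenSystem D) :
    ∃ ψ : HilbertBasis ℕ ℂ (curlSpace D),
      (∀ n, auxOperator g D (ψ n) = (S.β n : ℂ) • ψ n) ∧
      ∀ n i j, mean (S.u n).1 i * starRingEnd ℂ (mean (S.u n).1 j) = ((S.β n : ℂ))⁻¹ *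
        (averageOfCurl g D (ψ n) i * starRingEnd ℂ (averageOfCurl g D (ψ n) j)) := by
  choose w hw using fun n => (hchi _).1 (S.eigenpair n).2.1
  have hew : ∀ n, 0 < S.β n ∧ w n ≠ 0 ∧ auxOperator g D (w n) = (S.β n : ℂ) • w n := fun n =>
    (isEigenpair_fieldJet_iff hchi).1 (by rw [hw]; exact S.eigenpair n)
  set c : ℕ → ℂ := fun n => ((√(S.β n) : ℝ) : ℂ) with hc
  have hcc : ∀ n, c n * c n = S.β n := fun n => by
    simp only [hc]
    rw [← Complex.ofReal_mul, Real.mul_self_sqrt (hew n).1.le]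
  have hcr : ∀ n, starRingEnd ℂ (c n) = c n := fun n => Complex.conj_ofReal _
  have hc0 : ∀ n, c n ≠ 0 := fun n h => by
    have := hcc n
    rw [h, mul_zero] at this
    exact (hew n).1.ne' (by exact_mod_cast this.symm)
  have hinner : ∀ m n, (S.β n : ℂ) * inner ℂ (w m) (w n) = if m = n then 1 else 0 := fun m n => by
    rw [← orthonormal_iff_ite.1 S.orthonormal m n, ← hw m, ← hw n, fieldJet_fst, fieldJet_fst,
      ← inner_auxOperator, (hew n).2.2, inner_smul_right_curlSpace]
  have ho : Orthonormal ℂ fun n => c n • w n := by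
    rw [orthonormal_iff_ite]
    intro m n
    rw [inner_smul_left_curlSpace, inner_smul_right_curlSpace, hcr]
    have h := hinner m n
    by_cases hmn : m = n
    · subst hmn
      rw [← h, ← hcc]; ring
    · rw [if_neg hmn] at h ⊢
      have hβ : (S.β n : ℂ) ≠ 0 := by exact_mod_cast (hew n).1.ne'
      rw [(mul_eq_zero.1 h).resolve_left hβ, mul_zero, mul_zero]
  have hbot : (Submodule.span ℂ (Set.range fun n => c n • w n))ᗮ = ⊥ := by
    rw [Submodule.eq_bot_iff]
    intro x hx
    have hxw : ∀ n, inner ℂ (x : L2V) (w n : L2V) = 0 := fun n => by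
      have h1 := Submodule.inner_left_of_mem_orthogonal
        (Submodule.subset_span (Set.mem_range_self n)) hx
      rw [inner_smul_right_curlSpace] at h1
      exact (mul_eq_zero.1 h1).resolve_left (hc0 n)
    -- Pairing the curl with `x` is continuous in the `W^{1,2}` norm and kills all eigenfunctions,
    -- hence by density also the field with curl `x`.
    set T : Jet →L[ℂ] ℂ := innerSL ℂ (x : L2V) ∘L curlL with hT
    have hspan : Submodule.span ℂ (Set.range S.u) ≤ T.ker := by
      rw [Submodule.span_le]
      rintro _ ⟨n, rfl⟩
      change inner ℂ (x : L2V) (curlL (S.u n)) = 0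
      rw [← hw n, curlL_fieldJet, hxw]
    have hcl : IsClosed (T.ker : Set Jet) := T.isClosed_ker
    have hmem := closure_minimal hspan hcl (S.dense ((hchi _).2 ⟨x, rfl⟩))
    have h2 : inner ℂ (x : L2V) (curlL (fieldJet g D x)) = 0 := hmem
    rw [curlL_fieldJet] at h2
    exact Subtype.ext (inner_self_eq_zero.1 h2)
  refine ⟨HilbertBasis.mkOfOrthogonalEqBot ho hbot, fun n => ?_, fun n i j => ?_⟩
  · rw [HilbertBasis.coe_mkOfOrthogonalEqBot, map_smul, (hew n).2.2, smul_comm]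
  · rw [HilbertBasis.coe_mkOfOrthogonalEqBot, ← hw n, fieldJet_fst, mean_field]
    simp only [map_smul, PiLp.smul_apply, PiLp.neg_apply, smul_eq_mul, map_mul, map_neg, hcr]
    have hβ : (S.β n : ℂ) ≠ 0 := by exact_mod_cast (hew n).1.ne'
    rw [eq_inv_mul_iff_mul_eq₀ hβ, ← hcc]
    ring

lemma nonempty_eigenSystem
    (hchi : ∀ p, p ∈ chi0 D ↔ ∃ w : curlSpace D, fieldJet g D w = p)
    (hinf : ¬ FiniteDimensional ℂ (curlSpace D)) : Nonempty (EigenSystem D) := by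
  obtain ⟨ψ, β, hβ, hψ⟩ := exists_eigenbasis (isCompactOperator_auxOperator g)
    (isSymmetric_auxOperator g) (inner_auxOperator_pos g) hinf
  set c : ℕ → ℂ := fun n => (((√(β n))⁻¹ : ℝ) : ℂ) with hc
  have hcc : ∀ n, c n * c n = (β n : ℂ)⁻¹ := fun n => by
    simp only [hc]
    rw [← Complex.ofReal_mul, ← mul_inv, Real.mul_self_sqrt (hβ n).le, Complex.ofReal_inv]
  have hcr : ∀ n, starRingEnd ℂ (c n) = c n := fun n => Complex.conj_ofReal _
  have hβ0 : ∀ n, (β n : ℂ) ≠ 0 := fun n => by exact_mod_cast (hβ n).ne'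
  have hc0 : ∀ n, c n ≠ 0 := fun n h => by
    have := hcc n
    rw [h, mul_zero] at this
    exact inv_ne_zero (hβ0 n) this.symm
  refine ⟨⟨fun n => fieldJet g D (c n • ψ n), β, fun n => ?_, ?_, ?_⟩⟩
  · refine (isEigenpair_fieldJet_iff hchi).2 ⟨hβ n, smul_ne_zero (hc0 n) ?_, ?_⟩
    · exact ψ.orthonormal.ne_zero n
    · rw [map_smul, hψ, smul_comm]
  · rw [orthonormal_iff_ite]
    intro m n
    simp only [fieldJet_fst]
    rw [← inner_auxOperator, map_smul, hψ, inner_smul_left_curlSpace, inner_smul_right_curlSpace, inner_smul_right_curlSpace,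
      orthonormal_iff_ite.1 ψ.orthonormal, hcr]
    by_cases hmn : m = n
    · subst hmn
      rw [if_pos rfl, mul_one, ← mul_assoc, hcc, inv_mul_cancel₀ (hβ0 m)]
    · rw [if_neg hmn, mul_zero, mul_zero, mul_zero]
  · intro p hp
    obtain ⟨w, rfl⟩ := (hchi p).1 hp
    have hw : w ∈ closure (Submodule.span ℂ (Set.range ψ) : Set (curlSpace D)) := by
      have h := ψ.dense_span
      rw [← Submodule.topologicalClosure_coe, h]
      exact Submodule.mem_top
    -- The bounded map `fieldJet` carries the dense span in `curlSpace D` to one that is dense in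
    -- `chi0 D`.
    refine closure_mono ?_ (image_closure_subset_closure_image (fieldJet g D).continuous
      ⟨w, hw, rfl⟩)
    rintro _ ⟨v, hv, rfl⟩
    refine Submodule.span_induction (p := fun v _ => fieldJet g D v ∈ Submodule.span ℂ
      (Set.range fun n => fieldJet g D (c n • ψ n))) ?_ ?_ ?_ ?_ hv
    · rintro _ ⟨n, rfl⟩
      have h : ψ n = (c n)⁻¹ • (c n • ψ n) := by rw [smul_smul, inv_mul_cancel₀ (hc0 n), one_smul]
      rw [h, map_smul]
      exact Submodule.smul_mem _ _ (Submodule.subset_span ⟨n, rfl⟩)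
    · rw [map_zero]; exact Submodule.zero_mem _
    · intro x y _ _ hx hy
      rw [map_add]; exact Submodule.add_mem _ hx hy
    · intro a x _ hx
      rw [map_smul]; exact Submodule.smul_mem _ _ hx

end Eigenpairs

/-! ### The spectrum of the limit operator -/

section Spectrum

variable {D : Set E3} [CompleteSpace (curlSpace D)]

/-- By symmetry of Biot–Savart, the adjoint of its restriction is Biot–Savart followed by the
orthogonal projection. -/
lemma limitOperator_apply (hD : IsOpen D) (f : L2V) :
    limitOperator hD f = restrictedBiotSavart D ((restrictedBiotSavart D).adjoint f) := by
  have h : (restrictedBiotSavart D).adjoint f =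
      (curlSpace D).orthogonalProjectionOnto (biotSavart f) := by
    refine ext_inner_left ℂ fun v => ?_
    rw [ContinuousLinearMap.adjoint_inner_right]
    change inner ℂ (biotSavart v) f = _
    rw [isSymmetric_biotSavart, Submodule.inner_orthogonalProjectionOnto_eq_of_mem_left]
  rw [h]
  rfl

omit [CompleteSpace (curlSpace D)] in
lemma isCompactOperator_limitOperator (hD : IsOpen D) : IsCompactOperator (limitOperator hD) :=
  isCompactOperator_biotSavart.comp_clm _

omit [CompleteSpace (curlSpace D)] in
lemma zero_mem_spectrum_limitOperator (hD : IsOpen D) : (0 : ℂ) ∈ spectrum ℂ (limitOperator hD) := by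
  rw [spectrum.zero_mem_iff]
  intro hu
  obtain ⟨T, hT⟩ := hu.exists_left_inv
  set a : C3 := EuclideanSpace.single 0 1
  have h1 : biotSavart (wave 0 a) = 0 := by
    refine coeffL_ext fun k => ?_
    rw [hasSymbol_biotSavart, coeffL_wave]
    by_cases hk : 0 = k
    · subst hk; simp [biotSavartSymbol, lenSq]
    · simp [hk]
  have h2 : limitOperator hD (wave 0 a) = 0 := by
    simp only [limitOperator, ContinuousLinearMap.comp_apply, h1, map_zero]
  have h3 : wave 0 a = 0 := by
    have := congrArg (fun X : L2V →L[ℂ] L2V => X (wave 0 a)) hT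
    simpa [h2] using this.symm
  have h4 := (waveL 0).injective ((h3 : waveL 0 a = 0).trans (waveL 0).map_zero.symm)
  simpa [a] using congrArg (fun v : C3 => v 0) h4

/-- `B B*` and `B* B` have the same nonzero eigenvalues, with `B*` and `B` carrying eigenvectors
across; compactness makes the nonzero spectrum consist of eigenvalues. -/
lemma mem_spectrum_limitOperator_iff (hD : IsOpen D) {z : ℂ} (hz : z ≠ 0) :
    z ∈ spectrum ℂ (limitOperator hD) ↔ ∃ w ≠ 0,
      (restrictedBiotSavart D).adjoint (restrictedBiotSavart D w) = z • w := by
  rw [← (isCompactOperator_limitOperator hD).hasEigenvalue_iff_mem_spectrum hz]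
  constructor
  · intro h
    obtain ⟨u, hu, hu0⟩ := h.exists_hasEigenvector
    have h1 : limitOperator hD u = z • u := Module.End.mem_eigenspace_iff.1 hu
    rw [limitOperator_apply] at h1
    refine ⟨(restrictedBiotSavart D).adjoint u, fun h => ?_, by rw [h1, map_smul]⟩
    rw [h, map_zero] at h1
    exact smul_ne_zero hz hu0 h1.symm
  · rintro ⟨w, hw0, hw⟩
    refine Module.End.hasEigenvalue_of_hasEigenvector (x := restrictedBiotSavart D w)
      ⟨Module.End.mem_eigenspace_iff.2 ?_, fun h => ?_⟩
    · change limitOperator hD _ = _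
      rw [limitOperator_apply, hw, map_smul]
    · rw [h, map_zero] at hw
      exact smul_ne_zero hz hw0 hw.symm

end Spectrum

end PhotonicCrystal

end

/-! ### The spectrum of the limit operator -/

theorem mainTheorem10 (γ : ℝ≥0) (hγ : 0 < γ) (D : Set PhotonicCrystal.E3)
    (hD : PhotonicCrystal.IsInclusion γ D) :
    (∃! A : PhotonicCrystal.L2V →L[ℂ] PhotonicCrystal.L2V,
      PhotonicCrystal.IsLimitOperator D A) ∧
    Nonempty (PhotonicCrystal.EigenSystem D) ∧
    ∀ A : PhotonicCrystal.L2V →L[ℂ] PhotonicCrystal.L2V,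
      PhotonicCrystal.IsLimitOperator D A →
    ∀ S : PhotonicCrystal.EigenSystem D,
      spectrum ℂ A =
        {0} ∪ {z : ℂ | ∃ β ∈ PhotonicCrystal.meanZeroEigenvalues D, z = (β : ℂ)} ∪
          {z : ℂ | ∃ ν : ℂ, PhotonicCrystal.IsRoot S ν ∧ z = ν⁻¹} := by
  have : CompleteSpace (PhotonicCrystal.curlSpace D) :=
    (PhotonicCrystal.isClosed_curlSpace hD.isOpen).completeSpace_coe
  obtain ⟨g, hg0, hg⟩ := PhotonicCrystal.exists_geometricAverage hD
  have hchi : ∀ p, p ∈ PhotonicCrystal.chi0 D ↔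
      ∃ w : PhotonicCrystal.curlSpace D, PhotonicCrystal.fieldJet g D w = p :=
    fun p => PhotonicCrystal.mem_chi0_iff hD hg0 hg
  refine ⟨⟨PhotonicCrystal.limitOperator hD.isOpen,
    (PhotonicCrystal.isLimitOperator_iff hD.isOpen).2 rfl,
    fun A hA => (PhotonicCrystal.isLimitOperator_iff hD.isOpen).1 hA⟩,
    PhotonicCrystal.nonempty_eigenSystem hchi
      (PhotonicCrystal.not_finiteDimensional_curlSpace hD.isOpen hD.nonempty
        (subset_closure.trans hD.closure_subset_cell)), fun A hA S => ?_⟩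
  rw [(PhotonicCrystal.isLimitOperator_iff hD.isOpen).1 hA]
  have h0 := PhotonicCrystal.zero_mem_spectrum_limitOperator hD.isOpen
  obtain ⟨ψ, hψ, hm⟩ := PhotonicCrystal.exists_hilbertBasis_of_eigenSystem hchi S
  have key : ∀ z : ℂ, z ≠ 0 →
      (z ∈ spectrum ℂ (PhotonicCrystal.limitOperator hD.isOpen) ↔
        (∃ β ∈ PhotonicCrystal.meanZeroEigenvalues D, z = (β : ℂ)) ∨
          ∃ ν : ℂ, PhotonicCrystal.IsRoot S ν ∧ z = ν⁻¹) := by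
    intro z hz
    rw [PhotonicCrystal.mem_spectrum_limitOperator_iff hD.isOpen hz]
    simp_rw [← PhotonicCrystal.auxOperator_sub g]
    rw [PhotonicCrystal.eigenvalue_perturbation_iff
      (PhotonicCrystal.isCompactOperator_auxOperator g)
      (PhotonicCrystal.isSymmetric_auxOperator g) (PhotonicCrystal.inner_auxOperator_pos g)
      (fun n => (S.eigenpair n).1.ne') hψ hm hz]
    -- `IsRoot S` is by definition `TensorRoot` for the means of the eigenfunctions, so only the
    -- mean zero eigenvalues need translation.
    refine or_congr ⟨?_, ?_⟩ Iff.rfl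
    · rintro ⟨b, hb, rfl, w, hw0, hw, hG⟩
      refine ⟨b, ⟨PhotonicCrystal.fieldJet g D w,
        (PhotonicCrystal.isEigenpair_fieldJet_iff hchi).2 ⟨hb, hw0, hw⟩, ?_⟩, rfl⟩
      rw [PhotonicCrystal.fieldJet_fst, PhotonicCrystal.mean_field, hG, neg_zero]
    · rintro ⟨b, ⟨u, hu, hmu⟩, rfl⟩
      obtain ⟨w, rfl⟩ := (hchi u).1 hu.2.1
      obtain ⟨hb, hw0, hw⟩ := (PhotonicCrystal.isEigenpair_fieldJet_iff hchi).1 hu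
      refine ⟨b, hb, rfl, w, hw0, hw, ?_⟩
      rwa [PhotonicCrystal.fieldJet_fst, PhotonicCrystal.mean_field, neg_eq_zero] at hmu
  ext z
  by_cases hz : z = 0
  · subst hz
    exact ⟨fun _ => Or.inl (Or.inl rfl), fun _ => h0⟩
  · rw [key z hz]
    constructor
    · rintro (h | h)
      · exact Or.inl (Or.inr h)
      · exact Or.inr h
    · rintro ((h | h) | h)
      · exact absurd h hz
      · exact Or.inl h
      · exact Or.inr h
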